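/- Let $L>0$, $I=(0,L)$, $a_0>0$, $a_1\in\mathbb R$ and $k\in\{0,1,2\}$. Let $f:[0,\infty)\to\mathbb R$ satisfy, for some constant $c_0>0$, $$f\in C^2([0,\infty)),\quad f'<0,\quad 0\le f''\le -c_0f',\quad f(0)>0,\quad \lim_{s\to\infty}f(s)=0,$$ and put $g=-f'$, $g_0=\int_0^\infty g(s)\,ds=f(0)$. Let $H_0=L^2(I)$, $H_1=H^1_0(I)$, $H_2=H^2_0(I)$, where $H_k$ is normed by $\|\partial_x^k v\|_{L^2(I)}$. Let $L_g$ be the space of (classes of) measurable $\eta:(0,\infty)\to H_k$ with $\|\eta\|_{L_g}^2=\int_0^\infty g(s)\|\partial_x^k\eta(s)\|_{L^2(I)}^2ds<\infty$, and let $\mathcal H=L^2(I)\times L_g$ with $\|(u,\eta)\|_{\mathcal H}^2=\|u\|_{L^2(I)}^2+\|\eta\|_{L_g}^2$. Let $A$ be the linear operator in $\mathcal H$ given by $$A(u,\eta)=\Big(-\partial_x^3u+a_0\partial_x^5u-a_1\partial_xu-(-1)^k\int_0^\infty g(s)\,\partial_x^{2k}\eta(s)\,ds,\ \ u-\partial_s\eta\Big),$$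 $$D(A)=\{(u,\eta)\in\mathcal H:\ A(u,\eta)\in\mathcal H,\ u\in H^2_0(I),\ \partial_x^2u(L)=0,\ \eta(0)=0\},$$ with derivatives in the sense of distributions. For $T>0$ let $\mathcal B=C([0,T];L^2(I))\cap L^2(0,T;H^2(I))$ with the sum of the two norms. Then: (i) $A$ generates a $C_0$-semigroup of contractions $(S(t))_{t\ge0}$ on $\mathcal H$. For every $\Phi_0\in D(A)$ the problem $\Phi'(t)=A\Phi(t)$ $(t>0)$, $\Phi(0)=\Phi_0$, has a unique classical solution, i.e. a unique $\Phi\in C([0,\infty);\mathcal H)\cap C^1((0,\infty);\mathcal H)$ with $\Phi(t)\in D(A)$ for $t>0$ that solves it; it is $\Phi(t)=S(t)\Phi_0$ and lies in $C([0,\infty);D(A))\cap C^1([0,\infty);\mathcal H)$. For every $\Phi_0\in\mathcal H$ the problem has a unique mild solution, i.e. a unique $\Phi\in C([0,\infty);\mathcal H)$ such that for all $t\ge 0$, $\int_0^t\Phi(\tau)\,d\tau\in D(A)$ and $\Phi(t)=\Phi_0+A\int_0^t\Phi(\tau)\,d\tau$; it is $\Phi(t)=S(t)\Phi_0$. (ii)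 For every $T>0$ there is a constant $C>0$, depending only on $T$, $L$, $a_0$, $a_1$ and $g_0$, such that for every $\Phi_0\in\mathcal H$ the first component $u$ of $S(\cdot)\Phi_0=(u,\eta)$ belongs to $L^2(0,T;H^2(I))$ and $$\|u\|_{L^2(0,T;H^2(I))}^2\le C\,\|\Phi_0\|_{\mathcal H}^2 .$$ Moreover, the map $\Delta:\mathcal H\to\mathcal B\times C([0,T];L_g)$, $\Phi_0\mapsto S(\cdot)\Phi_0$, is continuous. -/

import Mathlib

open MeasureTheory Set Filter Topology
open scoped ContDiff

noncomputable section

namespace Kawahara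

/-! ### Sobolev spaces on the interval `I = (0, L)` -/

/-- `L²(I)` with `I = (0, L)`. -/
abbrev L2I (L : ℝ) : Type := Lp ℝ 2 (volume.restrict (Ioo 0 L))

/-- `φ ∈ C_c^∞(U)` for an open set `U ⊆ ℝ`. -/
structure IsTest (U : Set ℝ) (φ : ℝ → ℝ) : Prop where
  smooth : ContDiff ℝ ∞ φ
  compact : HasCompactSupport φ
  support : tsupport φ ⊆ U

/-- `v` is the weak derivative of `u` on `I`. -/
def IsWeakDeriv (L : ℝ) (u v : L2I L) : Prop :=
  ∀ φ : ℝ → ℝ, IsTest (Ioo 0 L) φ →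
    ∫ x in Ioo 0 L, u x * deriv φ x = -∫ x in Ioo 0 L, v x * φ x

/-- `u` has a representative that is continuous on `[0, L]` and takes the value `c` at `x`. -/
def HasTrace (L : ℝ) (u : L2I L) (x c : ℝ) : Prop :=
  ∃ r : ℝ → ℝ, ContinuousOn r (Icc 0 L) ∧ u =ᵐ[volume.restrict (Ioo 0 L)] r ∧ r x = c

theorem integrable_mul_test {L : ℝ} (u : L2I L) {φ : ℝ → ℝ} (hc : Continuous φ)
    (hs : HasCompactSupport φ) :
    Integrable (fun x => u x * φ x) (volume.restrict (Ioo 0 L)) :=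
  (Lp.memLp u).integrable_mul (q := 2) ((hc.memLp_of_hasCompactSupport hs).restrict _)

theorem IsTest.deriv {U : Set ℝ} {φ : ℝ → ℝ} (h : IsTest U φ) : IsTest U (deriv φ) where
  smooth := (contDiff_infty_iff_deriv.1 h.smooth).2
  compact := h.compact.deriv
  support := (tsupport_deriv_subset (f := φ)).trans h.support

theorem IsTest.iteratedDeriv {U : Set ℝ} {φ : ℝ → ℝ} (h : IsTest U φ) (n : ℕ) :
    IsTest U (iteratedDeriv n φ) := by
  induction n with
  | zero => simpa using h
  | succ n ih => rw [iteratedDeriv_succ]; exact ih.deriv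

theorem IsTest.integrable {L : ℝ} {U : Set ℝ} {φ : ℝ → ℝ} (h : IsTest U φ) (u : L2I L) :
    Integrable (fun x => u x * φ x) (volume.restrict (Ioo 0 L)) :=
  integrable_mul_test u h.smooth.continuous h.compact

theorem integral_add_mul {L : ℝ} (u v : L2I L) {U : Set ℝ} {φ : ℝ → ℝ} (h : IsTest U φ) :
    ∫ x in Ioo 0 L, (u + v : L2I L) x * φ x
      = (∫ x in Ioo 0 L, u x * φ x) + ∫ x in Ioo 0 L, v x * φ x := by
  rw [← integral_add (h.integrable u) (h.integrable v)]
  refine integral_congr_ae ?_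
  filter_upwards [Lp.coeFn_add u v] with x hx
  rw [hx, Pi.add_apply, add_mul]

theorem integral_smul_mul {L : ℝ} (c : ℝ) (u : L2I L) (φ : ℝ → ℝ) :
    ∫ x in Ioo 0 L, (c • u : L2I L) x * φ x = c * ∫ x in Ioo 0 L, u x * φ x := by
  rw [← integral_const_mul]
  refine integral_congr_ae ?_
  filter_upwards [Lp.coeFn_smul c u] with x hx
  rw [hx, Pi.smul_apply, smul_eq_mul, mul_assoc]

theorem integral_zero_mul {L : ℝ} (φ : ℝ → ℝ) :
    ∫ x in Ioo 0 L, (0 : L2I L) x * φ x = 0 := by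
  simpa using integral_smul_mul (L := L) 0 0 φ

theorem IsWeakDeriv.add {L : ℝ} {u v u' v' : L2I L} (h : IsWeakDeriv L u v)
    (h' : IsWeakDeriv L u' v') : IsWeakDeriv L (u + u') (v + v') := by
  intro φ hφ
  rw [integral_add_mul _ _ hφ.deriv, integral_add_mul _ _ hφ, h φ hφ, h' φ hφ]; ring

theorem IsWeakDeriv.smul {L : ℝ} {u v : L2I L} (c : ℝ) (h : IsWeakDeriv L u v) :
    IsWeakDeriv L (c • u) (c • v) := by
  intro φ hφ
  rw [integral_smul_mul, integral_smul_mul, h φ hφ]; ring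

theorem isWeakDeriv_zero (L : ℝ) : IsWeakDeriv L 0 0 := by
  intro φ _
  rw [integral_zero_mul, integral_zero_mul, neg_zero]

theorem HasTrace.add {L : ℝ} {u v : L2I L} {x c d : ℝ} (h : HasTrace L u x c)
    (h' : HasTrace L v x d) : HasTrace L (u + v) x (c + d) := by
  obtain ⟨r, hr, hu, rfl⟩ := h
  obtain ⟨s, hs, hv, rfl⟩ := h'
  exact ⟨r + s, hr.add hs, (Lp.coeFn_add u v).trans (hu.add hv), rfl⟩

theorem HasTrace.smul {L : ℝ} {u : L2I L} {x d : ℝ} (c : ℝ) (h : HasTrace L u x d) :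
    HasTrace L (c • u) x (c * d) := by
  obtain ⟨r, hr, hu, rfl⟩ := h
  exact ⟨c • r, hr.const_smul c, (Lp.coeFn_smul c u).trans (hu.const_smul c), rfl⟩

theorem hasTrace_zero (L x : ℝ) : HasTrace L 0 x 0 :=
  ⟨0, continuousOn_const, Lp.coeFn_zero _ _ _, rfl⟩

/-- An element of `L²(I)` that annihilates all test functions vanishes. -/
theorem eq_zero_of_test {L : ℝ} (u : L2I L)
    (h : ∀ φ : ℝ → ℝ, IsTest (Ioo 0 L) φ → ∫ x in Ioo 0 L, u x * φ x = 0) : u = 0 := by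
  have hi : IntegrableOn u (Ioo 0 L) volume := (Lp.memLp u).integrable (by norm_num)
  have := isOpen_Ioo.ae_eq_zero_of_integral_contDiff_smul_eq_zero (μ := volume) (U := Ioo 0 L)
    (f := fun x => u x) hi.locallyIntegrableOn (fun φ h1 h2 h3 => by
      have := h φ ⟨h1, h2, h3⟩
      refine Eq.trans (setIntegral_eq_integral_of_forall_compl_eq_zero (s := Ioo 0 L) ?_).symm
        (Eq.trans ?_ this)
      · intro x hx
        rw [image_eq_zero_of_notMem_tsupport (fun hx' => hx (h3 hx')), zero_smul]
      · exact integral_congr_ae (Eventually.of_forall fun x => mul_comm _ _))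
  refine Lp.ext ?_
  filter_upwards [(ae_restrict_iff' measurableSet_Ioo).2 this, Lp.coeFn_zero ℝ 2 (volume.restrict (Ioo 0 L))]
    with x h1 h2
  rw [h1, h2]; rfl

theorem IsWeakDeriv.eq_zero {L : ℝ} {v : L2I L} (h : IsWeakDeriv L 0 v) : v = 0 := by
  refine eq_zero_of_test v fun φ hφ => ?_
  have := h φ hφ
  rw [integral_zero_mul] at this
  linarith

/-- A test function of mean zero is the derivative of a test function. -/
theorem exists_primitive {L : ℝ} {χ : ℝ → ℝ} (h : IsTest (Ioo 0 L) χ) (h0 : ∫ x, χ x = 0) :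
    ∃ φ, IsTest (Ioo 0 L) φ ∧ deriv φ = χ := by
  rcases le_or_gt L 0 with hL | hL
  · refine ⟨χ, h, ?_⟩
    have : χ = 0 := by
      funext x
      exact image_eq_zero_of_notMem_tsupport fun hx => by
        have := h.support hx
        rw [Ioo_eq_empty (not_lt.2 hL)] at this
        exact this
    rw [this]; funext x; simp
  obtain ⟨a, b, hab, ha, hb⟩ : ∃ a b : ℝ, tsupport χ ⊆ Icc a b ∧ 0 < a ∧ b < L := by
    rcases (tsupport χ).eq_empty_or_nonempty with he | hne
    · exact ⟨L / 2, L / 2, by simp [he], by linarith, by linarith⟩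
    · have hc : IsCompact (tsupport χ) := h.compact
      exact ⟨sInf (tsupport χ), sSup (tsupport χ),
        fun x hx => ⟨csInf_le hc.bddBelow hx, le_csSup hc.bddAbove hx⟩,
        (h.support (hc.sInf_mem hne)).1, (h.support (hc.sSup_mem hne)).2⟩
  have hz : ∀ x, x ∉ Icc a b → χ x = 0 := fun x hx =>
    image_eq_zero_of_notMem_tsupport fun hx' => hx (hab hx')
  have hcont := h.smooth.continuous
  have hd : ∀ x, HasDerivAt (fun y => ∫ t in (0 : ℝ)..y, χ t) (χ x) x := fun x =>
    intervalIntegral.integral_hasDerivAt_right (hcont.intervalIntegrable _ _)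
      (hcont.stronglyMeasurableAtFilter _ _) hcont.continuousAt
  have hderiv : deriv (fun y => ∫ t in (0 : ℝ)..y, χ t) = χ := funext fun x => (hd x).deriv
  have hzero : ∀ x, x ∉ Icc a b → ∫ t in (0 : ℝ)..x, χ t = 0 := by
    intro x hx
    by_cases hxa : x < a
    · refine intervalIntegral.integral_zero_ae (Eventually.of_forall fun t ht => hz t fun h' => ?_)
      rcases le_total 0 x with h1 | h1
      · rw [uIoc_of_le h1] at ht; linarith [ht.2, h'.1]
      · rw [uIoc_of_ge h1] at ht; linarith [ht.2, h'.1]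
    · have hbx : b < x := by
        by_contra hbx
        exact hx ⟨not_lt.1 hxa, not_lt.1 hbx⟩
      have hx0 : 0 ≤ x := by linarith [not_lt.1 hxa]
      rw [intervalIntegral.integral_of_le hx0,
        setIntegral_eq_integral_of_forall_compl_eq_zero, h0]
      intro t ht
      refine hz t fun h' => ht ⟨by linarith [h'.1], by linarith [h'.2]⟩
  have hts : tsupport (fun y => ∫ t in (0 : ℝ)..y, χ t) ⊆ Icc a b :=
    closure_minimal (fun x hx => by_contra fun h' => hx (hzero x h')) isClosed_Icc
  refine ⟨fun y => ∫ t in (0 : ℝ)..y, χ t, ⟨?_, ?_, ?_⟩, hderiv⟩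
  · rw [contDiff_infty_iff_deriv, hderiv]
    exact ⟨fun x => (hd x).differentiableAt, h.smooth⟩
  · exact isCompact_Icc.of_isClosed_subset (isClosed_tsupport _) hts
  · exact hts.trans fun x hx => ⟨by linarith [hx.1], by linarith [hx.2]⟩

/-- A function with weak derivative zero and trace zero at `0` vanishes. -/
theorem IsWeakDeriv.eq_zero_of_hasTrace {L : ℝ} {u : L2I L} (h : IsWeakDeriv L u 0)
    (ht : HasTrace L u 0 0) : u = 0 := by
  rcases le_or_gt L 0 with hL | hL
  · refine eq_zero_of_test u fun φ _ => setIntegral_eq_zero_of_forall_eq_zero fun x hx => ?_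
    linarith [hx.1, hx.2]
  obtain ⟨r, hr, hur, hr0⟩ := ht
  -- a normalised test function
  obtain ⟨ψ, hψ, hψ1⟩ : ∃ ψ, IsTest (Ioo 0 L) ψ ∧ ∫ x, ψ x = 1 := by
    let B : ContDiffBump (L / 2 : ℝ) := ⟨L / 8, L / 4, by linarith, by linarith⟩
    refine ⟨B.normed volume, ⟨B.contDiff_normed, B.hasCompactSupport_normed, ?_⟩,
      B.integral_normed⟩
    rw [B.tsupport_normed_eq]
    intro x hx
    have hB : B.rOut = L / 4 := rfl
    rw [Metric.mem_closedBall, Real.dist_eq, abs_le, hB] at hx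
    constructor <;> linarith [hx.1, hx.2]
  have hself : ∀ φ, IsTest (Ioo 0 L) φ → ∫ x in Ioo 0 L, φ x = ∫ x, φ x := fun φ hφ =>
    setIntegral_eq_integral_of_forall_compl_eq_zero fun x hx =>
      image_eq_zero_of_notMem_tsupport fun hx' => hx (hφ.support hx')
  set c : ℝ := ∫ x in Ioo 0 L, u x * ψ x with hc
  have key : ∀ χ, IsTest (Ioo 0 L) χ → ∫ x in Ioo 0 L, u x * χ x = c * ∫ x, χ x := by
    intro χ hχ
    set m : ℝ := ∫ x, χ x with hm
    have hχi : Integrable χ := hχ.smooth.continuous.integrable_of_hasCompactSupport hχ.compact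
    have hψi : Integrable ψ := hψ.smooth.continuous.integrable_of_hasCompactSupport hψ.compact
    have hT : IsTest (Ioo 0 L) (fun x => χ x - m * ψ x) := by
      refine ⟨hχ.smooth.sub (contDiff_const.mul hψ.smooth),
        hχ.compact.sub (hψ.compact.mul_left (f := fun _ => m)), ?_⟩
      refine (tsupport_sub χ (fun x => m * ψ x)).trans (union_subset hχ.support ?_)
      exact (tsupport_mul_subset_right (f := fun _ => m) (g := ψ)).trans hψ.support
    obtain ⟨φ, hφ, hd⟩ := exists_primitive hT (by
      rw [integral_sub hχi (hψi.const_mul m), integral_const_mul, hψ1]; simp [hm])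
    have h1 := h φ hφ
    rw [integral_zero_mul, neg_zero, hd] at h1
    have h2 : ∀ x, u x * (χ x - m * ψ x) = u x * χ x - m * (u x * ψ x) := fun x => by ring
    simp only [h2] at h1
    rw [integral_sub (hχ.integrable u) ((hψ.integrable u).const_mul m), integral_const_mul] at h1
    rw [hc]; linarith
  set k : L2I L := (memLp_const c).toLp (fun _ => c) with hk
  have hkc : k =ᵐ[volume.restrict (Ioo 0 L)] fun _ => c := MemLp.coeFn_toLp _
  have huk : u + (-1 : ℝ) • k = 0 := by
    refine eq_zero_of_test _ fun χ hχ => ?_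
    rw [integral_add_mul _ _ hχ, integral_smul_mul, key χ hχ]
    have : ∫ x in Ioo 0 L, k x * χ x = c * ∫ x, χ x := by
      rw [← hself χ hχ, ← integral_const_mul]
      refine integral_congr_ae ?_
      filter_upwards [hkc] with x hx
      rw [hx]
    rw [this]; ring
  have huk' : u = k := by
    have : u - k = 0 := by simpa [sub_eq_add_neg] using huk
    exact sub_eq_zero.1 this
  -- the representative equals `c` on `(0, L)`, hence at `0`
  have hrc : r =ᵐ[volume.restrict (Ioo 0 L)] fun _ => c := by
    have := hur.symm; rw [huk'] at this; exact this.trans hkc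
  have heq : EqOn r (fun _ => c) (Ioo 0 L) :=
    Measure.eqOn_open_of_ae_eq hrc isOpen_Ioo (hr.mono Ioo_subset_Icc_self) continuousOn_const
  have hcl : EqOn r (fun _ => c) (Icc 0 L) := by
    refine heq.of_subset_closure hr continuousOn_const Ioo_subset_Icc_self ?_
    rw [closure_Ioo hL.ne]
  have hc0 : c = 0 := by
    have := hcl (left_mem_Icc.2 hL.le); rw [hr0] at this; exact this.symm
  rw [huk']
  refine Lp.ext ?_
  filter_upwards [hkc, Lp.coeFn_zero ℝ 2 (volume.restrict (Ioo 0 L))] with x h1 h2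
  rw [h1, h2, hc0]; rfl

/-- The ambient space of `m`-jets `(u, ∂ₓu, …, ∂ₓᵐu)` in `L²(I)`, with the Euclidean norm. -/
abbrev Jet (L : ℝ) (m : ℕ) : Type := PiLp 2 fun _ : Fin (m + 1) => L2I L

/-- `Hᵐ(I)`. A function is recorded together with its weak derivatives up to order `m`, which it
determines: `v j` is `∂ₓʲ` of the function `v 0`. The norm inherited from `Jet` is the usual one,
`‖v‖² = ∑_{j ≤ m} ‖∂ₓʲ v‖²`. -/
def Sob (L : ℝ) (m : ℕ) : Submodule ℝ (Jet L m) where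
  carrier := {v | ∀ j : Fin m, IsWeakDeriv L (v j.castSucc) (v j.succ)}
  zero_mem' := fun _ => isWeakDeriv_zero L
  add_mem' := fun hv hw j => (hv j).add (hw j)
  smul_mem' := fun c _ hv j => (hv j).smul c

/-- `H₀ᵐ(I)`: the functions in `Hᵐ(I)` whose derivatives of order `< m` vanish at `0` and `L`. -/
def Sob0 (L : ℝ) (m : ℕ) : Submodule ℝ (Jet L m) where
  carrier := {v | v ∈ Sob L m ∧
    ∀ j : Fin m, HasTrace L (v j.castSucc) 0 0 ∧ HasTrace L (v j.castSucc) L 0}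
  zero_mem' := ⟨zero_mem _, fun _ => ⟨hasTrace_zero L 0, hasTrace_zero L L⟩⟩
  add_mem' := fun hv hw => ⟨add_mem hv.1 hw.1, fun j =>
    ⟨by simpa using (hv.2 j).1.add (hw.2 j).1, by simpa using (hv.2 j).2.add (hw.2 j).2⟩⟩
  smul_mem' := fun c _ hv => ⟨Submodule.smul_mem _ c hv.1, fun j =>
    ⟨by simpa using (hv.2 j).1.smul c, by simpa using (hv.2 j).2.smul c⟩⟩

theorem Sob.eq_zero_of_zero {L : ℝ} {m : ℕ} {v : Jet L m} (hv : v ∈ Sob L m) (h : v 0 = 0) :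
    v = 0 := by
  ext1 j
  induction j using Fin.induction with
  | zero => exact h
  | succ j ih =>
    have := hv j
    rw [ih] at this
    exact this.eq_zero

theorem Sob0.eq_zero_of_last {L : ℝ} {m : ℕ} {v : Jet L m} (hv : v ∈ Sob0 L m)
    (h : v (Fin.last m) = 0) : v = 0 := by
  ext1 j
  induction j using Fin.reverseInduction with
  | last => exact h
  | cast j ih =>
    have := hv.1 j
    rw [ih] at this
    exact this.eq_zero_of_hasTrace (hv.2 j).1

/-- The space `H_k`: `L²(I)` for `k = 0`, `H₀¹(I)` for `k = 1`, `H₀²(I)` for `k = 2`,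
normed by `‖∂ₓᵏ v‖`. -/
def Hk (L : ℝ) (k : ℕ) : Type := Sob0 L k

namespace Hk

variable {L : ℝ} {k : ℕ}

instance : AddCommGroup (Hk L k) := inferInstanceAs (AddCommGroup (Sob0 L k))
instance : Module ℝ (Hk L k) := inferInstanceAs (Module ℝ (Sob0 L k))

/-- The function in `L²(I)` underlying an element of `H_k`. -/
def fn : Hk L k →ₗ[ℝ] L2I L where
  toFun v := (show Sob0 L k from v).1 0
  map_add' _ _ := rfl
  map_smul' _ _ := rfl

/-- The derivative `∂ₓᵏ` of an element of `H_k`. -/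
def dx : Hk L k →ₗ[ℝ] L2I L where
  toFun v := (show Sob0 L k from v).1 (Fin.last k)
  map_add' _ _ := rfl
  map_smul' _ _ := rfl

theorem eq_zero_of_dx {v : Hk L k} (h : dx v = 0) : v = 0 :=
  Subtype.ext (Sob0.eq_zero_of_last v.2 h)

theorem eq_zero_of_fn {v : Hk L k} (h : fn v = 0) : v = 0 :=
  Subtype.ext (Sob.eq_zero_of_zero v.2.1 h)

/-- The inner product `⟨∂ₓᵏ v, ∂ₓᵏ w⟩` on `H_k`. -/
@[reducible] def core (L : ℝ) (k : ℕ) : InnerProductSpace.Core ℝ (Hk L k) where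
  inner v w := inner ℝ (dx v) (dx w)
  conj_inner_symm v w := by simp [real_inner_comm]
  re_inner_nonneg v := by simp
  add_left u v w := by simp [inner_add_left]
  smul_left v w c := by simp [inner_smul_left]
  definite v h := eq_zero_of_dx (inner_self_eq_zero.1 h)

instance : NormedAddCommGroup (Hk L k) := (core L k).toNormedAddCommGroup
instance : InnerProductSpace ℝ (Hk L k) := InnerProductSpace.ofCore (core L k).toCore

theorem inner_def (v w : Hk L k) : inner ℝ v w = inner ℝ (dx v) (dx w) := rfl

theorem norm_dx (v : Hk L k) : ‖dx v‖ = ‖v‖ := by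
  rw [@norm_eq_sqrt_real_inner (Hk L k), inner_def, ← norm_eq_sqrt_real_inner]

/-- `∂ₓᵏ` as an isometry of `H_k` into `L²(I)`. -/
def dxi : Hk L k →ₗᵢ[ℝ] L2I L := ⟨dx, norm_dx⟩

end Hk

/-! ### The memory kernel and the energy space -/

/-- The assumptions on the memory kernel `f : [0, ∞) → ℝ`; derivatives are taken within `[0, ∞)`. -/
structure IsMemoryKernel (f : ℝ → ℝ) : Prop where
  smooth : ContDiffOn ℝ 2 f (Ici 0)
  deriv_neg : ∀ s, 0 ≤ s → derivWithin f (Ici 0) s < 0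
  second : ∃ c₀ : ℝ, 0 < c₀ ∧ ∀ s, 0 ≤ s → 0 ≤ iteratedDerivWithin 2 f (Ici 0) s ∧
    iteratedDerivWithin 2 f (Ici 0) s ≤ -c₀ * derivWithin f (Ici 0) s
  pos : 0 < f 0
  tendsto : Tendsto f atTop (𝓝 0)

/-- `g = -f'`. -/
def memG (f : ℝ → ℝ) (s : ℝ) : ℝ := -derivWithin f (Ici 0) s

/-- The measure `g(s) ds` on `(0, ∞)`. -/
def memMeasure (f : ℝ → ℝ) : Measure ℝ :=
  (volume.restrict (Ioi 0)).withDensity fun s => ENNReal.ofReal (memG f s)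

/-- `L_g`: the (classes of) functions `η : (0, ∞) → H_k` with `∫ g(s) ‖∂ₓᵏ η(s)‖² ds < ∞`, with the
inner product `∫ g(s) ⟨∂ₓᵏ η(s), ∂ₓᵏ ζ(s)⟩ ds`. -/
abbrev Lg (f : ℝ → ℝ) (L : ℝ) (k : ℕ) : Type := Lp (Hk L k) 2 (memMeasure f)

/-- The energy space `L²(I) × L_g`, as a Hilbert space product. -/
abbrev Energy (f : ℝ → ℝ) (L : ℝ) (k : ℕ) : Type := WithLp 2 (L2I L × Lg f L k)

namespace IsMemoryKernel

variable {f : ℝ → ℝ}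

theorem memG_pos (hf : IsMemoryKernel f) {s : ℝ} (hs : 0 ≤ s) : 0 < memG f s :=
  neg_pos.2 (hf.deriv_neg s hs)

theorem continuousOn_memG (hf : IsMemoryKernel f) : ContinuousOn (memG f) (Ici 0) :=
  (hf.smooth.continuousOn_derivWithin (uniqueDiffOn_Ici 0) (by norm_num)).neg

theorem integrableOn_memG (hf : IsMemoryKernel f) : IntegrableOn (memG f) (Ioi 0) := by
  refine IntegrableOn.neg ?_
  refine integrableOn_Ioi_deriv_of_nonpos (g := f) (l := 0)
    (hf.smooth.continuousOn.continuousWithinAt (by simp)) (fun x hx => ?_)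
    (fun x hx => (hf.deriv_neg x (le_of_lt hx)).le) hf.tendsto
  have hd : DifferentiableWithinAt ℝ f (Ici 0) x :=
    hf.smooth.differentiableOn (by norm_num) x (mem_Ici.2 (le_of_lt hx))
  exact hd.hasDerivWithinAt.hasDerivAt (Ici_mem_nhds hx)

theorem aemeasurable_memG (hf : IsMemoryKernel f) :
    AEMeasurable (memG f) (volume.restrict (Ioi 0)) :=
  hf.integrableOn_memG.aestronglyMeasurable.aemeasurable

theorem isFiniteMeasure (hf : IsMemoryKernel f) : IsFiniteMeasure (memMeasure f) :=
  isFiniteMeasure_withDensity_ofReal hf.integrableOn_memG.2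

theorem absolutelyContinuous (hf : IsMemoryKernel f) :
    volume.restrict (Ioi 0) ≪ memMeasure f := by
  refine withDensity_absolutelyContinuous' hf.aemeasurable_memG.ennreal_ofReal ?_
  filter_upwards [ae_restrict_mem measurableSet_Ioi] with s hs
  simpa using hf.memG_pos (le_of_lt hs)

theorem absolutelyContinuous' : memMeasure f ≪ volume.restrict (Ioi 0) :=
  withDensity_absolutelyContinuous _ _

variable {L : ℝ} {k : ℕ}

theorem locallyIntegrableOn_dx (hf : IsMemoryKernel f) (η : Lg f L k) :
    LocallyIntegrableOn (fun s => Hk.dx (η s)) (Ioi 0) volume := by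
  have := hf.isFiniteMeasure
  have h1 : Integrable (fun s => Hk.dx (η s)) (memMeasure f) :=
    ((Hk.dxi (L := L) (k := k)).toContinuousLinearMap).integrable_comp
      ((Lp.memLp η).integrable (by norm_num))
  have h2 : Integrable (fun s => memG f s • Hk.dx (η s)) (volume.restrict (Ioi 0)) := by
    have := (integrable_withDensity_iff_integrable_smul₀'
      (μ := volume.restrict (Ioi (0 : ℝ))) hf.aemeasurable_memG.ennreal_ofReal
      (Eventually.of_forall fun _ => ENNReal.ofReal_lt_top)).1 h1
    refine this.congr ?_
    filter_upwards [ae_restrict_mem measurableSet_Ioi] with s hs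
    rw [ENNReal.toReal_ofReal (hf.memG_pos (le_of_lt hs)).le]
  have h3 : LocallyIntegrableOn (fun s => (memG f s)⁻¹ • (memG f s • Hk.dx (η s))) (Ioi 0)
      volume := by
    refine LocallyIntegrableOn.continuousOn_smul isOpen_Ioi.isLocallyClosed
      (IntegrableOn.locallyIntegrableOn h2) ?_
    exact (hf.continuousOn_memG.mono Ioi_subset_Ici_self).inv₀
      fun s hs => (hf.memG_pos (le_of_lt hs)).ne'
  rw [locallyIntegrableOn_iff isOpen_Ioi.isLocallyClosed] at h3 ⊢
  intro K hK hKc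
  refine (h3 K hK hKc).congr_fun (fun s hs => ?_) hKc.measurableSet
  exact inv_smul_smul₀ (hf.memG_pos (le_of_lt (hK hs))).ne' _

theorem integrable_smul_dx (hf : IsMemoryKernel f) (η : Lg f L k) {φ : ℝ → ℝ}
    (hφ : IsTest (Ioi 0) φ) :
    Integrable (fun s => φ s • Hk.dx (η s)) (volume.restrict (Ioi 0)) := by
  have h1 : IntegrableOn (fun s => φ s • Hk.dx (η s)) (tsupport φ) volume :=
    ((hf.locallyIntegrableOn_dx η).integrableOn_compact_subset hφ.support
      hφ.compact).continuousOn_smul hφ.smooth.continuous.continuousOn hφ.compact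
  refine ((integrableOn_iff_integrable_of_support_subset fun s hs => ?_).1 h1).restrict
  by_contra h'
  exact hs (by simp [image_eq_zero_of_notMem_tsupport h'])

theorem integrable_pairing (hf : IsMemoryKernel f) (η : Lg f L k) {φ : ℝ → ℝ}
    (hφ : IsTest (Ioo 0 L) φ) :
    Integrable (fun s => ∫ x in Ioo 0 L, Hk.dx (η s) x * φ x) (memMeasure f) := by
  have := hf.isFiniteMeasure
  have hm : MemLp φ 2 (volume.restrict (Ioo 0 L)) :=
    (hφ.smooth.continuous.memLp_of_hasCompactSupport hφ.compact).restrict _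
  have h1 : Integrable (fun s => Hk.dx (η s)) (memMeasure f) :=
    ((Hk.dxi (L := L) (k := k)).toContinuousLinearMap).integrable_comp
      ((Lp.memLp η).integrable (by norm_num))
  refine (h1.const_inner (𝕜 := ℝ) hm.toLp).congr (Eventually.of_forall fun s => ?_)
  change inner ℝ hm.toLp (Hk.dx (η s)) = _
  rw [L2.inner_def]
  refine integral_congr_ae ?_
  filter_upwards [hm.coeFn_toLp] with x hx
  simp [hx]

end IsMemoryKernel

/-! ### The operator `A` -/

section Operator

variable {f : ℝ → ℝ} {L : ℝ} {k : ℕ}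

/-- `u ∈ H₀²(I)` and `∂ₓ² u(L) = 0`. -/
def IsDomU (L : ℝ) (u : L2I L) : Prop :=
  ∃ v ∈ Sob0 L 2, v 0 = u ∧ HasTrace L (v 2) L 0

/-- `F = -∂ₓ³u + a₀ ∂ₓ⁵u - a₁ ∂ₓu - (-1)ᵏ ∫₀^∞ g(s) ∂ₓ²ᵏ η(s) ds` in the sense of distributions on
`I`, for `u, F ∈ L²(I)` and `η ∈ L_g`. All derivatives are moved to the test function, except that
the memory term uses `∂ₓᵏ η(s) ∈ L²(I)`: for it, `(-1)ᵏ ⟨∂ₓ²ᵏ η(s), φ⟩ = ⟨∂ₓᵏ η(s), ∂ₓᵏ φ⟩`. -/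
def IsFirstComp (a₀ a₁ : ℝ) (u : L2I L) (η : Lg f L k) (F : L2I L) : Prop :=
  ∀ φ : ℝ → ℝ, IsTest (Ioo 0 L) φ →
    ∫ x in Ioo 0 L, F x * φ x =
      (∫ x in Ioo 0 L, u x * iteratedDeriv 3 φ x)
      - a₀ * (∫ x in Ioo 0 L, u x * iteratedDeriv 5 φ x)
      + a₁ * (∫ x in Ioo 0 L, u x * iteratedDeriv 1 φ x)
      - ∫ s, (∫ x in Ioo 0 L, Hk.dx (η s) x * iteratedDeriv k φ x) ∂(memMeasure f)

/-- `η(0) = 0`: `η` has a representative that is continuous on `[0, ∞)` with values in `H_k` and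
vanishes at `0`. -/
def VanishesAtZero (η : Lg f L k) : Prop :=
  ∃ r : ℝ → Hk L k, ContinuousOn r (Ici 0) ∧ η =ᵐ[memMeasure f] r ∧ r 0 = 0

/-- `ζ = ∂ₛ η` weakly on `(0, ∞)` with values in `H_k`. The identity of Bochner integrals is written
after the isometry `∂ₓᵏ : H_k → L²(I)`. -/
def IsMemDeriv (η ζ : Lg f L k) : Prop :=
  ∀ φ : ℝ → ℝ, IsTest (Ioi 0) φ →
    ∫ s in Ioi 0, deriv φ s • Hk.dx (η s) = -∫ s in Ioi 0, φ s • Hk.dx (ζ s)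

/-- `Ξ = u - ∂ₛ η` with `Ξ ∈ L_g`. -/
def IsSecondComp (u : L2I L) (η Ξ : Lg f L k) : Prop :=
  ∃ ζ : Lg f L k, IsMemDeriv η ζ ∧ ∀ᵐ s ∂(memMeasure f), Hk.fn (Ξ s) = u - Hk.fn (ζ s)

theorem IsDomU.add {u u' : L2I L} (h : IsDomU L u) (h' : IsDomU L u') : IsDomU L (u + u') := by
  obtain ⟨v, hv, rfl, ht⟩ := h
  obtain ⟨v', hv', rfl, ht'⟩ := h'
  exact ⟨v + v', add_mem hv hv', rfl, by simpa using ht.add ht'⟩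

theorem IsDomU.smul {u : L2I L} (c : ℝ) (h : IsDomU L u) : IsDomU L (c • u) := by
  obtain ⟨v, hv, rfl, ht⟩ := h
  exact ⟨c • v, Submodule.smul_mem _ c hv, rfl, by simpa using ht.smul c⟩

theorem isDomU_zero (L : ℝ) : IsDomU L 0 := by
  exact ⟨0, zero_mem _, rfl, hasTrace_zero L L⟩

theorem pairing_add (hf : IsMemoryKernel f) (η η' : Lg f L k) {φ : ℝ → ℝ}
    (hφ : IsTest (Ioo 0 L) φ) :
    ∫ s, (∫ x in Ioo 0 L, Hk.dx ((η + η' : Lg f L k) s) x * φ x) ∂(memMeasure f)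
      = (∫ s, (∫ x in Ioo 0 L, Hk.dx (η s) x * φ x) ∂(memMeasure f))
        + ∫ s, (∫ x in Ioo 0 L, Hk.dx (η' s) x * φ x) ∂(memMeasure f) := by
  rw [← integral_add (hf.integrable_pairing η hφ) (hf.integrable_pairing η' hφ)]
  refine integral_congr_ae ?_
  filter_upwards [Lp.coeFn_add η η'] with s hs
  rw [hs, Pi.add_apply, map_add, integral_add_mul _ _ hφ]

theorem pairing_smul (c : ℝ) (η : Lg f L k) (φ : ℝ → ℝ) :
    ∫ s, (∫ x in Ioo 0 L, Hk.dx ((c • η : Lg f L k) s) x * φ x) ∂(memMeasure f)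
      = c * ∫ s, (∫ x in Ioo 0 L, Hk.dx (η s) x * φ x) ∂(memMeasure f) := by
  rw [← integral_const_mul]
  refine integral_congr_ae ?_
  filter_upwards [Lp.coeFn_smul c η] with s hs
  rw [hs, Pi.smul_apply, map_smul, integral_smul_mul]

theorem IsFirstComp.add (hf : IsMemoryKernel f) {a₀ a₁ : ℝ} {u u' F F' : L2I L} {η η' : Lg f L k}
    (h : IsFirstComp a₀ a₁ u η F) (h' : IsFirstComp a₀ a₁ u' η' F') :
    IsFirstComp a₀ a₁ (u + u') (η + η') (F + F') := by
  intro φ hφ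
  rw [integral_add_mul _ _ hφ, integral_add_mul _ _ (hφ.iteratedDeriv 3),
    integral_add_mul _ _ (hφ.iteratedDeriv 5), integral_add_mul _ _ (hφ.iteratedDeriv 1),
    pairing_add hf _ _ (hφ.iteratedDeriv k), h φ hφ, h' φ hφ]
  ring

theorem IsFirstComp.smul {a₀ a₁ : ℝ} {u F : L2I L} {η : Lg f L k} (c : ℝ)
    (h : IsFirstComp a₀ a₁ u η F) : IsFirstComp a₀ a₁ (c • u) (c • η) (c • F) := by
  intro φ hφ
  rw [integral_smul_mul, integral_smul_mul, integral_smul_mul, integral_smul_mul, pairing_smul,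
    h φ hφ]
  ring

theorem VanishesAtZero.add {η η' : Lg f L k} (h : VanishesAtZero η) (h' : VanishesAtZero η') :
    VanishesAtZero (η + η') := by
  obtain ⟨r, hr, hu, h0⟩ := h
  obtain ⟨r', hr', hu', h0'⟩ := h'
  exact ⟨r + r', hr.add hr', (Lp.coeFn_add _ _).trans (hu.add hu'), by simp [h0, h0']⟩

theorem VanishesAtZero.smul {η : Lg f L k} (c : ℝ) (h : VanishesAtZero η) :
    VanishesAtZero (c • η) := by
  obtain ⟨r, hr, hu, h0⟩ := h
  exact ⟨c • r, hr.const_smul c, (Lp.coeFn_smul _ _).trans (hu.const_smul c), by simp [h0]⟩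

theorem integral_smul_dx_add (hf : IsMemoryKernel f) (η η' : Lg f L k) {φ : ℝ → ℝ}
    (hφ : IsTest (Ioi 0) φ) :
    ∫ s in Ioi 0, φ s • Hk.dx ((η + η' : Lg f L k) s)
      = (∫ s in Ioi 0, φ s • Hk.dx (η s)) + ∫ s in Ioi 0, φ s • Hk.dx (η' s) := by
  rw [← integral_add (hf.integrable_smul_dx η hφ) (hf.integrable_smul_dx η' hφ)]
  refine integral_congr_ae ?_
  filter_upwards [hf.absolutelyContinuous.ae_le (Lp.coeFn_add η η')] with s hs
  rw [hs, Pi.add_apply, map_add, smul_add]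

theorem integral_smul_dx_smul (hf : IsMemoryKernel f) (c : ℝ) (η : Lg f L k) (φ : ℝ → ℝ) :
    ∫ s in Ioi 0, φ s • Hk.dx ((c • η : Lg f L k) s) = c • ∫ s in Ioi 0, φ s • Hk.dx (η s) := by
  rw [← integral_smul]
  refine integral_congr_ae ?_
  filter_upwards [hf.absolutelyContinuous.ae_le (Lp.coeFn_smul c η)] with s hs
  rw [hs, Pi.smul_apply, map_smul, smul_comm]

theorem IsMemDeriv.add (hf : IsMemoryKernel f) {η η' ζ ζ' : Lg f L k} (h : IsMemDeriv η ζ)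
    (h' : IsMemDeriv η' ζ') : IsMemDeriv (η + η') (ζ + ζ') := by
  intro φ hφ
  rw [integral_smul_dx_add hf _ _ hφ.deriv, integral_smul_dx_add hf _ _ hφ, h φ hφ, h' φ hφ,
    neg_add]

theorem IsMemDeriv.smul (hf : IsMemoryKernel f) {η ζ : Lg f L k} (c : ℝ) (h : IsMemDeriv η ζ) :
    IsMemDeriv (c • η) (c • ζ) := by
  intro φ hφ
  rw [integral_smul_dx_smul hf, integral_smul_dx_smul hf, h φ hφ, smul_neg]

theorem IsMemDeriv.eq_zero (hf : IsMemoryKernel f) {ζ : Lg f L k} (h : IsMemDeriv 0 ζ) :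
    ζ = 0 := by
  have h0 : ∀ φ : ℝ → ℝ, ∫ s in Ioi 0, φ s • Hk.dx ((0 : Lg f L k) s) = 0 := fun φ => by
    simpa using integral_smul_dx_smul hf 0 (0 : Lg f L k) φ
  have h1 := isOpen_Ioi.ae_eq_zero_of_integral_contDiff_smul_eq_zero (μ := volume)
    (hf.locallyIntegrableOn_dx ζ) (fun φ h1 h2 h3 => by
      have h4 := h φ ⟨h1, h2, h3⟩
      rw [h0, eq_comm, neg_eq_zero] at h4
      refine Eq.trans (setIntegral_eq_integral_of_forall_compl_eq_zero (s := Ioi 0) ?_).symm h4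
      intro x hx
      rw [image_eq_zero_of_notMem_tsupport (fun hx' => hx (h3 hx')), zero_smul])
  have h2 : ∀ᵐ s ∂(memMeasure f), Hk.dx (ζ s) = 0 :=
    IsMemoryKernel.absolutelyContinuous'.ae_le ((ae_restrict_iff' measurableSet_Ioi).2 h1)
  refine Lp.ext ?_
  filter_upwards [h2, Lp.coeFn_zero (Hk L k) 2 (memMeasure f)] with s h3 h4
  rw [h4, Hk.eq_zero_of_dx h3]; rfl

theorem IsSecondComp.add (hf : IsMemoryKernel f) {u u' : L2I L} {η η' Ξ Ξ' : Lg f L k}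
    (h : IsSecondComp u η Ξ) (h' : IsSecondComp u' η' Ξ') :
    IsSecondComp (u + u') (η + η') (Ξ + Ξ') := by
  obtain ⟨ζ, hz, he⟩ := h
  obtain ⟨ζ', hz', he'⟩ := h'
  refine ⟨ζ + ζ', hz.add hf hz', ?_⟩
  filter_upwards [he, he', Lp.coeFn_add Ξ Ξ', Lp.coeFn_add ζ ζ'] with s h1 h2 h3 h4
  rw [h3, h4, Pi.add_apply, Pi.add_apply, map_add, map_add, h1, h2]; abel

theorem IsSecondComp.smul (hf : IsMemoryKernel f) {u : L2I L} {η Ξ : Lg f L k} (c : ℝ)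
    (h : IsSecondComp u η Ξ) : IsSecondComp (c • u) (c • η) (c • Ξ) := by
  obtain ⟨ζ, hz, he⟩ := h
  refine ⟨c • ζ, hz.smul hf c, ?_⟩
  filter_upwards [he, Lp.coeFn_smul c Ξ, Lp.coeFn_smul c ζ] with s h1 h3 h4
  rw [h3, h4, Pi.smul_apply, Pi.smul_apply, map_smul, map_smul, h1, smul_sub]

theorem isFirstComp_zero (a₀ a₁ : ℝ) : IsFirstComp a₀ a₁ (0 : L2I L) (0 : Lg f L k) 0 := by
  intro φ _
  have := pairing_smul (f := f) (L := L) (k := k) 0 0 (_root_.iteratedDeriv k φ)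
  rw [zero_smul, zero_mul] at this
  rw [integral_zero_mul, integral_zero_mul, integral_zero_mul, integral_zero_mul, this]
  ring

theorem isMemDeriv_zero (hf : IsMemoryKernel f) : IsMemDeriv (0 : Lg f L k) 0 := by
  have := integral_smul_dx_smul hf 0 (0 : Lg f L k)
  simp only [zero_smul] at this
  intro φ _
  rw [this, this, neg_zero]

theorem isSecondComp_zero (hf : IsMemoryKernel f) :
    IsSecondComp (0 : L2I L) (0 : Lg f L k) 0 := by
  refine ⟨0, isMemDeriv_zero hf, ?_⟩
  filter_upwards [Lp.coeFn_zero (Hk L k) 2 (memMeasure f)] with s h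
  rw [h, Pi.zero_apply, map_zero, sub_zero]

/-- The graph of `A`: pairs `(Φ, Ψ)` with `Φ = (u, η) ∈ D(A)` and `Ψ = A Φ`. -/
def opGraph (hf : IsMemoryKernel f) (L : ℝ) (k : ℕ) (a₀ a₁ : ℝ) :
    Submodule ℝ (Energy f L k × Energy f L k) where
  carrier := {p | IsDomU L p.1.fst ∧ VanishesAtZero p.1.snd ∧
    IsFirstComp a₀ a₁ p.1.fst p.1.snd p.2.fst ∧ IsSecondComp p.1.fst p.1.snd p.2.snd}
  zero_mem' := ⟨isDomU_zero L, ⟨0, continuousOn_const, Lp.coeFn_zero _ _ _, rfl⟩,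
    isFirstComp_zero a₀ a₁, isSecondComp_zero hf⟩
  add_mem' := fun hp hq => ⟨hp.1.add hq.1, hp.2.1.add hq.2.1, hp.2.2.1.add hf hq.2.2.1,
    hp.2.2.2.add hf hq.2.2.2⟩
  smul_mem' := fun c _ hp => ⟨hp.1.smul c, hp.2.1.smul c, hp.2.2.1.smul c, hp.2.2.2.smul hf c⟩

theorem opGraph_functional (hf : IsMemoryKernel f) (L : ℝ) (k : ℕ) (a₀ a₁ : ℝ)
    (p : Energy f L k × Energy f L k) (hp : p ∈ opGraph hf L k a₀ a₁) (h0 : p.1 = 0) :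
    p.2 = 0 := by
  obtain ⟨Φ, Ψ⟩ := p
  obtain ⟨-, -, h1, ζ, hz, h2⟩ := hp
  change Φ = 0 at h0
  subst h0
  have hF : Ψ.fst = 0 := by
    refine eq_zero_of_test _ fun φ hφ => ?_
    exact (h1 φ hφ).trans
      ((isFirstComp_zero (f := f) (k := k) a₀ a₁ φ hφ).symm.trans (integral_zero_mul φ))
  have hZ : ζ = 0 := IsMemDeriv.eq_zero hf hz
  have hX : Ψ.snd = 0 := by
    refine Lp.ext ?_
    filter_upwards [h2, Lp.coeFn_zero (Hk L k) 2 (memMeasure f)] with s h3 h4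
    rw [hZ, h4] at h3
    rw [h4, Hk.eq_zero_of_fn (v := Ψ.snd s) (by simpa using h3)]; rfl
  exact (WithLp.ofLp_injective 2) (Prod.ext hF hX)

/-- The linear operator `A` on `L²(I) × L_g`. -/
def op (hf : IsMemoryKernel f) (L : ℝ) (k : ℕ) (a₀ a₁ : ℝ) :
    Energy f L k →ₗ.[ℝ] Energy f L k :=
  (opGraph hf L k a₀ a₁).toLinearPMap

theorem op_graph (hf : IsMemoryKernel f) (L : ℝ) (k : ℕ) (a₀ a₁ : ℝ) :
    (op hf L k a₀ a₁).graph = opGraph hf L k a₀ a₁ :=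
  Submodule.toLinearPMap_graph_eq _ (opGraph_functional hf L k a₀ a₁)

end Operator

/-! ### Semigroups and abstract Cauchy problems -/

section Semigroup

variable {X : Type*} [NormedAddCommGroup X] [NormedSpace ℝ X]

/-- `(S t)_{t ≥ 0}` is a `C₀`-semigroup of contractions (values at `t < 0` are irrelevant). -/
structure IsContractionSemigroup (S : ℝ → X →L[ℝ] X) : Prop where
  zero : S 0 = 1
  add : ∀ s t, 0 ≤ s → 0 ≤ t → S (s + t) = S s * S t
  tendsto : ∀ x, Tendsto (fun t => S t x) (𝓝[>] 0) (𝓝 x)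
  contraction : ∀ t, 0 ≤ t → ‖S t‖ ≤ 1

/-- `A` is the infinitesimal generator of `S`, including the equality of domains. -/
def IsGenerator (A : X →ₗ.[ℝ] X) (S : ℝ → X →L[ℝ] X) : Prop :=
  ∀ x y, (x, y) ∈ A.graph ↔ Tendsto (fun t : ℝ => t⁻¹ • (S t x - x)) (𝓝[>] 0) (𝓝 y)

/-- Classical solutions of `Φ' = A Φ` for `t > 0`, `Φ(0) = Φ₀`: continuous on `[0, ∞)`, continuously
differentiable on `(0, ∞)`, with values in `D(A)` for `t > 0`. -/
structure IsClassicalSolution (A : X →ₗ.[ℝ] X) (Φ₀ : X) (Φ : ℝ → X) : Prop where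
  init : Φ 0 = Φ₀
  continuousOn : ContinuousOn Φ (Ici 0)
  deriv_continuousOn : ContinuousOn (deriv Φ) (Ioi 0)
  equation : ∀ t, 0 < t → ∃ h : Φ t ∈ A.domain, HasDerivAt Φ (A ⟨Φ t, h⟩) t

/-- `Φ ∈ C([0, ∞); D(A))`, where `D(A)` carries the graph norm. -/
def IsContinuousIntoDomain (A : X →ₗ.[ℝ] X) (Φ : ℝ → X) : Prop :=
  ContinuousOn Φ (Ici 0) ∧
    ∃ h : ∀ t : Ici (0 : ℝ), Φ t ∈ A.domain, Continuous fun t : Ici (0 : ℝ) => A ⟨Φ t, h t⟩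

/-- Mild solutions of `Φ' = A Φ`, `Φ(0) = Φ₀`: continuous on `[0, ∞)`, with `∫₀ᵗ Φ ∈ D(A)` and
`Φ(t) = Φ₀ + A ∫₀ᵗ Φ`. -/
structure IsMildSolution (A : X →ₗ.[ℝ] X) (Φ₀ : X) (Φ : ℝ → X) : Prop where
  continuousOn : ContinuousOn Φ (Ici 0)
  equation : ∀ t, 0 ≤ t → ∃ h : (∫ s in (0 : ℝ)..t, Φ s) ∈ A.domain,
    Φ t = Φ₀ + A ⟨∫ s in (0 : ℝ)..t, Φ s, h⟩

end Semigroup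

/-! ### The space `𝓑 = C([0,T]; L²(I)) ∩ L²(0,T; H²(I))` -/

/-- `C([0,T]; L²(I)) × L²(0,T; H²(I))` with the sum of the two norms. -/
abbrev BAmbient (L T : ℝ) : Type :=
  WithLp 1 (C(Icc (0 : ℝ) T, L2I L) × Lp (Sob L 2) 2 (volume.restrict (Ioo 0 T)))

/-- `𝓑 = C([0,T]; L²(I)) ∩ L²(0,T; H²(I))`, as the space of pairs of elements of the two spaces
that are the same function of `t`; its norm is the sum of the two norms. -/
def BSpace (L T : ℝ) : Submodule ℝ (BAmbient L T) where
  carrier := {p | ∀ᵐ t ∂(volume.restrict (Ioo 0 T)), ∀ ht : t ∈ Icc 0 T,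
    (p.snd t).1 0 = p.fst ⟨t, ht⟩}
  zero_mem' := by
    filter_upwards [Lp.coeFn_zero (Sob L 2) 2 (volume.restrict (Ioo 0 T))] with t h ht
    change (((0 : Lp (Sob L 2) 2 (volume.restrict (Ioo 0 T))) t).1 0) = 0
    rw [h]; rfl
  add_mem' := by
    intro p q hp hq
    filter_upwards [hp, hq, Lp.coeFn_add p.snd q.snd] with t h1 h2 h3 ht
    rw [WithLp.add_snd, WithLp.add_fst, h3]
    simp [h1 ht, h2 ht]
  smul_mem' := by
    intro c p hp
    filter_upwards [hp, Lp.coeFn_smul c p.snd] with t h1 h3 ht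
    rw [WithLp.smul_snd, WithLp.smul_fst, h3]
    simp [h1 ht]

end Kawahara

end

noncomputable section

namespace Kawahara

/-! ### Generation of contraction semigroups on Hilbert spaces -/

section Generation

variable {X : Type*} [NormedAddCommGroup X] [InnerProductSpace ℝ X]

/-! Assertion (i) is the Lumer–Phillips theorem on a Hilbert space: a linear operator that is
dissipative, with `μ - A` onto for `μ > 0`, is densely defined and generates a contraction
semigroup, the limit of the exponentials of its Yosida approximations. Dissipativity also yields
uniqueness of classical and mild solutions. The work is to verify these two properties and to find a
multiplier for (ii).

On the interval everything is expressed by the Volterra operator `(K v)(x) = ∫ₓᴸ v` and the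
functional `ell v = ∫ v`. With `w = ∂ₓ²u`, membership of `u` in `H₀²(I)` means `u = K²w` and `ell w
= ell (K w) = 0` (`mem_sob0_iff`), and `∂ₓ²u(L) = 0` means `w = K z` with `z = -∂ₓ³u`. By the lemma
of du Bois-Reymond the distributional equation for the first component `F` of `A (u, η)` becomes the
identity `K²F = K w - a₀ z + a₁ K³w - K^(2-k) m + β + γ K 1` in `L²(I)`, where `m = ∫ g ∂ₓᵏη` and
`β, γ` are free constants (`exists_graphData`).

Dissipativity: `⟨F, u⟩ = ⟨K²F, w⟩`, and `K` is skew up to the boundary term `ell v * ell w`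
(`inner_volterra`). What survives is `-a₀ (∂ₓ²u(0))² / 2` and a memory term, and the latter cancels
against the contribution of `u` to the second component. The remaining `-⟨∂ₛη, η⟩` is nonpositive
because `g` decreases (`inner_memDeriv_nonneg`).

Surjectivity of `μ - A`: the transport equation in `s` is solved explicitly, and its response to a
constant is a scalar multiple of it. Eliminating `η` leaves `(a₀ - K Q) w = K (r + β + γ K 1)` with
`Q` a polynomial in `K`. Since `K` is quasinilpotent, `a₀ - K Q` is invertible. The conditions `ell
w = ell (K w) = 0` form a square linear system for `(β, γ)`, whose injectivity is dissipativity once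
more (`exists_mem_opGraph`).

Smoothing: the multiplier `x u` gives `2 a₀ ‖∂ₓ²u‖² ≤ -⟨F, x u⟩ + κ ‖Φ‖²` (`GraphData.kato`). Along
the flow `⟨F, x u⟩` is half the time derivative of `⟨u, x u⟩`, so integration in time bounds `u` in
`L²(0, T; H²(I))` for data in the domain, and density extends the bound (`exists_smoothing`). -/

/-- `A` is dissipative and `μ - A` is onto for every `μ > 0`. -/
structure IsMaximalDissipative (A : X →ₗ.[ℝ] X) : Prop where
  dissipative : ∀ x y, (x, y) ∈ A.graph → inner ℝ y x ≤ 0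
  range : ∀ μ : ℝ, 0 < μ → ∀ z, ∃ x y, (x, y) ∈ A.graph ∧ μ • x - y = z

/-- Pairing `μ • x - y` with `x` only loses a term of good sign. This gives both uniqueness for the
resolvent equation and the resolvent bound. -/
theorem norm_smul_le_of_inner_nonpos {μ : ℝ} {x y : X} (h : inner ℝ y x ≤ 0) :
    μ * ‖x‖ ≤ ‖μ • x - y‖ := by
  rcases (norm_nonneg x).eq_or_lt with h0 | h0
  · rw [← h0, mul_zero]; exact norm_nonneg _
  refine le_of_mul_le_mul_right ?_ h0
  calc μ * ‖x‖ * ‖x‖ = μ * inner ℝ x x := by rw [real_inner_self_eq_norm_mul_norm]; ring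
    _ ≤ inner ℝ (μ • x - y) x := by rw [inner_sub_left, real_inner_smul_left]; linarith
    _ ≤ _ := real_inner_le_norm _ _

namespace IsMaximalDissipative

variable {A : X →ₗ.[ℝ] X} (hA : IsMaximalDissipative A)
include hA

theorem exists_resolvent {μ : ℝ} (hμ : 0 < μ) :
    ∃ R : X →L[ℝ] X, (∀ z, (R z, μ • R z - z) ∈ A.graph) ∧
      (∀ x y, (x, y) ∈ A.graph → R (μ • x - y) = x) ∧ ∀ z, μ * ‖R z‖ ≤ ‖z‖ := by
  have huniq : ∀ x y x' y', (x, y) ∈ A.graph → (x', y') ∈ A.graph →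
      μ • x - y = μ • x' - y' → x = x' := by
    intro x y x' y' h h' he
    have h1 := norm_smul_le_of_inner_nonpos (μ := μ) (hA.dissipative _ _ (A.graph.sub_mem h h'))
    have h2 : μ • (x - x') - (y - y') = 0 := by
      rw [smul_sub, sub_sub_sub_comm, he, sub_self]
    rw [h2, norm_zero] at h1
    have : ‖x - x'‖ = 0 := le_antisymm (by nlinarith) (norm_nonneg _)
    exact sub_eq_zero.1 (norm_eq_zero.1 this)
  choose r y hr hy using hA.range μ hμ
  have hmem : ∀ z, (r z, μ • r z - z) ∈ A.graph := fun z => by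
    have : μ • r z - z = y z := by rw [sub_eq_iff_eq_add, ← sub_eq_iff_eq_add', hy]
    rw [this]; exact hr z
  have hbd : ∀ z, μ * ‖r z‖ ≤ ‖z‖ := fun z => by
    have := norm_smul_le_of_inner_nonpos (μ := μ) (hA.dissipative _ _ (hr z))
    rwa [hy] at this
  let Rl : X →ₗ[ℝ] X :=
    { toFun := r
      map_add' := fun a b => huniq _ _ _ _ (hr _) (A.graph.add_mem (hr a) (hr b)) (by
        rw [hy, smul_add, add_sub_add_comm, hy, hy])
      map_smul' := fun c a => huniq _ _ _ _ (hr _) (A.graph.smul_mem c (hr a)) (by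
        change _ = μ • (c • r a) - c • y a
        rw [hy, smul_comm, ← smul_sub, hy]) }
  refine ⟨Rl.mkContinuous μ⁻¹ fun z => ?_, hmem, fun a b h => ?_, hbd⟩
  · change ‖r z‖ ≤ _
    rw [inv_mul_eq_div, le_div_iff₀ hμ, mul_comm]; exact hbd z
  · exact huniq _ _ _ _ (hr _) h (hy _)

/-- The resolvent `(μ - A)⁻¹`. -/
def resolvent (μ : ℝ) : X →L[ℝ] X :=
  if hμ : 0 < μ then (hA.exists_resolvent hμ).choose else 0

theorem resolvent_mem {μ : ℝ} (hμ : 0 < μ) (z : X) :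
    (hA.resolvent μ z, μ • hA.resolvent μ z - z) ∈ A.graph := by
  rw [resolvent, dif_pos hμ]; exact (hA.exists_resolvent hμ).choose_spec.1 z

theorem resolvent_apply {μ : ℝ} (hμ : 0 < μ) {x y : X} (h : (x, y) ∈ A.graph) :
    hA.resolvent μ (μ • x - y) = x := by
  rw [resolvent, dif_pos hμ]; exact (hA.exists_resolvent hμ).choose_spec.2.1 x y h

theorem norm_resolvent_le {μ : ℝ} (hμ : 0 < μ) (z : X) : μ * ‖hA.resolvent μ z‖ ≤ ‖z‖ := by
  rw [resolvent, dif_pos hμ]; exact (hA.exists_resolvent hμ).choose_spec.2.2 z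

theorem resolvent_identity {μ ν : ℝ} (hμ : 0 < μ) (hν : 0 < ν) (z : X) :
    hA.resolvent ν z - hA.resolvent μ z
      = (μ - ν) • hA.resolvent μ (hA.resolvent ν z) := by
  have h := hA.resolvent_apply hμ (hA.resolvent_mem hν z)
  have h2 : μ • hA.resolvent ν z - (ν • hA.resolvent ν z - z)
      = (μ - ν) • hA.resolvent ν z + z := by rw [sub_smul]; abel
  rw [h2, map_add, map_smul] at h
  rw [sub_eq_iff_eq_add]; exact h.symm

theorem resolvent_commute {μ ν : ℝ} (hμ : 0 < μ) (hν : 0 < ν) :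
    Commute (hA.resolvent μ) (hA.resolvent ν) := by
  rcases eq_or_ne μ ν with rfl | hne
  · exact Commute.refl _
  ext z
  change hA.resolvent μ (hA.resolvent ν z) = hA.resolvent ν (hA.resolvent μ z)
  have h1 := hA.resolvent_identity hμ hν z
  have h2 := hA.resolvent_identity hν hμ z
  have h3 : (μ - ν) • hA.resolvent μ (hA.resolvent ν z)
      = (μ - ν) • hA.resolvent ν (hA.resolvent μ z) := by
    rw [← h1, ← neg_sub (hA.resolvent μ z), h2, ← neg_smul, neg_sub]
  exact smul_right_injective X (sub_ne_zero.2 hne) h3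

/-- Let `v` be orthogonal to the domain and `x = (1 - A)⁻¹ v`. Then `⟨A x, x⟩ = ‖x‖² - ⟨v, x⟩ =
‖x‖²`, so dissipativity forces `x = 0`, and then `v = x - A x = 0`. -/
theorem dense_domain [CompleteSpace X] : Dense (A.domain : Set X) := by
  rw [Submodule.dense_iff_topologicalClosure_eq_top, Submodule.topologicalClosure_eq_top_iff,
    Submodule.eq_bot_iff]
  intro v hv
  rw [Submodule.mem_orthogonal] at hv
  have hm := hA.resolvent_mem one_pos v
  have h1 := hv _ (LinearPMap.mem_domain_of_mem_graph hm)
  have h2 := hA.dissipative _ _ hm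
  rw [one_smul, inner_sub_left, real_inner_comm, real_inner_comm _ v] at h2
  rw [real_inner_comm] at h1
  have h3 : inner ℝ (hA.resolvent 1 v) (hA.resolvent 1 v) ≤ 0 := by
    rw [real_inner_comm] at h1; linarith [real_inner_comm v (hA.resolvent 1 v)]
  have h4 : hA.resolvent 1 v = 0 :=
    inner_self_eq_zero.1 (le_antisymm h3 real_inner_self_nonneg)
  have h5 := hm
  rw [h4, smul_zero, zero_sub] at h5
  exact neg_eq_zero.1 (LinearPMap.graph_fst_eq_zero_snd A h5 rfl)

/-- The Yosida approximation `μ A (μ - A)⁻¹`. -/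
def yosida (μ : ℝ) : X →L[ℝ] X := μ ^ 2 • hA.resolvent μ - μ • 1

/-- On the domain the resolvent commutes with `A`. Hence the Yosida approximations converge to `A`
there and are bounded by `‖A x‖` uniformly in `μ`. -/
theorem yosida_apply_of_mem {μ : ℝ} (hμ : 0 < μ) {x y : X} (h : (x, y) ∈ A.graph) :
    hA.yosida μ x = μ • hA.resolvent μ y := by
  have h1 := hA.resolvent_apply hμ h
  rw [map_sub, map_smul, sub_eq_iff_eq_add] at h1
  change μ ^ 2 • hA.resolvent μ x - μ • x = _
  nth_rewrite 2 [← sub_eq_iff_eq_add.2 h1]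
  rw [smul_sub, smul_smul, pow_two, sub_sub_cancel]

/-- The bound `μ ‖(μ - A)⁻¹‖ ≤ 1` lets `μ ‖x‖²` dominate `μ² ⟨(μ - A)⁻¹ x, x⟩`; the approximations
are therefore dissipative too. -/
theorem yosida_inner_nonpos {μ : ℝ} (hμ : 0 < μ) (x : X) : inner ℝ (hA.yosida μ x) x ≤ 0 := by
  change inner ℝ (μ ^ 2 • hA.resolvent μ x - μ • x) x ≤ 0
  rw [inner_sub_left, real_inner_smul_left, real_inner_smul_left,
    real_inner_self_eq_norm_mul_norm]
  have h1 := real_inner_le_norm (hA.resolvent μ x) x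
  have h2 := hA.norm_resolvent_le hμ x
  have h3 : μ * inner ℝ (hA.resolvent μ x) x ≤ ‖x‖ * ‖x‖ := by
    refine (mul_le_mul_of_nonneg_left h1 hμ.le).trans ?_
    rw [← mul_assoc]; exact mul_le_mul_of_nonneg_right h2 (norm_nonneg _)
  nlinarith

theorem yosida_commute {μ ν : ℝ} (hμ : 0 < μ) (hν : 0 < ν) :
    Commute (hA.yosida μ) (hA.yosida ν) := by
  have h := hA.resolvent_commute hμ hν
  exact (((h.smul_left _).smul_right _).sub_right ((Commute.one_right _).smul_right _)).sub_left
    ((Commute.one_left _).smul_left _)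

theorem resolvent_commute_yosida {μ ν : ℝ} (hμ : 0 < μ) (hν : 0 < ν) :
    Commute (hA.resolvent μ) (hA.yosida ν) := by
  have h := hA.resolvent_commute hμ hν
  exact (h.smul_right _).sub_right ((Commute.one_right _).smul_right _)

theorem norm_yosida_le {μ : ℝ} (hμ : 0 < μ) {x y : X} (h : (x, y) ∈ A.graph) :
    ‖hA.yosida μ x‖ ≤ ‖y‖ := by
  rw [hA.yosida_apply_of_mem hμ h, norm_smul, Real.norm_of_nonneg hμ.le]
  exact hA.norm_resolvent_le hμ y

end IsMaximalDissipative

/-- If uniformly bounded operators converge pointwise on a dense set, they do so everywhere. -/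
theorem tendsto_of_dense {ι : Type*} {l : Filter ι} {Y : Type*} [NormedAddCommGroup Y]
    [NormedSpace ℝ Y] {T : ι → X →L[ℝ] Y}
    {U : X →L[ℝ] Y} {M : ℝ} (hT : ∀ᶠ i in l, ∀ x, ‖T i x‖ ≤ M * ‖x‖) (hU : ∀ x, ‖U x‖ ≤ M * ‖x‖)
    {s : Set X} (hs : Dense s) (h : ∀ x ∈ s, Tendsto (fun i => T i x) l (𝓝 (U x))) (x : X) :
    Tendsto (fun i => T i x) l (𝓝 (U x)) := by
  rw [Metric.tendsto_nhds]
  intro ε hε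
  have hM : 0 < |M| + 1 := by positivity
  obtain ⟨y, hy, hxy⟩ := Metric.dense_iff.1 hs x (ε / (3 * (|M| + 1))) (by positivity)
  rw [Metric.mem_ball, dist_comm, dist_eq_norm, lt_div_iff₀ (by positivity)] at hy
  have hb : ∀ v : X, M * ‖v‖ ≤ (|M| + 1) * ‖v‖ := fun v =>
    mul_le_mul_of_nonneg_right (by linarith [le_abs_self M]) (norm_nonneg _)
  filter_upwards [hT, Metric.tendsto_nhds.1 (h y hxy) (ε / 3) (by positivity)] with i h1 h2
  have h3 : T i x - U x = T i (x - y) + (T i y - U y) - U (x - y) := by simp only [map_sub]; abel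
  rw [dist_eq_norm] at h2 ⊢
  rw [h3]
  have h4 := (h1 (x - y)).trans (hb _)
  have h5 := (hU (x - y)).trans (hb _)
  have h6 := norm_sub_le (T i (x - y) + (T i y - U y)) (U (x - y))
  have h7 := norm_add_le (T i (x - y)) (T i y - U y)
  nlinarith

theorem commute_exp_smul {B C : X →L[ℝ] X} (h : Commute B C) (t : ℝ) :
    Commute B (NormedSpace.exp (t • C)) :=
  (h.smul_right t).exp_right

/-! ### Exponentials of bounded dissipative operators. -/

section Exp

variable [CompleteSpace X]

theorem hasDerivAt_exp_apply (B : X →L[ℝ] X) (x : X) (t : ℝ) :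
    HasDerivAt (fun s : ℝ => NormedSpace.exp (s • B) x) (NormedSpace.exp (t • B) (B x)) t := by
  have h := hasDerivAt_exp_smul_const (𝕂 := ℝ) B t
  exact ((ContinuousLinearMap.apply ℝ X x).hasFDerivAt.comp_hasDerivAt t h)

/-- The derivative of `‖exp(s B) x‖²` is `2 ⟨B y, y⟩` with `y = exp(s B) x`, hence nonpositive. -/
theorem norm_exp_apply_le {B : X →L[ℝ] X} (hB : ∀ x, inner ℝ (B x) x ≤ 0) {t : ℝ} (ht : 0 ≤ t)
    (x : X) : ‖NormedSpace.exp (t • B) x‖ ≤ ‖x‖ := by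
  have hd : ∀ s, HasDerivAt (fun s : ℝ => ‖NormedSpace.exp (s • B) x‖ ^ 2)
      (2 * inner ℝ (NormedSpace.exp (s • B) x) (NormedSpace.exp (s • B) (B x))) s := fun s =>
    (hasDerivAt_exp_apply B x s).norm_sq
  have hanti : Antitone (fun s : ℝ => ‖NormedSpace.exp (s • B) x‖ ^ 2) := by
    refine antitone_of_hasDerivAt_nonpos hd fun s => ?_
    have h1 : NormedSpace.exp (s • B) (B x) = B (NormedSpace.exp (s • B) x) :=
      (congrArg (fun T : X →L[ℝ] X => T x) (commute_exp_smul (Commute.refl B) s).eq).symm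
    rw [h1, real_inner_comm]
    exact mul_nonpos_of_nonneg_of_nonpos (by norm_num) (hB _)
  have := hanti ht
  simp only [zero_smul, NormedSpace.exp_zero] at this
  exact (sq_le_sq₀ (norm_nonneg _) (norm_nonneg _)).1 this

/-- Interpolate by `s ↦ exp(s B) exp((t - s) C) x`: by commutativity its derivative is the two
contractions applied to `B x - C x`, and the mean value inequality applies. -/
theorem norm_exp_sub_exp_le {B C : X →L[ℝ] X} (hB : ∀ x, inner ℝ (B x) x ≤ 0)
    (hC : ∀ x, inner ℝ (C x) x ≤ 0) (h : Commute B C) {t : ℝ} (ht : 0 ≤ t) (x : X) :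
    ‖NormedSpace.exp (t • B) x - NormedSpace.exp (t • C) x‖ ≤ ‖B x - C x‖ * t := by
  set F : ℝ → X := fun s => NormedSpace.exp (s • B) (NormedSpace.exp ((t - s) • C) x) with hF
  have hd : ∀ s, HasDerivAt F
      (NormedSpace.exp (s • B) (NormedSpace.exp ((t - s) • C) (B x - C x))) s := by
    intro s
    have h1 := hasDerivAt_exp_smul_const (𝕂 := ℝ) B s
    have h2 : HasDerivAt (fun s : ℝ => NormedSpace.exp ((t - s) • C) x)
        (-(NormedSpace.exp ((t - s) • C) (C x))) s := by
      have := (hasDerivAt_exp_apply C x (t - s)).scomp s ((hasDerivAt_id s).const_sub t)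
      simpa [Function.comp_def] using this
    have h3 := h1.clm_apply h2
    refine h3.congr_deriv ?_
    have h4 : B (NormedSpace.exp ((t - s) • C) x) = NormedSpace.exp ((t - s) • C) (B x) :=
      congrArg (fun T : X →L[ℝ] X => T x) (commute_exp_smul h (t - s)).eq
    rw [mul_apply_eq_comp, h4, map_neg, map_sub, map_sub]
    exact (sub_eq_add_neg _ _).symm
  have := norm_image_sub_le_of_norm_deriv_le_segment' (f := F) (a := 0) (b := t)
    (C := ‖B x - C x‖) (fun s _ => (hd s).hasDerivWithinAt) (fun s hs =>
      (norm_exp_apply_le hB hs.1 _).trans (norm_exp_apply_le hC (by linarith [hs.2]) _)) t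
      (right_mem_Icc.2 ht)
  simpa [hF] using this

end Exp

end Generation

/-! ### The semigroup as a limit of Yosida exponentials, its generator, and classical and mild
solutions. -/

section Semigroup

variable {X : Type*} [NormedAddCommGroup X] [InnerProductSpace ℝ X] [CompleteSpace X]

namespace IsMaximalDissipative

variable {A : X →ₗ.[ℝ] X} (hA : IsMaximalDissipative A)
include hA

/-- On the domain the error is `(μ - A)⁻¹ A z`, of size at most `‖A z‖ / μ`; density and the uniform
bound do the rest. The shift by one keeps `μ` positive. -/
theorem tendsto_smul_resolvent (x : X) :
    Tendsto (fun n : ℕ => ((n : ℝ) + 1) • hA.resolvent (n + 1) x) atTop (𝓝 x) := by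
  have hpos : ∀ n : ℕ, (0 : ℝ) < (n : ℝ) + 1 := fun n => by positivity
  refine tendsto_of_dense (T := fun n : ℕ => ((n : ℝ) + 1) • hA.resolvent (n + 1))
    (U := ContinuousLinearMap.id ℝ X) (M := 1) (Eventually.of_forall fun n z => ?_)
    (fun z => by simp) hA.dense_domain (fun z hz => ?_) x
  · have := hA.norm_resolvent_le (hpos n) z
    rw [smul_apply, norm_smul, Real.norm_of_nonneg (hpos n).le, one_mul]
    exact this
  · obtain ⟨y, hy⟩ := LinearPMap.mem_domain_iff.1 hz
    rw [tendsto_iff_norm_sub_tendsto_zero]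
    refine squeeze_zero (fun _ => norm_nonneg _) (g := fun n : ℕ => ‖y‖ / ((n : ℝ) + 1))
      (fun n => ?_) (tendsto_const_div_atTop_nhds_zero_nat ‖y‖ |>.comp (tendsto_add_atTop_nat 1)
        |>.congr fun n => by simp)
    have h1 := hA.resolvent_apply (hpos n) hy
    rw [map_sub, map_smul, sub_eq_iff_eq_add] at h1
    change ‖((n : ℝ) + 1) • hA.resolvent (n + 1) z - z‖ ≤ _
    rw [h1, add_sub_cancel_left, le_div_iff₀ (hpos n), mul_comm]
    exact hA.norm_resolvent_le (hpos n) y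

theorem tendsto_yosida {x y : X} (h : (x, y) ∈ A.graph) :
    Tendsto (fun n : ℕ => hA.yosida (n + 1) x) atTop (𝓝 y) := by
  refine (hA.tendsto_smul_resolvent y).congr fun n => ?_
  exact (hA.yosida_apply_of_mem (by positivity) h).symm

/-- The approximating semigroup generated by the Yosida approximation of index `n`. -/
def approx (n : ℕ) (t : ℝ) : X →L[ℝ] X := NormedSpace.exp (t • hA.yosida (n + 1))

theorem norm_approx_le (n : ℕ) {t : ℝ} (ht : 0 ≤ t) (x : X) : ‖hA.approx n t x‖ ≤ ‖x‖ :=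
  norm_exp_apply_le (hA.yosida_inner_nonpos (by positivity)) ht x

theorem cauchySeq_approx {t : ℝ} (ht : 0 ≤ t) (x : X) :
    CauchySeq fun n => hA.approx n t x := by
  rw [Metric.cauchySeq_iff']
  intro ε hε
  obtain ⟨z, hz, hxz⟩ := Metric.dense_iff.1 hA.dense_domain x (ε / 4) (by positivity)
  rw [Metric.mem_ball, dist_comm, dist_eq_norm] at hz
  obtain ⟨y, hy⟩ := LinearPMap.mem_domain_iff.1 hxz
  -- The difference of the exponentials grows like `t` times this quantity; `t + 1` in place of `t`
  -- covers `t = 0`.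
  obtain ⟨N, hN⟩ := Metric.cauchySeq_iff'.1 (hA.tendsto_yosida hy).cauchySeq (ε / (4 * (t + 1)))
    (by positivity)
  refine ⟨N, fun n hn => ?_⟩
  have h1 := hN n hn
  rw [dist_eq_norm, lt_div_iff₀ (by positivity)] at h1
  have h2 : ‖hA.approx n t z - hA.approx N t z‖ ≤ _ :=
    norm_exp_sub_exp_le (hA.yosida_inner_nonpos (by positivity))
      (hA.yosida_inner_nonpos (by positivity))
      (hA.yosida_commute (by positivity) (by positivity)) ht z
  rw [dist_eq_norm]
  have h3 : hA.approx n t x - hA.approx N t x = hA.approx n t (x - z)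
      + (hA.approx n t z - hA.approx N t z) - hA.approx N t (x - z) := by
    simp only [map_sub]; abel
  rw [h3]
  have h4 := norm_sub_le (hA.approx n t (x - z) + (hA.approx n t z - hA.approx N t z))
    (hA.approx N t (x - z))
  have h5 := norm_add_le (hA.approx n t (x - z)) (hA.approx n t z - hA.approx N t z)
  have h6 := hA.norm_approx_le n ht (x - z)
  have h7 := hA.norm_approx_le N ht (x - z)
  nlinarith [norm_nonneg (hA.yosida (n + 1) z - hA.yosida (N + 1) z)]

/-- The semigroup generated by `A`, extended evenly to negative times. -/
def semigroup (t : ℝ) : X →L[ℝ] X :=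
  continuousLinearMapOfTendsto (fun n => hA.approx n |t|)
    (tendsto_pi_nhds.2 fun x => tendsto_nhds_limUnder (cauchySeq_tendsto_of_complete (hA.cauchySeq_approx (abs_nonneg t) x)))

theorem tendsto_approx {t : ℝ} (ht : 0 ≤ t) (x : X) :
    Tendsto (fun n => hA.approx n t x) atTop (𝓝 (hA.semigroup t x)) := by
  have : Tendsto (fun n => hA.approx n |t| x) atTop (𝓝 (hA.semigroup t x)) :=
    tendsto_nhds_limUnder (cauchySeq_tendsto_of_complete (hA.cauchySeq_approx (abs_nonneg t) x))
  simpa only [abs_of_nonneg ht] using this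

theorem norm_semigroup_le {t : ℝ} (ht : 0 ≤ t) (x : X) : ‖hA.semigroup t x‖ ≤ ‖x‖ :=
  le_of_tendsto (hA.tendsto_approx ht x).norm (Eventually.of_forall fun n => hA.norm_approx_le n ht x)

theorem semigroup_zero : hA.semigroup 0 = 1 := by
  ext x
  refine tendsto_nhds_unique (hA.tendsto_approx le_rfl x) (tendsto_const_nhds.congr fun n => ?_)
  simp [approx, NormedSpace.exp_zero]

theorem approx_add (n : ℕ) (s t : ℝ) : hA.approx n (s + t) = hA.approx n s * hA.approx n t := by
  let _ : NormedAlgebra ℚ (X →L[ℝ] X) := NormedAlgebra.restrictScalars ℚ ℝ _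
  rw [approx, add_smul, NormedSpace.exp_add_of_commute]
  · rfl
  · exact ((Commute.refl _).smul_left _).smul_right _

/-- Uniform contractivity allows the vector to vary with `n`, as it does in products of
approximations and in `exp(s A_n) A_n x`. -/
theorem tendsto_approx_apply {t : ℝ} (ht : 0 ≤ t) {x : ℕ → X} {y : X}
    (hx : Tendsto x atTop (𝓝 y)) :
    Tendsto (fun n => hA.approx n t (x n)) atTop (𝓝 (hA.semigroup t y)) := by
  have h1 : Tendsto (fun n => hA.approx n t (x n - y)) atTop (𝓝 0) :=
    squeeze_zero_norm (fun n => hA.norm_approx_le n ht _) (tendsto_iff_norm_sub_tendsto_zero.1 hx)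
  simpa [map_sub] using h1.add (hA.tendsto_approx ht y)

theorem semigroup_add {s t : ℝ} (hs : 0 ≤ s) (ht : 0 ≤ t) :
    hA.semigroup (s + t) = hA.semigroup s * hA.semigroup t := by
  ext x
  refine tendsto_nhds_unique (hA.tendsto_approx (add_nonneg hs ht) x)
    ((hA.tendsto_approx_apply hs (hA.tendsto_approx ht x)).congr fun n => ?_)
  rw [hA.approx_add]; rfl

theorem resolvent_semigroup {μ : ℝ} (hμ : 0 < μ) {t : ℝ} (ht : 0 ≤ t) (x : X) :
    hA.resolvent μ (hA.semigroup t x) = hA.semigroup t (hA.resolvent μ x) := by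
  refine tendsto_nhds_unique
    (((hA.resolvent μ).continuous.tendsto _).comp (hA.tendsto_approx ht x))
    ((hA.tendsto_approx ht _).congr fun n => ?_)
  exact (congrArg (fun T : X →L[ℝ] X => T x)
    (commute_exp_smul (hA.resolvent_commute_yosida hμ (by positivity)) t).eq).symm

/-- The domain is the range of the resolvent, so commutation with the resolvent is invariance of the
domain together with `A S(t) = S(t) A`. -/
theorem semigroup_mem {x y : X} (h : (x, y) ∈ A.graph) {t : ℝ} (ht : 0 ≤ t) :
    (hA.semigroup t x, hA.semigroup t y) ∈ A.graph := by
  have h1 := hA.resolvent_apply one_pos h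
  have h2 := hA.resolvent_mem one_pos (hA.semigroup t ((1 : ℝ) • x - y))
  rw [hA.resolvent_semigroup one_pos ht, h1] at h2
  simpa using h2

/-- The fundamental theorem of calculus holds for each approximation; `‖A x‖` dominates the
integrands uniformly in `n`, so the limit may be taken under the integral. -/
theorem semigroup_sub_eq_integral {x y : X} (h : (x, y) ∈ A.graph) {t : ℝ} (ht : 0 ≤ t) :
    hA.semigroup t x - x = ∫ s in (0 : ℝ)..t, hA.semigroup s y := by
  have hder : ∀ n s, HasDerivAt (fun s => hA.approx n s x)
      (hA.approx n s (hA.yosida (n + 1) x)) s := fun n s => hasDerivAt_exp_apply _ _ _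
  have hcont : ∀ n, Continuous fun s => hA.approx n s (hA.yosida (n + 1) x) := fun n =>
    continuous_iff_continuousAt.2 fun s => (hasDerivAt_exp_apply _ _ _).continuousAt
  have hn : ∀ n, ∫ s in (0 : ℝ)..t, hA.approx n s (hA.yosida (n + 1) x) = hA.approx n t x - x := by
    intro n
    rw [intervalIntegral.integral_eq_sub_of_hasDerivAt (fun s _ => hder n s)
      ((hcont n).intervalIntegrable _ _)]
    simp [approx, NormedSpace.exp_zero]
  refine tendsto_nhds_unique ((hA.tendsto_approx ht x).sub_const x) ?_
  have := intervalIntegral.tendsto_integral_filter_of_dominated_convergence (μ := volume)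
    (l := atTop) (a := 0) (b := t)
    (F := fun n s => hA.approx n s (hA.yosida (n + 1) x)) (f := fun s => hA.semigroup s y)
    (fun _ => ‖y‖) (Eventually.of_forall fun n => (hcont n).aestronglyMeasurable)
    (Eventually.of_forall fun n => Eventually.of_forall fun s hs => by
      rw [uIoc_of_le ht] at hs
      exact (hA.norm_approx_le n hs.1.le _).trans (hA.norm_yosida_le (by positivity) h))
    intervalIntegrable_const
    (Eventually.of_forall fun s hs => by
      rw [uIoc_of_le ht] at hs
      exact hA.tendsto_approx_apply hs.1.le (hA.tendsto_yosida h))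
  exact this.congr fun n => hn n

theorem norm_semigroup_sub_le {x y : X} (h : (x, y) ∈ A.graph) {t : ℝ} (ht : 0 ≤ t) :
    ‖hA.semigroup t x - x‖ ≤ ‖y‖ * t := by
  refine le_of_tendsto ((hA.tendsto_approx ht x).sub_const x).norm
    (Eventually.of_forall fun n => ?_)
  -- Comparison with the zero operator, whose exponential is the identity.
  have := norm_exp_sub_exp_le (hA.yosida_inner_nonpos (μ := n + 1) (by positivity))
    (C := 0) (fun x => by simp) (Commute.zero_right _) ht x
  simp only [smul_zero, NormedSpace.exp_zero, zero_apply, sub_zero] at this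
  exact this.trans (mul_le_mul_of_nonneg_right (hA.norm_yosida_le (by positivity) h) ht)

theorem tendsto_semigroup (x : X) : Tendsto (fun t => hA.semigroup t x) (𝓝[≥] 0) (𝓝 x) := by
  refine tendsto_of_dense (T := hA.semigroup) (U := ContinuousLinearMap.id ℝ X) (M := 1) ?_
    (fun z => by simp) hA.dense_domain (fun z hz => ?_) x
  · filter_upwards [self_mem_nhdsWithin] with t ht z
    rw [one_mul]; exact hA.norm_semigroup_le ht z
  · obtain ⟨y, hy⟩ := LinearPMap.mem_domain_iff.1 hz
    rw [tendsto_iff_norm_sub_tendsto_zero]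
    have h0 : Tendsto (fun t : ℝ => ‖y‖ * t) (𝓝[≥] 0) (𝓝 0) := by
      have : Tendsto (fun t : ℝ => ‖y‖ * t) (𝓝 0) (𝓝 (‖y‖ * 0)) :=
        tendsto_id.const_mul _
      rw [mul_zero] at this
      exact this.mono_left nhdsWithin_le_nhds
    refine squeeze_zero' (Eventually.of_forall fun _ => norm_nonneg _) ?_ h0
    filter_upwards [self_mem_nhdsWithin] with t ht
    exact hA.norm_semigroup_sub_le hy ht

theorem norm_semigroup_sub_semigroup_le (x : X) {s t : ℝ} (hs : 0 ≤ s) (ht : 0 ≤ t) :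
    ‖hA.semigroup t x - hA.semigroup s x‖ ≤ ‖hA.semigroup |t - s| x - x‖ := by
  wlog hst : s ≤ t generalizing s t
  · rw [norm_sub_rev, abs_sub_comm]; exact this ht hs (le_of_not_ge hst)
  have h1 : hA.semigroup t x - hA.semigroup s x
      = hA.semigroup s (hA.semigroup (t - s) x - x) := by
    rw [map_sub, ← mul_apply_eq_comp, ← hA.semigroup_add hs (sub_nonneg.2 hst), add_sub_cancel]
  rw [h1, abs_of_nonneg (sub_nonneg.2 hst)]
  exact hA.norm_semigroup_le hs _

theorem continuousOn_semigroup (x : X) : ContinuousOn (fun t => hA.semigroup t x) (Ici 0) := by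
  intro s hs
  change Tendsto _ _ _
  rw [tendsto_iff_norm_sub_tendsto_zero]
  have h1 : Tendsto (fun t : ℝ => |t - s|) (𝓝[Ici 0] s) (𝓝[≥] 0) := by
    refine tendsto_nhdsWithin_iff.2 ⟨?_, Eventually.of_forall fun t => mem_Ici.2 (abs_nonneg _)⟩
    have : Tendsto (fun t : ℝ => |t - s|) (𝓝 s) (𝓝 |s - s|) :=
      (continuous_id.sub continuous_const).abs.tendsto s
    rw [sub_self, abs_zero] at this
    exact this.mono_left nhdsWithin_le_nhds
  have h2 := tendsto_iff_norm_sub_tendsto_zero.1 ((hA.tendsto_semigroup x).comp h1)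
  refine squeeze_zero' (Eventually.of_forall fun _ => norm_nonneg _) ?_ h2
  filter_upwards [self_mem_nhdsWithin] with t ht
  exact hA.norm_semigroup_sub_semigroup_le x hs ht

theorem isContractionSemigroup : IsContractionSemigroup hA.semigroup where
  zero := hA.semigroup_zero
  add _ _ hs ht := hA.semigroup_add hs ht
  tendsto x := (hA.tendsto_semigroup x).mono_left (nhdsWithin_mono _ Ioi_subset_Ici_self)
  contraction t ht := ContinuousLinearMap.opNorm_le_bound _ zero_le_one fun x => by
    rw [one_mul]; exact hA.norm_semigroup_le ht x

theorem hasDerivWithinAt_semigroup {x y : X} (h : (x, y) ∈ A.graph) {t : ℝ} (ht : 0 ≤ t) :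
    HasDerivWithinAt (fun s => hA.semigroup s x) (hA.semigroup t y) (Ici 0) t := by
  -- extend the integrand continuously to negative times
  have hcont : Continuous fun s : ℝ => hA.semigroup |s| y :=
    (hA.continuousOn_semigroup y).comp_continuous continuous_abs fun s => abs_nonneg s
  have h1 : HasDerivAt (fun s => x + ∫ r in (0 : ℝ)..s, hA.semigroup |r| y)
      (hA.semigroup |t| y) t :=
    (intervalIntegral.integral_hasDerivAt_right (hcont.intervalIntegrable _ _)
      (hcont.stronglyMeasurableAtFilter _ _) hcont.continuousAt).const_add x
  rw [abs_of_nonneg ht] at h1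
  have h2 : ∀ s ∈ Ici (0 : ℝ), hA.semigroup s x = x + ∫ r in (0 : ℝ)..s, hA.semigroup |r| y := by
    intro s hs
    rw [← sub_eq_iff_eq_add', hA.semigroup_sub_eq_integral h hs]
    refine intervalIntegral.integral_congr fun r hr => ?_
    rw [uIcc_of_le hs] at hr
    simp only [abs_of_nonneg hr.1]
  exact h1.hasDerivWithinAt.congr h2 (h2 t ht)

/-- The generator of the semigroup extends `A` and is dissipative by contractivity. Since `1 - A` is
already onto, a dissipative extension cannot be proper. -/
theorem isGenerator : IsGenerator A hA.semigroup := by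
  have key : ∀ x y, (x, y) ∈ A.graph →
      Tendsto (fun t : ℝ => t⁻¹ • (hA.semigroup t x - x)) (𝓝[>] 0) (𝓝 y) := by
    intro x y h
    have h1 := (hA.hasDerivWithinAt_semigroup h le_rfl).mono Ioi_subset_Ici_self
    rw [hA.semigroup_zero, hasDerivWithinAt_iff_tendsto_slope' self_notMem_Ioi] at h1
    refine h1.congr fun t => ?_
    simp [slope, hA.semigroup_zero]
  refine fun x y => ⟨key x y, fun h => ?_⟩
  -- The pair `(x' - x, y' - y)` lies in the graph of the generator and has equal entries by this
  -- choice, so dissipativity makes it zero.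
  obtain ⟨x', y', hm, he⟩ := hA.range 1 one_pos ((1 : ℝ) • x - y)
  have h1 : Tendsto (fun t : ℝ => t⁻¹ • (hA.semigroup t (x' - x) - (x' - x))) (𝓝[>] 0)
      (𝓝 (y' - y)) := by
    refine ((key x' y' hm).sub h).congr fun t => ?_
    rw [map_sub, ← smul_sub]; congr 1; abel
  have h2 : inner ℝ (y' - y) (x' - x) ≤ 0 := by
    refine le_of_tendsto (h1.inner tendsto_const_nhds) ?_
    filter_upwards [self_mem_nhdsWithin] with t ht
    rw [real_inner_smul_left, inner_sub_left, real_inner_self_eq_norm_mul_norm]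
    refine mul_nonpos_of_nonneg_of_nonpos (inv_nonneg.2 (le_of_lt ht)) ?_
    have h3 := real_inner_le_norm (hA.semigroup t (x' - x)) (x' - x)
    have h4 := hA.norm_semigroup_le (le_of_lt ht) (x' - x)
    nlinarith [norm_nonneg (x' - x)]
  have h3 : y' - y = x' - x := by
    simp only [one_smul] at he
    rw [sub_eq_sub_iff_add_eq_add] at he ⊢
    rw [add_comm y', he.symm, add_comm]
  rw [h3] at h2
  have h4 : x' = x := sub_eq_zero.1 (inner_self_eq_zero.1 (le_antisymm h2 real_inner_self_nonneg))
  rw [h4, sub_self, sub_eq_zero] at h3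
  rwa [h4, h3] at hm

omit [CompleteSpace X] in
-- `‖D t‖²` has derivative `2 ⟨A D, D⟩ ≤ 0`. Both uniqueness assertions rest on this;
-- differentiability at `0` is not required.
theorem eq_zero_of_hasDerivAt {D : ℝ → X} (h0 : D 0 = 0) (hc : ContinuousOn D (Ici 0))
    (h : ∀ t, 0 < t → ∃ y, (D t, y) ∈ A.graph ∧ HasDerivAt D y t) {t : ℝ} (ht : 0 ≤ t) :
    D t = 0 := by
  have hanti : AntitoneOn (fun t => ‖D t‖ ^ 2) (Ici 0) := by
    choose! y hm hd using h
    refine antitoneOn_of_hasDerivWithinAt_nonpos (convex_Ici 0) (hc.norm.pow 2)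
      (f' := fun t => 2 * inner ℝ (D t) (y t)) (fun t ht => ?_) (fun t ht => ?_)
    · rw [interior_Ici] at ht
      exact (hd t ht).norm_sq.hasDerivWithinAt
    · rw [interior_Ici] at ht
      rw [real_inner_comm]
      exact mul_nonpos_of_nonneg_of_nonpos (by norm_num) (hA.dissipative _ _ (hm t ht))
  have := hanti (mem_Ici.2 le_rfl) (mem_Ici.2 ht) ht
  simp only [h0, norm_zero] at this
  have h1 : ‖D t‖ ^ 2 = 0 := le_antisymm (by simpa using this) (sq_nonneg _)
  exact norm_eq_zero.1 (pow_eq_zero_iff two_ne_zero |>.1 h1)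

theorem isClassicalSolution {x : X} (hx : x ∈ A.domain) :
    IsClassicalSolution A x (fun t => hA.semigroup t x) := by
  obtain ⟨y, hy⟩ := LinearPMap.mem_domain_iff.1 hx
  have hd : ∀ t, 0 < t → HasDerivAt (fun t => hA.semigroup t x) (hA.semigroup t y) t := fun t ht =>
    (hA.hasDerivWithinAt_semigroup hy ht.le).hasDerivAt (Ici_mem_nhds ht)
  refine ⟨by rw [hA.semigroup_zero]; rfl, hA.continuousOn_semigroup x, ?_, fun t ht => ?_⟩
  · exact ((hA.continuousOn_semigroup y).mono Ioi_subset_Ici_self).congr fun t ht => (hd t ht).deriv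
  · have hm := hA.semigroup_mem hy ht.le
    refine ⟨LinearPMap.mem_domain_of_mem_graph hm, ?_⟩
    rw [← (LinearPMap.image_iff (LinearPMap.mem_domain_of_mem_graph hm)).2 hm]
    exact hd t ht

theorem isContinuousIntoDomain {x : X} (hx : x ∈ A.domain) :
    IsContinuousIntoDomain A (fun t => hA.semigroup t x) := by
  obtain ⟨y, hy⟩ := LinearPMap.mem_domain_iff.1 hx
  refine ⟨hA.continuousOn_semigroup x, fun t =>
    LinearPMap.mem_domain_of_mem_graph (hA.semigroup_mem hy t.2), ?_⟩
  refine (continuousOn_iff_continuous_domRestrict.1 (hA.continuousOn_semigroup y)).congr fun t => ?_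
  exact (LinearPMap.image_iff _).2 (hA.semigroup_mem hy t.2)

theorem contDiffOn_semigroup {x : X} (hx : x ∈ A.domain) :
    ContDiffOn ℝ 1 (fun t => hA.semigroup t x) (Ici 0) := by
  obtain ⟨y, hy⟩ := LinearPMap.mem_domain_iff.1 hx
  have hd := fun t (ht : t ∈ Ici (0 : ℝ)) => hA.hasDerivWithinAt_semigroup hy (mem_Ici.1 ht)
  have := (contDiffOn_succ_iff_derivWithin (n := 0) (𝕜 := ℝ) (f := fun t => hA.semigroup t x)
    (uniqueDiffOn_Ici 0)).2 ⟨fun t ht => (hd t ht).differentiableWithinAt, by simp, by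
      rw [contDiffOn_zero]
      exact (hA.continuousOn_semigroup y).congr fun t ht =>
        (hd t ht).derivWithin (uniqueDiffOn_Ici 0 t ht)⟩
  simpa using this

theorem classical_unique {x : X} (hx : x ∈ A.domain) {Ψ : ℝ → X}
    (hΨ : IsClassicalSolution A x Ψ) : EqOn Ψ (fun t => hA.semigroup t x) (Ici 0) := by
  have hS := hA.isClassicalSolution hx
  intro t ht
  refine sub_eq_zero.1 (hA.eq_zero_of_hasDerivAt (D := fun t => Ψ t - hA.semigroup t x) ?_
    (hΨ.continuousOn.sub hS.continuousOn) (fun t ht => ?_) (mem_Ici.1 ht))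
  · rw [hΨ.init, hA.semigroup_zero]; exact sub_self x
  · obtain ⟨h1, h2⟩ := hΨ.equation t ht
    obtain ⟨h3, h4⟩ := hS.equation t ht
    exact ⟨_, A.graph.sub_mem (A.mem_graph ⟨Ψ t, h1⟩) (A.mem_graph ⟨_, h3⟩), h2.sub h4⟩

/-- Let `I` be the integral and `R = (1 - A)⁻¹`. The integral formula for `R x`, with `A R x = R x -
x`, gives `S(t) R x - R x = R I - I`, that is, `I = R (I - (S(t) x - x))`. So `I` is in the range of
`R`, and `A I` can be read off. -/
theorem integral_mem {x : X} {t : ℝ} (ht : 0 ≤ t) :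
    (∫ s in (0 : ℝ)..t, hA.semigroup s x, hA.semigroup t x - x) ∈ A.graph := by
  set R := hA.resolvent 1 with hR
  have hc : ∀ z, IntervalIntegrable (fun s => hA.semigroup s z) volume 0 t := fun z =>
    ((hA.continuousOn_semigroup z).mono (by rw [uIcc_of_le ht]; exact Icc_subset_Ici_self)
      ).intervalIntegrable
  have h1 := hA.resolvent_mem one_pos x
  have h2 := hA.semigroup_sub_eq_integral h1 ht
  have h3 : ∫ s in (0 : ℝ)..t, hA.semigroup s ((1 : ℝ) • R x - x)
      = R (∫ s in (0 : ℝ)..t, hA.semigroup s x) - ∫ s in (0 : ℝ)..t, hA.semigroup s x := by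
    rw [← ContinuousLinearMap.intervalIntegral_comp_comm _ (hc x),
      ← intervalIntegral.integral_sub ((hc (R x)).congr fun s hs => ?_) (hc x)]
    · refine intervalIntegral.integral_congr fun s hs => ?_
      rw [uIcc_of_le ht] at hs
      simp only [one_smul, map_sub]
      rw [hR, hA.resolvent_semigroup one_pos hs.1]
    · rw [uIoc_of_le ht] at hs
      exact (hA.resolvent_semigroup one_pos hs.1.le x).symm
  rw [h3] at h2
  set I := ∫ s in (0 : ℝ)..t, hA.semigroup s x
  have h4 := hA.resolvent_mem one_pos (I - (hA.semigroup t x - x))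
  have h5 : R (I - (hA.semigroup t x - x)) = I := by
    rw [map_sub, map_sub, hR, hA.resolvent_semigroup one_pos ht, h2]; simp [hR]
  rw [← hR, h5] at h4
  simpa using h4

theorem isMildSolution (x : X) : IsMildSolution A x (fun t => hA.semigroup t x) := by
  refine ⟨hA.continuousOn_semigroup x, fun t ht => ?_⟩
  have hm := hA.integral_mem (x := x) ht
  refine ⟨LinearPMap.mem_domain_of_mem_graph hm, ?_⟩
  rw [← (LinearPMap.image_iff (LinearPMap.mem_domain_of_mem_graph hm)).2 hm, add_sub_cancel]

/-- The primitive of the difference `δ` of two mild solutions is a curve in the domain with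
derivative `δ = A ∫ δ`, hence zero; then `δ = A 0 = 0`. -/
theorem mild_unique {x : X} {Ψ : ℝ → X} (hΨ : IsMildSolution A x Ψ) :
    EqOn Ψ (fun t => hA.semigroup t x) (Ici 0) := by
  have hS := hA.isMildSolution x
  -- Reflecting in `t` makes the difference continuous on the whole line, so its primitive is
  -- differentiable everywhere, including at `0`.
  set δ : ℝ → X := fun t => Ψ |t| - hA.semigroup |t| x with hδ
  have hcont : Continuous δ :=
    (hΨ.continuousOn.sub hS.continuousOn).comp_continuous continuous_abs fun s => abs_nonneg s
  have hd : ∀ t, HasDerivAt (fun t => ∫ s in (0 : ℝ)..t, δ s) (δ t) t := fun t =>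
    intervalIntegral.integral_hasDerivAt_right (hcont.intervalIntegrable _ _)
      (hcont.stronglyMeasurableAtFilter _ _) hcont.continuousAt
  have hi : ∀ {Φ : ℝ → X} (_ : ContinuousOn Φ (Ici 0)) {t : ℝ} (_ : 0 ≤ t),
      IntervalIntegrable Φ volume 0 t := fun h t ht =>
    (h.mono (by rw [uIcc_of_le ht]; exact Icc_subset_Ici_self)).intervalIntegrable
  have hm : ∀ t, 0 ≤ t → (∫ s in (0 : ℝ)..t, δ s, δ t) ∈ A.graph := by
    intro t ht
    obtain ⟨h1, h2⟩ := hΨ.equation t ht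
    obtain ⟨h3, h4⟩ := hS.equation t ht
    have := A.graph.sub_mem (A.mem_graph ⟨_, h1⟩) (A.mem_graph ⟨_, h3⟩)
    convert this using 1
    refine Prod.ext ?_ ?_
    · change _ = (∫ s in (0 : ℝ)..t, Ψ s) - ∫ s in (0 : ℝ)..t, hA.semigroup s x
      rw [← intervalIntegral.integral_sub (hi hΨ.continuousOn ht) (hi hS.continuousOn ht)]
      refine intervalIntegral.integral_congr fun s hs => ?_
      rw [uIcc_of_le ht] at hs
      simp only [abs_of_nonneg hs.1]
    · change δ t = A ⟨_, h1⟩ - A ⟨_, h3⟩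
      simp only [hδ, abs_of_nonneg ht]
      rw [h2, h4]; abel
  have hz : ∀ t, 0 ≤ t → ∫ s in (0 : ℝ)..t, δ s = 0 := fun t ht =>
    hA.eq_zero_of_hasDerivAt (D := fun t => ∫ s in (0 : ℝ)..t, δ s) (by simp)
      (fun t _ => (hd t).continuousAt.continuousWithinAt)
      (fun t ht => ⟨_, hm t ht.le, hd t⟩) ht
  intro t ht
  have h1 := hm t ht
  rw [hz t ht] at h1
  have h2 := LinearPMap.graph_fst_eq_zero_snd A h1 rfl
  simp only [hδ, abs_of_nonneg (mem_Ici.1 ht)] at h2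
  exact sub_eq_zero.1 h2

end IsMaximalDissipative

end Semigroup

/-! ### The Volterra operator on `L²(I)` -/

section Volterra

/-- Fubini's theorem on the triangle `a < τ < s < b`. -/
theorem integral_smul_primitive {E : Type*} [NormedAddCommGroup E] [NormedSpace ℝ E]
    [CompleteSpace E] {a b : ℝ} (hab : a ≤ b) {h : ℝ → ℝ} {G : ℝ → E}
    (hh : IntegrableOn h (Ioc a b)) (hG : IntegrableOn G (Ioc a b)) :
    ∫ s in a..b, h s • ∫ τ in a..s, G τ = ∫ τ in a..b, (∫ s in τ..b, h s) • G τ := by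
  set μ := volume.restrict (Ioc a b) with hμ
  have hprod : Integrable (fun p : ℝ × ℝ => h p.1 • G p.2) (μ.prod μ) := hh.smul_prod hG
  have hmeas : MeasurableSet {p : ℝ × ℝ | p.2 ≤ p.1} :=
    measurableSet_le measurable_snd measurable_fst
  have hswap := integral_integral_swap (f := fun s τ =>
    ({p : ℝ × ℝ | p.2 ≤ p.1}.indicator (fun p => h p.1 • G p.2)) (s, τ))
    (hprod.indicator hmeas)
  rw [intervalIntegral.integral_of_le hab, intervalIntegral.integral_of_le hab]
  calc ∫ s in Ioc a b, h s • ∫ τ in a..s, G τ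
      = ∫ s in Ioc a b, ∫ τ in Ioc a b,
          ({p : ℝ × ℝ | p.2 ≤ p.1}.indicator (fun p => h p.1 • G p.2)) (s, τ) := by
        refine setIntegral_congr_fun measurableSet_Ioc fun s hs => ?_
        have h1 : (fun τ => ({p : ℝ × ℝ | p.2 ≤ p.1}.indicator (fun p => h p.1 • G p.2)) (s, τ))
            = (Iic s).indicator fun τ => h s • G τ := by
          funext τ; simp [indicator]
        simp only [h1]
        rw [setIntegral_indicator measurableSet_Iic, integral_smul,
          intervalIntegral.integral_of_le hs.1.le]
        congr 3
        ext τ; simp only [mem_inter_iff, mem_Ioc, mem_Iic]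
        constructor
        · exact fun h => ⟨⟨h.1, h.2.trans hs.2⟩, h.2⟩
        · exact fun h => ⟨h.1.1, h.2⟩
    _ = _ := hswap
    _ = _ := by
        refine setIntegral_congr_fun measurableSet_Ioc fun τ hτ => ?_
        have h1 : (fun s => ({p : ℝ × ℝ | p.2 ≤ p.1}.indicator (fun p => h p.1 • G p.2)) (s, τ))
            = (Ici τ).indicator fun s => h s • G τ := by
          funext s; simp [indicator]
        simp only [h1]
        rw [setIntegral_indicator measurableSet_Ici, integral_smul_const,
          intervalIntegral.integral_of_le hτ.2, ← integral_Icc_eq_integral_Ioc]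
        congr 3
        ext s; simp only [mem_inter_iff, mem_Ioc, mem_Icc, mem_Ici]
        constructor
        · exact fun h => ⟨h.2, h.1.2⟩
        · exact fun h => ⟨⟨hτ.1.trans_le h.1, h.2⟩, h.1⟩

variable {L : ℝ}

theorem integrable_L2I (v : L2I L) : IntegrableOn v (Ioo 0 L) :=
  (Lp.memLp v).integrable (by norm_num)

theorem integrableOn_Ioc_L2I (v : L2I L) : IntegrableOn v (Ioc 0 L) :=
  (integrableOn_Ioc_iff_integrableOn_Ioo (by simp)).2 (integrable_L2I v)

theorem intervalIntegrable_L2I (v : L2I L) {x y : ℝ} (hx : x ∈ Icc 0 L) (hy : y ∈ Icc 0 L) :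
    IntervalIntegrable v volume x y := by
  rw [intervalIntegrable_iff]
  refine (integrableOn_Ioc_L2I v).mono_set fun z hz => ?_
  rw [mem_uIoc] at hz
  rcases hz with hz | hz
  · exact ⟨hx.1.trans_lt hz.1, hz.2.trans hy.2⟩
  · exact ⟨hy.1.trans_lt hz.1, hz.2.trans hx.2⟩

theorem inner_eq_integral (u v : L2I L) : inner ℝ u v = ∫ x in Ioo 0 L, u x * v x := by
  rw [L2.inner_def]
  refine integral_congr_ae (Eventually.of_forall fun x => ?_)
  simp [mul_comm]

/-- The constant function `1`. -/
def oneI (L : ℝ) : L2I L := (memLp_const (1 : ℝ)).toLp fun _ => 1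

theorem coeFn_oneI : oneI L =ᵐ[volume.restrict (Ioo 0 L)] fun _ => (1 : ℝ) := MemLp.coeFn_toLp _

/-- The integral over `I`. -/
def ell (L : ℝ) : L2I L →L[ℝ] ℝ := innerSL ℝ (oneI L)

theorem ell_apply (v : L2I L) : ell L v = ∫ x in Ioo 0 L, v x := by
  change inner ℝ (oneI L) v = _
  rw [inner_eq_integral]
  refine integral_congr_ae ?_
  filter_upwards [coeFn_oneI] with x hx
  rw [hx, one_mul]

theorem inner_oneI_left (v : L2I L) : inner ℝ (oneI L) v = ell L v := rfl

theorem inner_oneI_right (v : L2I L) : inner ℝ v (oneI L) = ell L v := real_inner_comm _ _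

theorem norm_le_of_ae_le {v : L2I L} {B : ℝ}
    (h : ∀ᵐ x ∂(volume.restrict (Ioo 0 L)), |v x| ≤ B) : ‖v‖ ≤ B * ‖oneI L‖ := by
  refine Lp.norm_le_mul_norm_of_ae_le_mul ?_
  filter_upwards [h, coeFn_oneI] with x h1 h2
  rw [h2]; simpa using h1

theorem integral_abs_le (v : L2I L) : ∫ x in Ioo 0 L, |v x| ≤ ‖oneI L‖ * ‖v‖ := by
  have hm : MemLp (fun x => |v x|) 2 (volume.restrict (Ioo 0 L)) := (Lp.memLp v).abs
  have h1 := real_inner_le_norm (oneI L) hm.toLp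
  rw [inner_oneI_left, ell_apply, integral_congr_ae hm.coeFn_toLp] at h1
  refine h1.trans (mul_le_mul_of_nonneg_left ?_ (norm_nonneg _))
  refine Lp.norm_le_norm_of_ae_le ?_
  filter_upwards [hm.coeFn_toLp] with x hx
  rw [hx]; simp

/-- The continuous representative of `K v`. -/
def primR (v : L2I L) (x : ℝ) : ℝ := ∫ y in x..L, v y

theorem continuousOn_primR (v : L2I L) : ContinuousOn (primR v) (Icc 0 L) := by
  rcases le_or_gt 0 L with hL | hL
  · have h1 : ContinuousOn (fun x => ∫ y in (0 : ℝ)..x, v y) (Icc 0 L) := by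
      have := intervalIntegral.continuousOn_primitive_interval (μ := volume) (f := v) (a := 0)
        (b := L) (by
          rw [uIcc_of_le hL]
          exact (integrableOn_Icc_iff_integrableOn_Ioo (by simp) (by simp)).2 (integrable_L2I v))
      rwa [uIcc_of_le hL] at this
    refine ((continuousOn_const (c := ∫ y in (0 : ℝ)..L, v y)).sub h1).congr fun x hx => ?_
    have h0 : (0 : ℝ) ∈ Icc 0 L := ⟨le_rfl, hL⟩
    have hL' : L ∈ Icc 0 L := ⟨hL, le_rfl⟩
    have := intervalIntegral.integral_add_adjacent_intervals (intervalIntegrable_L2I v h0 hx)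
      (intervalIntegrable_L2I v hx hL')
    exact eq_sub_of_add_eq' this
  · rw [Icc_eq_empty (not_le.2 hL)]; exact continuousOn_empty _

theorem abs_primR_le (v : L2I L) {x : ℝ} (hx : x ∈ Icc 0 L) :
    |primR v x| ≤ ∫ y in Ioo 0 L, |v y| := by
  rw [primR, intervalIntegral.integral_of_le hx.2, integral_Ioc_eq_integral_Ioo]
  refine (norm_integral_le_integral_norm (G := ℝ) _).trans ?_
  exact setIntegral_mono_set (integrable_L2I v).norm (Eventually.of_forall fun _ => norm_nonneg _)
    (Ioo_subset_Ioo_left hx.1).eventuallyLE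

theorem memLp_primR (v : L2I L) : MemLp (primR v) 2 (volume.restrict (Ioo 0 L)) := by
  refine MemLp.of_bound (((continuousOn_primR v).mono Ioo_subset_Icc_self).aestronglyMeasurable
    measurableSet_Ioo) (∫ y in Ioo 0 L, |v y|) ?_
  filter_upwards [ae_restrict_mem measurableSet_Ioo] with x hx
  exact abs_primR_le v (Ioo_subset_Icc_self hx)

theorem primR_congr {v : L2I L} {w : ℝ → ℝ} (h : v =ᵐ[volume.restrict (Ioo 0 L)] w) {x : ℝ}
    (hx : x ∈ Icc 0 L) : primR v x = ∫ y in x..L, w y := by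
  rw [primR, intervalIntegral.integral_of_le hx.2, intervalIntegral.integral_of_le hx.2,
    integral_Ioc_eq_integral_Ioo, integral_Ioc_eq_integral_Ioo]
  exact integral_congr_ae (ae_mono (Measure.restrict_mono_set _ (Ioo_subset_Ioo_left hx.1)) h)

/-- The Volterra operator `(K v)(x) = ∫ₓᴸ v`. -/
def volterra (L : ℝ) : L2I L →L[ℝ] L2I L :=
  LinearMap.mkContinuous
    { toFun := fun v => (memLp_primR v).toLp
      map_add' := fun u v => by
        rw [← MemLp.toLp_add, MemLp.toLp_eq_toLp_iff]
        filter_upwards [ae_restrict_mem measurableSet_Ioo] with x hx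
        have hx' := Ioo_subset_Icc_self hx
        have hL : L ∈ Icc 0 L := ⟨hx'.1.trans hx'.2, le_rfl⟩
        rw [primR_congr (Lp.coeFn_add u v) hx', Pi.add_apply, primR, primR]
        exact intervalIntegral.integral_add (intervalIntegrable_L2I u hx' hL)
          (intervalIntegrable_L2I v hx' hL)
      map_smul' := fun c v => by
        rw [RingHom.id_apply, ← MemLp.toLp_const_smul, MemLp.toLp_eq_toLp_iff]
        filter_upwards [ae_restrict_mem measurableSet_Ioo] with x hx
        rw [primR_congr (Lp.coeFn_smul c v) (Ioo_subset_Icc_self hx), Pi.smul_apply, primR]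
        exact intervalIntegral.integral_smul c _ }
    (‖oneI L‖ * ‖oneI L‖) fun v => by
      have := norm_le_of_ae_le (v := (memLp_primR v).toLp) (B := ∫ y in Ioo 0 L, |v y|) (by
        filter_upwards [ae_restrict_mem measurableSet_Ioo, (memLp_primR v).coeFn_toLp] with x hx h
        rw [h]; exact abs_primR_le v (Ioo_subset_Icc_self hx))
      refine this.trans ?_
      rw [mul_right_comm]
      exact mul_le_mul_of_nonneg_right (integral_abs_le v) (norm_nonneg _)

theorem coeFn_volterra (v : L2I L) :
    volterra L v =ᵐ[volume.restrict (Ioo 0 L)] fun x => ∫ y in x..L, v y :=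
  (memLp_primR v).coeFn_toLp

theorem hasTrace_volterra_right (v : L2I L) : HasTrace L (volterra L v) L 0 :=
  ⟨primR v, continuousOn_primR v, coeFn_volterra v, by rw [primR, intervalIntegral.integral_same]⟩

theorem ell_eq_intervalIntegral (hL : 0 < L) (v : L2I L) : ell L v = ∫ x in (0 : ℝ)..L, v x := by
  rw [ell_apply, intervalIntegral.integral_of_le hL.le, integral_Ioc_eq_integral_Ioo]

theorem hasTrace_volterra_left (hL : 0 < L) (v : L2I L) :
    HasTrace L (volterra L v) 0 (ell L v) :=
  ⟨primR v, continuousOn_primR v, coeFn_volterra v, (ell_eq_intervalIntegral hL v).symm⟩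

theorem HasTrace.unique (hL : 0 < L) {u : L2I L} {x c d : ℝ} (hx : x ∈ Icc 0 L)
    (hc : HasTrace L u x c) (hd : HasTrace L u x d) : c = d := by
  obtain ⟨r, hr, hur, rfl⟩ := hc
  obtain ⟨s, hs, hus, rfl⟩ := hd
  have h1 : EqOn r s (Ioo 0 L) := Measure.eqOn_open_of_ae_eq (hur.symm.trans hus) isOpen_Ioo
    (hr.mono Ioo_subset_Icc_self) (hs.mono Ioo_subset_Icc_self)
  exact h1.of_subset_closure hr hs Ioo_subset_Icc_self (by rw [closure_Ioo hL.ne]) hx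

/-- Integration by parts for the Volterra operator. -/
theorem inner_volterra (hL : 0 < L) (v w : L2I L) :
    inner ℝ (volterra L v) w + inner ℝ v (volterra L w) = ell L v * ell L w := by
  have h := integral_smul_primitive hL.le (integrableOn_Ioc_L2I v) (integrableOn_Ioc_L2I w)
  rw [intervalIntegral.integral_of_le hL.le, intervalIntegral.integral_of_le hL.le,
    integral_Ioc_eq_integral_Ioo, integral_Ioc_eq_integral_Ioo] at h
  have h1 : inner ℝ (volterra L v) w = ∫ τ in Ioo 0 L, (∫ s in τ..L, v s) • w τ := by
    rw [inner_eq_integral]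
    refine integral_congr_ae ?_
    filter_upwards [coeFn_volterra v] with x hx
    rw [hx, smul_eq_mul]
  -- `ell L w • oneI L - volterra L w` is the primitive `∫₀ˢ w`, the form in which Fubini's theorem
  -- on the triangle delivers the other side.
  have h2 : inner ℝ v (ell L w • oneI L - volterra L w)
      = ∫ s in Ioo 0 L, v s • ∫ τ in (0 : ℝ)..s, w τ := by
    rw [inner_eq_integral]
    refine integral_congr_ae ?_
    filter_upwards [coeFn_volterra w, Lp.coeFn_sub (ell L w • oneI L) (volterra L w),
      Lp.coeFn_smul (ell L w) (oneI L), coeFn_oneI, ae_restrict_mem measurableSet_Ioo]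
      with x h3 h4 h5 h6 hx
    have hx' := Ioo_subset_Icc_self hx
    rw [h4, Pi.sub_apply, h5, Pi.smul_apply, h6, h3, smul_eq_mul, mul_one, smul_eq_mul,
      ell_eq_intervalIntegral hL, ← intervalIntegral.integral_add_adjacent_intervals
        (intervalIntegrable_L2I w (left_mem_Icc.2 hL.le) hx')
        (intervalIntegrable_L2I w hx' (right_mem_Icc.2 hL.le)), add_sub_cancel_right]
  rw [inner_sub_right, real_inner_smul_right, inner_oneI_right] at h2
  linarith

theorem inner_volterra_self (hL : 0 < L) (v : L2I L) :
    inner ℝ (volterra L v) v = ell L v ^ 2 / 2 := by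
  have := inner_volterra hL v v
  rw [real_inner_comm] at this
  rw [real_inner_comm]; linarith

theorem inner_volterra_of_ell_eq_zero (hL : 0 < L) {v w : L2I L} (h : ell L w = 0) :
    inner ℝ (volterra L v) w = -inner ℝ v (volterra L w) := by
  have := inner_volterra hL v w
  rw [h, mul_zero] at this; linarith

/-! ### Powers of the Volterra operator -/

/-- Each further integration from `x` to `L` turns `(L - x)^n / n!` into the next such term; the
factorial makes the operator quasinilpotent. -/
theorem abs_volterra_pow_le (v : L2I L) (n : ℕ) :
    ∀ᵐ x ∂(volume.restrict (Ioo 0 L)), |(volterra L ^ (n + 1)) v x|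
      ≤ (∫ y in Ioo 0 L, |v y|) * ((L - x) ^ n / n.factorial) := by
  set M := ∫ y in Ioo 0 L, |v y|
  have hM : 0 ≤ M := integral_nonneg fun _ => abs_nonneg _
  induction n with
  | zero =>
    filter_upwards [coeFn_volterra v, ae_restrict_mem measurableSet_Ioo] with x h hx
    have := abs_primR_le v (Ioo_subset_Icc_self hx)
    rw [primR] at this
    simpa [h] using this
  | succ n ih =>
    set w := (volterra L ^ (n + 1)) v with hw
    have h0 : (volterra L ^ (n + 1 + 1)) v = volterra L w := by
      rw [hw, pow_succ' _ (n + 1)]; rfl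
    rw [h0]
    filter_upwards [coeFn_volterra w, ae_restrict_mem measurableSet_Ioo] with x h hx
    have hx' := Ioo_subset_Icc_self hx
    rw [h, intervalIntegral.integral_of_le hx.2.le, integral_Ioc_eq_integral_Ioo]
    have hd : ∀ y, HasDerivAt (fun y => -(M * ((L - y) ^ (n + 1) / (n + 1).factorial)))
        (M * ((L - y) ^ n / n.factorial)) y := by
      intro y
      have h1 := ((((hasDerivAt_id y).const_sub L).pow (n + 1)).div_const
        ((n + 1).factorial : ℝ)).const_mul M |>.neg
      refine h1.congr_deriv ?_
      rw [Nat.factorial_succ]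
      have : (n.factorial : ℝ) ≠ 0 := by positivity
      have : (n + 1 : ℝ) ≠ 0 := by positivity
      push_cast
      simp only [id]
      field_simp
    have hc : Continuous fun y : ℝ => M * ((L - y) ^ n / n.factorial) := by fun_prop
    calc |∫ y in Ioo x L, w y| ≤ ∫ y in Ioo x L, |w y| :=
          norm_integral_le_integral_norm (G := ℝ) _
      _ ≤ ∫ y in Ioo x L, M * ((L - y) ^ n / n.factorial) := by
          refine integral_mono_ae ?_ ?_ (ae_mono
            (Measure.restrict_mono_set _ (Ioo_subset_Ioo_left hx.1.le)) ih)
          · exact ((integrable_L2I w).mono_set (Ioo_subset_Ioo_left hx.1.le)).abs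
          · exact (hc.integrableOn_Icc (a := x) (b := L)).mono_set Ioo_subset_Icc_self
      _ = _ := by
          rw [← integral_Ioc_eq_integral_Ioo, ← intervalIntegral.integral_of_le hx.2.le,
            intervalIntegral.integral_eq_sub_of_hasDerivAt (fun y _ => hd y)
              (hc.intervalIntegrable _ _)]
          simp

theorem norm_volterra_pow_le (hL : 0 < L) (n : ℕ) :
    ‖volterra L ^ (n + 1)‖ ≤ ‖oneI L‖ ^ 2 * (L ^ n / n.factorial) := by
  refine ContinuousLinearMap.opNorm_le_bound _ (by positivity) fun v => ?_
  have hM : 0 ≤ ∫ y in Ioo 0 L, |v y| := integral_nonneg fun _ => abs_nonneg _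
  have h1 := norm_le_of_ae_le (v := (volterra L ^ (n + 1)) v)
    (B := (∫ y in Ioo 0 L, |v y|) * (L ^ n / n.factorial)) (by
      filter_upwards [abs_volterra_pow_le v n, ae_restrict_mem measurableSet_Ioo] with x h hx
      refine h.trans (mul_le_mul_of_nonneg_left ?_ hM)
      have : (L - x) ^ n ≤ L ^ n :=
        pow_le_pow_left₀ (by linarith [hx.2]) (by linarith [hx.1]) n
      gcongr)
  refine h1.trans ?_
  have h2 := integral_abs_le v
  calc _ ≤ (‖oneI L‖ * ‖v‖) * (L ^ n / n.factorial) * ‖oneI L‖ := by gcongr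
    _ = _ := by ring

/-- `1 - x` is one of two commuting factors of `1 - x ^ n`, which is invertible by the Neumann
series. -/
theorem isUnit_one_sub_of_norm_pow_lt {R : Type*} [NormedRing R] [CompleteSpace R] {x : R} {n : ℕ}
    (h : ‖x ^ n‖ < 1) : IsUnit (1 - x) := by
  have h1 : IsUnit (1 - x ^ n) := isUnit_one_sub_of_norm_lt_one h
  rw [← mul_neg_geom_sum] at h1
  exact ((Commute.isUnit_mul_iff
    (Commute.sum_right _ _ _ fun i _ =>
      ((Commute.one_left _).sub_left ((Commute.refl x).pow_right i)))).1 h1).1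

/-- `a - K Q` is invertible for `a ≠ 0` and `Q` commuting with `K`: the Volterra operator is
quasinilpotent. -/
theorem isUnit_smul_one_sub_volterra_mul (hL : 0 < L) {a : ℝ} (ha : a ≠ 0)
    {Q : L2I L →L[ℝ] L2I L} (hQ : Commute (volterra L) Q) :
    IsUnit (a • (1 : L2I L →L[ℝ] L2I L) - volterra L * Q) := by
  have hlim : Tendsto (fun n : ℕ => ‖oneI L‖ ^ 2 * (‖a⁻¹ • Q‖ * ((L * ‖a⁻¹ • Q‖) ^ n / n.factorial)))
      atTop (𝓝 (‖oneI L‖ ^ 2 * (‖a⁻¹ • Q‖ * 0))) :=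
    ((FloorSemiring.tendsto_pow_div_factorial_atTop _).const_mul _).const_mul _
  rw [mul_zero, mul_zero] at hlim
  -- For large `n` the factorial beats `(L ‖a⁻¹ Q‖)^n`, so some power of `K (a⁻¹ Q)` has norm below
  -- `1`; commutativity splits that power.
  obtain ⟨n, hn⟩ := (hlim.eventually (gt_mem_nhds one_pos)).exists
  have hQ' : Commute (volterra L) (a⁻¹ • Q) := hQ.smul_right _
  have h1 : ‖(volterra L * (a⁻¹ • Q)) ^ (n + 1)‖ < 1 := by
    rw [hQ'.mul_pow]
    refine (norm_mul_le _ _).trans_lt (lt_of_le_of_lt ?_ hn)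
    calc _ ≤ ‖oneI L‖ ^ 2 * (L ^ n / n.factorial) * ‖a⁻¹ • Q‖ ^ (n + 1) :=
          mul_le_mul (norm_volterra_pow_le hL n) (norm_pow_le' _ n.succ_pos) (norm_nonneg _)
            (by positivity)
      _ = _ := by rw [mul_pow]; ring
  have h2 := isUnit_one_sub_of_norm_pow_lt h1
  have h3 : a • (1 : L2I L →L[ℝ] L2I L) - volterra L * Q
      = (Units.mk0 a ha) • (1 - volterra L * (a⁻¹ • Q)) := by
    change _ = a • ((1 : L2I L →L[ℝ] L2I L) - volterra L * (a⁻¹ • Q))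
    rw [mul_smul_comm, smul_sub, smul_smul, mul_inv_cancel₀ ha, one_smul]
  rw [h3]
  exact h2.smul (Units.mk0 a ha)

end Volterra

/-! ### Test functions, weak derivatives and the Volterra operator -/

section WeakDeriv

variable {L : ℝ}

/-- The class in `L²(I)` of a test function. -/
def testL2 (L : ℝ) {U : Set ℝ} {φ : ℝ → ℝ} (h : IsTest U φ) : L2I L :=
  MemLp.toLp φ ((h.smooth.continuous.memLp_of_hasCompactSupport h.compact).restrict _)

theorem coeFn_testL2 {U : Set ℝ} {φ : ℝ → ℝ} (h : IsTest U φ) :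
    testL2 L h =ᵐ[volume.restrict (Ioo 0 L)] φ := MemLp.coeFn_toLp _

theorem testL2_congr {U : Set ℝ} {φ ψ : ℝ → ℝ} (h : IsTest U φ) (h' : IsTest U ψ) (he : φ = ψ) :
    testL2 L h = testL2 L h' := by
  subst he; rfl

theorem inner_testL2 (u : L2I L) {U : Set ℝ} {φ : ℝ → ℝ} (h : IsTest U φ) :
    inner ℝ u (testL2 L h) = ∫ x in Ioo 0 L, u x * φ x := by
  rw [inner_eq_integral]
  refine integral_congr_ae ?_
  filter_upwards [coeFn_testL2 h] with x hx
  rw [hx]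

theorem IsTest.eq_zero {φ : ℝ → ℝ} (h : IsTest (Ioo 0 L) φ) {x : ℝ} (hx : x ∉ Ioo 0 L) : φ x = 0 :=
  image_eq_zero_of_notMem_tsupport fun hx' => hx (h.support hx')

theorem IsTest.integral_deriv {U : Set ℝ} {φ : ℝ → ℝ} (h : IsTest U φ) (a b : ℝ) :
    ∫ x in a..b, _root_.deriv φ x = φ b - φ a :=
  intervalIntegral.integral_deriv_eq_sub
    (fun x _ => h.smooth.differentiable (by simp) x)
    (h.deriv.smooth.continuous.intervalIntegrable _ _)

theorem volterra_testL2_deriv {φ : ℝ → ℝ} (h : IsTest (Ioo 0 L) φ) :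
    volterra L (testL2 L h.deriv) = -testL2 L h := by
  refine Lp.ext ?_
  filter_upwards [coeFn_volterra (testL2 L h.deriv), Lp.coeFn_neg (testL2 L h), coeFn_testL2 h,
    ae_restrict_mem measurableSet_Ioo] with x h1 h2 h3 hx
  have h4 := primR_congr (coeFn_testL2 (L := L) h.deriv) (Ioo_subset_Icc_self hx)
  rw [primR] at h4
  rw [h1, h2, Pi.neg_apply, h3, h4, h.integral_deriv, h.eq_zero (x := L) (by simp), zero_sub]

theorem ell_testL2_deriv (hL : 0 < L) {φ : ℝ → ℝ} (h : IsTest (Ioo 0 L) φ) :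
    ell L (testL2 L h.deriv) = 0 := by
  rw [ell_apply, integral_congr_ae (coeFn_testL2 (L := L) h.deriv), ← integral_Ioc_eq_integral_Ioo,
    ← intervalIntegral.integral_of_le hL.le, h.integral_deriv, h.eq_zero (x := L) (by simp),
    h.eq_zero (x := 0) (by simp), sub_self]

/-- The class in `L²(I)` of the `n`-th derivative of a test function. -/
abbrev testD {φ : ℝ → ℝ} (h : IsTest (Ioo 0 L) φ) (n : ℕ) : L2I L := testL2 L (h.iteratedDeriv n)

theorem testD_succ {φ : ℝ → ℝ} (h : IsTest (Ioo 0 L) φ) (n : ℕ) :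
    testD h (n + 1) = testL2 L (h.iteratedDeriv n).deriv :=
  testL2_congr _ _ iteratedDeriv_succ

/-- The derivative of a test function has mean zero, so against it `K` is skew without boundary term
and cancels the derivative. -/
theorem inner_testD_succ (hL : 0 < L) (v : L2I L) {φ : ℝ → ℝ} (h : IsTest (Ioo 0 L) φ) (n : ℕ) :
    inner ℝ (volterra L v) (testD h (n + 1)) = inner ℝ v (testD h n) := by
  rw [testD_succ, inner_volterra_of_ell_eq_zero hL (ell_testL2_deriv hL (h.iteratedDeriv n)), volterra_testL2_deriv,
    inner_neg_right, neg_neg]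

theorem inner_testD_add (hL : 0 < L) (v : L2I L) {φ : ℝ → ℝ} (h : IsTest (Ioo 0 L) φ) (n i : ℕ) :
    inner ℝ ((volterra L ^ i) v) (testD h (n + i)) = inner ℝ v (testD h n) := by
  induction i with
  | zero => rfl
  | succ i ih =>
    rw [pow_succ' (volterra L) i]
    exact (inner_testD_succ hL _ h (n + i)).trans ih

theorem exists_test_integral_one (hL : 0 < L) : ∃ ψ, IsTest (Ioo 0 L) ψ ∧ ∫ x, ψ x = 1 := by
  let B : ContDiffBump (L / 2 : ℝ) := ⟨L / 8, L / 4, by linarith, by linarith⟩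
  refine ⟨B.normed volume, ⟨B.contDiff_normed, B.hasCompactSupport_normed, ?_⟩,
    B.integral_normed⟩
  rw [B.tsupport_normed_eq]
  intro x hx
  have hB : B.rOut = L / 4 := rfl
  rw [Metric.mem_closedBall, Real.dist_eq, abs_le, hB] at hx
  constructor <;> linarith [hx.1, hx.2]

theorem IsTest.sub_const_mul {U : Set ℝ} {χ ψ : ℝ → ℝ} (hχ : IsTest U χ) (hψ : IsTest U ψ) (m : ℝ) :
    IsTest U (fun x => χ x - m * ψ x) where
  smooth := hχ.smooth.sub (contDiff_const.mul hψ.smooth)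
  compact := hχ.compact.sub (hψ.compact.mul_left (f := fun _ => m))
  support := (tsupport_sub χ (fun x => m * ψ x)).trans (union_subset hχ.support
    ((tsupport_mul_subset_right (f := fun _ => m) (g := ψ)).trans hψ.support))

theorem IsTest.integrable' {U : Set ℝ} {χ : ℝ → ℝ} (h : IsTest U χ) : MeasureTheory.Integrable χ :=
  h.smooth.continuous.integrable_of_hasCompactSupport h.compact

/-- A test function is, up to a multiple of a fixed one, the derivative of a test function. -/
theorem exists_deriv_eq_sub {χ ψ : ℝ → ℝ} (hχ : IsTest (Ioo 0 L) χ) (hψ : IsTest (Ioo 0 L) ψ)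
    (h1 : ∫ x, ψ x = 1) :
    ∃ φ, IsTest (Ioo 0 L) φ ∧ deriv φ = fun x => χ x - (∫ y, χ y) * ψ x :=
  exists_primitive (hχ.sub_const_mul hψ _) (by
    rw [integral_sub hχ.integrable' (hψ.integrable'.const_mul _), integral_const_mul, h1]; simp)

theorem ell_testL2 {φ : ℝ → ℝ} (h : IsTest (Ioo 0 L) φ) : ell L (testL2 L h) = ∫ x, φ x := by
  rw [ell_apply, integral_congr_ae (coeFn_testL2 (L := L) h)]
  exact setIntegral_eq_integral_of_forall_compl_eq_zero fun x hx => h.eq_zero hx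

/-- The lemma of du Bois-Reymond for derivatives of order `n`. -/
theorem eq_sum_of_inner_testD_eq_zero (hL : 0 < L) (n : ℕ) (q : L2I L)
    (hq : ∀ φ (h : IsTest (Ioo 0 L) φ), inner ℝ q (testD h n) = 0) :
    ∃ c : ℕ → ℝ, q = ∑ i ∈ Finset.range n, c i • (volterra L ^ i) (oneI L) := by
  induction n generalizing q with
  | zero =>
    refine ⟨0, ?_⟩
    rw [Finset.sum_range_zero]
    refine eq_zero_of_test q fun φ h => ?_
    rw [← inner_testL2 q h, testL2_congr h (h.iteratedDeriv 0) iteratedDeriv_zero.symm]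
    exact hq φ h
  | succ n ih =>
    obtain ⟨ψ, hψ, hψ1⟩ := exists_test_integral_one hL
    -- The coefficient of the new top term `K^n 1`, normalised by `∫ ψ = 1`.
    set c := inner ℝ q (testD hψ n) with hc
    obtain ⟨d, hd⟩ := ih (q - c • (volterra L ^ n) (oneI L)) fun χ hχ => by
      -- After subtraction of a multiple of `ψ`, `χ` becomes `φ'`, so `q` annihilates its `n`-th
      -- derivative. The discarded multiple contributes `c ∫ χ`, which is the pairing of `c K^n 1`
      -- with the `n`-th derivative of `χ`.
      obtain ⟨φ, hφ, hder⟩ := exists_deriv_eq_sub hχ hψ hψ1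
      have h1 : testD hφ (n + 1) = testD hχ n - (∫ y, χ y) • testD hψ n := by
        have he : iteratedDeriv (n + 1) φ
            = iteratedDeriv n χ - (∫ y, χ y) • iteratedDeriv n ψ := by
          funext x
          rw [iteratedDeriv_succ', hder]
          have h2 : (fun x => χ x - (∫ y, χ y) * ψ x) = χ - (∫ y, χ y) • ψ := rfl
          rw [h2, iteratedDeriv_sub (f := χ) (g := (∫ y, χ y) • ψ) (contDiff_infty.1 hχ.smooth n).contDiffAt
            ((contDiff_infty.1 hψ.smooth n).const_smul (∫ y, χ y)).contDiffAt,
            iteratedDeriv_const_smul_field]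
          rfl
        refine Lp.ext ?_
        filter_upwards [coeFn_testL2 (L := L) (hφ.iteratedDeriv (n + 1)),
          coeFn_testL2 (L := L) (hχ.iteratedDeriv n), coeFn_testL2 (L := L) (hψ.iteratedDeriv n),
          Lp.coeFn_sub (testD hχ n) ((∫ y, χ y) • testD hψ n),
          Lp.coeFn_smul (∫ y, χ y) (testD hψ n)] with x a1 a2 a3 a4 a5
        rw [a4, Pi.sub_apply, a5, Pi.smul_apply, a1, a2, a3, he]; rfl
      have h2 := hq φ hφ
      rw [h1, inner_sub_right, real_inner_smul_right, ← hc] at h2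
      have h3 := inner_testD_add hL (oneI L) hχ 0 n
      have e1 : testD hχ 0 = testL2 L hχ := testL2_congr _ _ iteratedDeriv_zero
      have e2 : testD hχ (0 + n) = testD hχ n := testL2_congr _ _ (by rw [zero_add])
      rw [e1, e2, inner_oneI_left, ell_testL2] at h3
      rw [inner_sub_left, real_inner_smul_left, h3]; linarith
    refine ⟨fun i => if i = n then c else d i, ?_⟩
    simp only [Finset.sum_range_succ, if_pos]
    rw [← sub_eq_iff_eq_add, hd]
    refine Finset.sum_congr rfl fun i hi => ?_
    rw [if_neg (Finset.mem_range.1 hi).ne]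

theorem isWeakDeriv_iff_inner {u v : L2I L} : IsWeakDeriv L u v ↔
    ∀ φ (h : IsTest (Ioo 0 L) φ), inner ℝ u (testL2 L h.deriv) = -inner ℝ v (testL2 L h) := by
  simp only [inner_testL2]; rfl

theorem inner_testL2_deriv (hL : 0 < L) (v : L2I L) {φ : ℝ → ℝ} (h : IsTest (Ioo 0 L) φ) :
    inner ℝ (volterra L v) (testL2 L h.deriv) = inner ℝ v (testL2 L h) := by
  rw [inner_volterra_of_ell_eq_zero hL (ell_testL2_deriv hL h), volterra_testL2_deriv,
    inner_neg_right, neg_neg]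

theorem isWeakDeriv_neg_volterra (hL : 0 < L) (v : L2I L) : IsWeakDeriv L (-volterra L v) v :=
  isWeakDeriv_iff_inner.2 fun φ h => by rw [inner_neg_left, inner_testL2_deriv hL v h]

theorem IsWeakDeriv.eq_sub_volterra (hL : 0 < L) {u v : L2I L} (h : IsWeakDeriv L u v) :
    ∃ c : ℝ, u = c • oneI L - volterra L v := by
  obtain ⟨c, hc⟩ := eq_sum_of_inner_testD_eq_zero hL 1 (u + volterra L v) fun φ hφ => by
    have he : testD hφ 1 = testL2 L hφ.deriv := testL2_congr _ _ iteratedDeriv_one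
    rw [he, inner_add_left, inner_testL2_deriv hL v hφ, isWeakDeriv_iff_inner.1 h φ hφ, neg_add_cancel]
  refine ⟨c 0, ?_⟩
  rw [eq_sub_iff_add_eq, hc]
  simp

theorem hasTrace_oneI (x : ℝ) : HasTrace L (oneI L) x 1 :=
  ⟨fun _ => 1, continuousOn_const, coeFn_oneI, rfl⟩

theorem HasTrace.neg {u : L2I L} {x c : ℝ} (h : HasTrace L u x c) : HasTrace L (-u) x (-c) := by
  simpa using h.smul (-1)

/-- Evaluation at `L`, where `K v` vanishes, kills the constant; differentiation then kills `v`. -/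
theorem eq_zero_of_smul_oneI_add_volterra (hL : 0 < L) {c : ℝ} {v : L2I L}
    (h : c • oneI L + volterra L v = 0) : c = 0 ∧ v = 0 := by
  have hc : c = 0 := by
    have h1 := ((hasTrace_oneI (L := L) L).smul c).add (hasTrace_volterra_right v)
    rw [h] at h1
    have := h1.unique hL (right_mem_Icc.2 hL.le) (hasTrace_zero L L)
    linarith
  refine ⟨hc, ?_⟩
  rw [hc, zero_smul, zero_add] at h
  have h1 := isWeakDeriv_neg_volterra hL v
  rw [h, neg_zero] at h1
  exact h1.eq_zero

theorem volterra_injective (hL : 0 < L) : Function.Injective (volterra L) :=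
  (injective_iff_map_eq_zero _).2 fun v hv =>
    (eq_zero_of_smul_oneI_add_volterra hL (c := 0) (by rw [zero_smul, zero_add, hv])).2

theorem oneI_ne_zero (hL : 0 < L) : oneI L ≠ 0 := fun h => by
  have := (hasTrace_oneI (L := L) 0)
  rw [h] at this
  exact one_ne_zero (this.unique hL (left_mem_Icc.2 hL.le) (hasTrace_zero L 0))

theorem IsWeakDeriv.eq_neg_volterra (hL : 0 < L) {u v : L2I L} (h : IsWeakDeriv L u v)
    (ht : HasTrace L u L 0) : u = -volterra L v := by
  obtain ⟨c, rfl⟩ := h.eq_sub_volterra hL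
  have h1 := ((hasTrace_oneI (L := L) L).smul c).add (hasTrace_volterra_right v).neg
  rw [← sub_eq_add_neg] at h1
  have h2 := h1.unique hL (right_mem_Icc.2 hL.le) ht
  have hc : c = 0 := by linarith
  rw [hc, zero_smul, zero_sub]

/-- The zero trace at `L` makes each derivative `-K` of the next, and the value of that function at
`0` is then `-ell` of the next derivative. All later use of `H₀ᵐ` goes through `K` and `ell`. -/
theorem mem_sob0_iff (hL : 0 < L) {m : ℕ} {v : Jet L m} : v ∈ Sob0 L m ↔
    ∀ j : Fin m, v j.castSucc = -volterra L (v j.succ) ∧ ell L (v j.succ) = 0 := by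
  constructor
  · intro h j
    have h1 := (h.1 j).eq_neg_volterra hL (h.2 j).2
    have h2 := (h.2 j).1
    rw [h1] at h2
    have h3 := (hasTrace_volterra_left hL (v j.succ)).neg.unique hL (left_mem_Icc.2 hL.le) h2
    exact ⟨h1, neg_eq_zero.1 h3⟩
  · intro h
    refine ⟨fun j => ?_, fun j => ?_⟩
    · rw [(h j).1]; exact isWeakDeriv_neg_volterra hL _
    · rw [(h j).1]
      constructor
      · simpa [(h j).2] using (hasTrace_volterra_left hL (v j.succ)).neg
      · simpa using (hasTrace_volterra_right (v j.succ)).neg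

theorem Sob0.apply_eq (hL : 0 < L) {m : ℕ} {v : Jet L m} (hv : v ∈ Sob0 L m) (j : Fin (m + 1)) :
    v j = ((-volterra L) ^ (m - j : ℕ)) (v (Fin.last m)) := by
  induction j using Fin.reverseInduction with
  | last => simp
  | cast j ih =>
    have h : m - (j.castSucc : ℕ) = (m - (j.succ : ℕ)) + 1 := by
      simp only [Fin.val_castSucc, Fin.val_succ]; omega
    rw [((mem_sob0_iff hL).1 hv j).1, ih, h, pow_succ']; rfl

theorem Sob0.ell_pow_last (hL : 0 < L) {m : ℕ} {v : Jet L m} (hv : v ∈ Sob0 L m) {i : ℕ}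
    (hi : i < m) : ell L (((-volterra L) ^ i) (v (Fin.last m))) = 0 := by
  have h := ((mem_sob0_iff hL).1 hv ⟨m - 1 - i, by omega⟩).2
  rw [Sob0.apply_eq hL hv] at h
  have h1 : m - ((⟨m - 1 - i, by omega⟩ : Fin m).succ : ℕ) = i := by
    simp only [Fin.val_succ]; omega
  rwa [h1] at h

/-- The jet of the function whose `m`-th derivative is `w` and whose derivatives of order `< m`
vanish at `L`. -/
def jetOf (m : ℕ) (w : L2I L) : Jet L m := WithLp.toLp 2 fun j => ((-volterra L) ^ (m - j : ℕ)) w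

theorem jetOf_mem (hL : 0 < L) {m : ℕ} {w : L2I L}
    (h : ∀ i < m, ell L (((-volterra L) ^ i) w) = 0) : jetOf m w ∈ Sob0 L m := by
  refine (mem_sob0_iff hL).2 fun j => ⟨?_, ?_⟩
  · change ((-volterra L) ^ (m - (j.castSucc : ℕ))) w
      = -volterra L (((-volterra L) ^ (m - (j.succ : ℕ))) w)
    have h : m - (j.castSucc : ℕ) = (m - (j.succ : ℕ)) + 1 := by
      simp only [Fin.val_castSucc, Fin.val_succ]; omega
    rw [h, pow_succ']; rfl
  · exact h _ (by simp only [Fin.val_succ]; omega)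

namespace Hk

variable {k : ℕ}

/-- The element of `H_k` with given `k`-th derivative. -/
def ofDx (hL : 0 < L) (w : L2I L) (h : ∀ i < k, ell L (((-volterra L) ^ i) w) = 0) : Hk L k :=
  (⟨jetOf k w, jetOf_mem hL h⟩ : Sob0 L k)

theorem dx_ofDx (hL : 0 < L) (w : L2I L) (h : ∀ i < k, ell L (((-volterra L) ^ i) w) = 0) :
    dx (ofDx hL w h) = w := by
  change ((-volterra L) ^ (k - (Fin.last k : ℕ))) w = w
  simp

theorem fn_ofDx (hL : 0 < L) (w : L2I L) (h : ∀ i < k, ell L (((-volterra L) ^ i) w) = 0) :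
    fn (ofDx hL w h) = ((-volterra L) ^ k) w := by
  change ((-volterra L) ^ (k - ((0 : Fin (k + 1)) : ℕ))) w = _
  simp

theorem ell_pow_dx (hL : 0 < L) (v : Hk L k) {i : ℕ} (hi : i < k) :
    ell L (((-volterra L) ^ i) (dx v)) = 0 :=
  Sob0.ell_pow_last hL (show Sob0 L k from v).2 hi

theorem fn_injective : Function.Injective (fn : Hk L k → L2I L) :=
  (injective_iff_map_eq_zero _).2 fun _ => eq_zero_of_fn

/-- The isometry `∂ₓᵏ` identifies `H_k` with a finite intersection of kernels of continuous
functionals on `L²(I)`. Besides completeness of the energy space, this makes the integral in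
`memConv` genuine: in an incomplete space it would take the default value `0`. -/
theorem completeSpace (hL : 0 < L) : CompleteSpace (Hk L k) := by
  rw [completeSpace_iff_isComplete_range (dxi (L := L) (k := k)).isometry.isUniformInducing]
  refine IsClosed.isComplete ?_
  have h : range (dxi (L := L) (k := k))
      = ⋂ i : Fin k, {w | ell L (((-volterra L) ^ (i : ℕ)) w) = 0} := by
    ext w
    simp only [mem_range, mem_iInter, mem_ofPred_eq]
    constructor
    · rintro ⟨v, rfl⟩ i
      exact ell_pow_dx hL v i.2
    · exact fun h => ⟨ofDx hL w fun i hi => h ⟨i, hi⟩, dx_ofDx hL w _⟩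
  rw [h]
  exact isClosed_iInter fun i => isClosed_eq (by fun_prop) continuous_const

end Hk

theorem isClosed_sob (m : ℕ) : IsClosed (Sob L m : Set (Jet L m)) := by
  have h : (Sob L m : Set (Jet L m)) = ⋂ (j : Fin m) (φ : ℝ → ℝ) (h : IsTest (Ioo 0 L) φ),
      {v : Jet L m | inner ℝ (v j.castSucc) (testL2 L h.deriv)
        = -inner ℝ (v j.succ) (testL2 L h)} := by
    ext v
    simp only [mem_iInter, mem_ofPred_eq]
    exact forall_congr' fun j => isWeakDeriv_iff_inner
  rw [h]
  refine isClosed_iInter fun j => isClosed_iInter fun φ => isClosed_iInter fun hφ => ?_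
  have hc : ∀ i : Fin (m + 1), Continuous fun v : Jet L m => v i := fun i =>
    (PiLp.proj 2 (𝕜 := ℝ) (fun _ : Fin (m + 1) => L2I L) i).continuous
  exact isClosed_eq ((hc _).inner continuous_const) ((hc _).inner continuous_const).neg

instance (m : ℕ) : CompleteSpace (Sob L m) := (isClosed_sob m).completeSpace_coe

/-! ### Multiplication by `x` -/

theorem memLp_mulX (v : L2I L) : MemLp (fun x => x * v x) 2 (volume.restrict (Ioo 0 L)) := by
  refine MemLp.of_le_mul (c := L) (Lp.memLp v)
    (measurable_id.aestronglyMeasurable.mul (Lp.aestronglyMeasurable v)) ?_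
  filter_upwards [ae_restrict_mem measurableSet_Ioo] with x hx
  rw [norm_mul, Real.norm_of_nonneg hx.1.le]
  exact mul_le_mul_of_nonneg_right hx.2.le (norm_nonneg _)

/-- Multiplication by the variable `x` on `L²(I)`. -/
def mulX (L : ℝ) : L2I L →L[ℝ] L2I L :=
  LinearMap.mkContinuous
    { toFun := fun v => (memLp_mulX v).toLp
      map_add' := fun u v => by
        rw [← MemLp.toLp_add, MemLp.toLp_eq_toLp_iff]
        filter_upwards [Lp.coeFn_add u v] with x hx
        simp only [Pi.add_apply, hx]; ring
      map_smul' := fun c v => by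
        rw [RingHom.id_apply, ← MemLp.toLp_const_smul, MemLp.toLp_eq_toLp_iff]
        filter_upwards [Lp.coeFn_smul c v] with x hx
        simp only [Pi.smul_apply, hx, smul_eq_mul]; ring }
    |L| fun v => by
      refine Lp.norm_le_mul_norm_of_ae_le_mul ?_
      filter_upwards [ae_restrict_mem measurableSet_Ioo, (memLp_mulX v).coeFn_toLp] with x hx h
      change ‖(memLp_mulX v).toLp _ x‖ ≤ _
      rw [h, norm_mul, Real.norm_of_nonneg hx.1.le]
      exact mul_le_mul_of_nonneg_right (hx.2.le.trans (le_abs_self L)) (norm_nonneg _)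

theorem coeFn_mulX (v : L2I L) : mulX L v =ᵐ[volume.restrict (Ioo 0 L)] fun x => x * v x :=
  (memLp_mulX v).coeFn_toLp

theorem norm_mulX_le (v : L2I L) : ‖mulX L v‖ ≤ L * ‖v‖ := by
  refine Lp.norm_le_mul_norm_of_ae_le_mul ?_
  filter_upwards [ae_restrict_mem measurableSet_Ioo, coeFn_mulX v] with x hx h
  rw [h, norm_mul, Real.norm_of_nonneg hx.1.le]
  exact mul_le_mul_of_nonneg_right hx.2.le (norm_nonneg _)

theorem inner_mulX (u v : L2I L) : inner ℝ (mulX L u) v = inner ℝ u (mulX L v) := by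
  rw [inner_eq_integral, inner_eq_integral]
  refine integral_congr_ae ?_
  filter_upwards [coeFn_mulX u, coeFn_mulX v] with x h1 h2
  rw [h1, h2]; ring

/-- The commutator of `x` with `K` is `-K²`: the function `x K v` has derivative `K v - x v` and
vanishes at `L`, hence equals `-K (K v - x v)`. -/
theorem mulX_volterra (hL : 0 < L) (v : L2I L) :
    mulX L (volterra L v) = volterra L (mulX L v) - volterra L (volterra L v) := by
  have hw : IsWeakDeriv L (mulX L (volterra L v)) (volterra L v - mulX L v) := by
    refine isWeakDeriv_iff_inner.2 fun φ h => ?_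
    have hx : IsTest (Ioo 0 L) (fun x => x * φ x) :=
      ⟨contDiff_id.mul h.smooth, h.compact.mul_left (f := fun x => x),
        (tsupport_mul_subset_right (f := fun x => x)).trans h.support⟩
    have hd : ∀ x, deriv (fun x => x * φ x) x = φ x + x * deriv φ x := fun x => by
      rw [deriv_fun_mul differentiableAt_fun_id (h.smooth.differentiable (by simp) x)]; simp
    have h1 : testL2 L hx = mulX L (testL2 L h) := by
      refine Lp.ext ?_
      filter_upwards [coeFn_testL2 (L := L) hx, coeFn_mulX (testL2 L h), coeFn_testL2 (L := L) h]
        with x a1 a2 a3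
      rw [a1, a2, a3]
    have h2 : mulX L (testL2 L h.deriv) = testL2 L hx.deriv - testL2 L h := by
      refine Lp.ext ?_
      filter_upwards [coeFn_testL2 (L := L) hx.deriv, coeFn_mulX (testL2 L h.deriv),
        coeFn_testL2 (L := L) h, coeFn_testL2 (L := L) h.deriv,
        Lp.coeFn_sub (testL2 L hx.deriv) (testL2 L h)] with x a1 a2 a3 a4 a5
      rw [a5, Pi.sub_apply, a1, a2, a3, a4, hd]; ring
    rw [inner_mulX, h2, inner_sub_right, inner_testL2_deriv hL v hx, h1, ← inner_mulX, inner_sub_left]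
    ring
  have ht : HasTrace L (mulX L (volterra L v)) L 0 := by
    refine ⟨fun x => x * primR v x, continuousOn_id.mul (continuousOn_primR v), ?_, ?_⟩
    · filter_upwards [coeFn_mulX (volterra L v), coeFn_volterra v] with x h1 h2
      rw [h1, h2]; rfl
    · simp [primR]
  rw [hw.eq_neg_volterra hL ht, map_sub, neg_sub]

end WeakDeriv

/-! ### Primitives of locally integrable functions on the half-line -/

section Primitive

variable {E : Type*} [NormedAddCommGroup E] [NormedSpace ℝ E]

theorem continuousOn_primitive_Ici {G : ℝ → E} (hG : ∀ S, IntegrableOn G (Icc 0 S)) :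
    ContinuousOn (fun s => ∫ τ in (0 : ℝ)..s, G τ) (Ici 0) := by
  intro s hs
  have h := intervalIntegral.continuousOn_primitive_interval (μ := volume) (f := G) (a := 0)
    (b := s + 1) (by rw [uIcc_of_le (by linarith [mem_Ici.1 hs])]; exact hG _)
  rw [uIcc_of_le (by linarith [mem_Ici.1 hs])] at h
  refine (h s ⟨hs, by linarith⟩).mono_of_mem_nhdsWithin ?_
  rw [← Ici_inter_Iic]
  exact inter_mem self_mem_nhdsWithin (mem_nhdsWithin_of_mem_nhds (Iic_mem_nhds (by linarith)))

theorem IsTest.exists_subset_Ioo {φ : ℝ → ℝ} (h : IsTest (Ioi 0) φ) (a : ℝ) :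
    ∃ S, 0 < S ∧ a ≤ S ∧ IsTest (Ioo 0 S) φ := by
  obtain ⟨b, hb⟩ := h.compact.isCompact.bddAbove
  refine ⟨max (max a b + 1) 1, by positivity, ?_, h.smooth, h.compact, fun x hx => ⟨h.support hx, ?_⟩⟩
  · exact le_max_of_le_left (by linarith [le_max_left a b])
  · exact lt_max_of_lt_left (by linarith [le_max_right a b, hb hx])

theorem IsTest.mono {U V : Set ℝ} {φ : ℝ → ℝ} (h : IsTest U φ) (hUV : U ⊆ V) : IsTest V φ :=
  ⟨h.smooth, h.compact, h.support.trans hUV⟩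

theorem IsTest.mul_left {U : Set ℝ} {φ ψ : ℝ → ℝ} (h : IsTest U φ) (hψ : ContDiff ℝ ∞ ψ) :
    IsTest U (fun x => ψ x * φ x) :=
  ⟨hψ.mul h.smooth, h.compact.mul_left (f := ψ),
    (tsupport_mul_subset_right (f := ψ)).trans h.support⟩

theorem IsTest.setIntegral_smul {φ : ℝ → ℝ} {S : ℝ} (h : IsTest (Ioo 0 S) φ) (hS : 0 ≤ S)
    (F : ℝ → E) : ∫ s in Ioi 0, φ s • F s = ∫ s in (0 : ℝ)..S, φ s • F s := by
  rw [intervalIntegral.integral_of_le hS]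
  refine (setIntegral_eq_of_subset_of_forall_sdiff_eq_zero measurableSet_Ioi Ioc_subset_Ioi_self
    fun x hx => ?_)
  rw [h.eq_zero (fun h' => hx.2 (Ioo_subset_Ioc_self h')), zero_smul]

/-- Integration by parts through Fubini's theorem: `∫_τ^S φ' = -φ(τ)` once the support of `φ` lies
below `S`. -/
theorem IsTest.integral_deriv_smul_primitive [CompleteSpace E] {φ : ℝ → ℝ} (h : IsTest (Ioi 0) φ)
    {G : ℝ → E} (hG : ∀ S, IntegrableOn G (Icc 0 S)) :
    ∫ s in Ioi 0, _root_.deriv φ s • ∫ τ in (0 : ℝ)..s, G τ = -∫ s in Ioi 0, φ s • G s := by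
  obtain ⟨S, hS, -, hφ⟩ := h.exists_subset_Ioo 0
  rw [hφ.deriv.setIntegral_smul hS.le, hφ.setIntegral_smul hS.le,
    integral_smul_primitive hS.le
      ((hφ.deriv.smooth.continuous.integrableOn_Icc).mono_set Ioc_subset_Icc_self)
      ((hG S).mono_set Ioc_subset_Icc_self), ← intervalIntegral.integral_neg]
  refine intervalIntegral.integral_congr fun τ _ => ?_
  simp only [hφ.integral_deriv, hφ.eq_zero (x := S) (by simp), zero_sub, neg_smul]

theorem IsTest.integrable_smul {φ : ℝ → ℝ} (h : IsTest (Ioi 0) φ)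
    {D : ℝ → E} (hD : ContinuousOn D (Ici 0)) : IntegrableOn (fun s => φ s • D s) (Ioi 0) := by
  obtain ⟨S, hS, -, hφ⟩ := h.exists_subset_Ioo 0
  have h1 : IntegrableOn (fun s => φ s • D s) (Ioc 0 S) :=
    ((h.smooth.continuous.continuousOn.smul (hD.mono Icc_subset_Ici_self)).integrableOn_Icc).mono_set
      Ioc_subset_Icc_self
  refine h1.of_forall_sdiff_eq_zero measurableSet_Ioi fun x hx => ?_
  rw [hφ.eq_zero (fun h' => hx.2 (Ioo_subset_Ioc_self h')), zero_smul]

/-- A continuous function on `[0, ∞)` with weak derivative zero that vanishes at `0` is zero. -/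
theorem eqOn_zero_of_integral_deriv_smul [CompleteSpace E] {D : ℝ → E}
    (hD : ContinuousOn D (Ici 0)) (h0 : D 0 = 0)
    (h : ∀ φ : ℝ → ℝ, IsTest (Ioi 0) φ → ∫ s in Ioi 0, deriv φ s • D s = 0) :
    EqOn D 0 (Ici 0) := by
  obtain ⟨ψ, hψ, hψ1⟩ := exists_test_integral_one (L := 1) one_pos
  have hψ' : IsTest (Ioi 0) ψ := hψ.mono Ioo_subset_Ioi_self
  -- The only candidate for the constant value of `D`; the hypothesis says that `D - c` annihilates
  -- all test functions.
  set c := ∫ s in Ioi 0, ψ s • D s with hc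
  have key : ∀ χ, IsTest (Ioi 0) χ → ∫ s in Ioi 0, χ s • (D s - c) = 0 := by
    intro χ hχ
    obtain ⟨S, hS, h1S, hχS⟩ := hχ.exists_subset_Ioo 1
    obtain ⟨φ, hφ, hder⟩ := exists_deriv_eq_sub hχS (hψ.mono (Ioo_subset_Ioo_right h1S)) hψ1
    have h1 := h φ (hφ.mono Ioo_subset_Ioi_self)
    rw [hder] at h1
    simp only [sub_smul, mul_smul] at h1
    have hi : IntegrableOn (fun s => (∫ y, χ y) • ψ s • D s) (Ioi 0) :=
      (hψ'.integrable_smul hD).smul (∫ y, χ y)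
    rw [integral_sub (hχ.integrable_smul hD) hi,
      integral_smul, ← hc] at h1
    simp only [smul_sub]
    have h2 : IntegrableOn (fun s => χ s • c) (Ioi 0) :=
      (hχ.integrable_smul (continuousOn_const (c := c)))
    rw [integral_sub (hχ.integrable_smul hD) h2, integral_smul_const]
    have h3 : ∫ s in Ioi 0, χ s = ∫ s, χ s :=
      setIntegral_eq_integral_of_forall_compl_eq_zero fun x hx =>
        hχS.eq_zero fun hx' => hx hx'.1
    rw [h3, h1]
  have h1 : ∀ᵐ s ∂volume, s ∈ Ioi 0 → D s - c = 0 :=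
    isOpen_Ioi.ae_eq_zero_of_integral_contDiff_smul_eq_zero (U := Ioi (0 : ℝ))
    (((hD.mono Ioi_subset_Ici_self).sub continuousOn_const).locallyIntegrableOn measurableSet_Ioi)
    fun φ h1 h2 h3 => by
      rw [← key φ ⟨h1, h2, h3⟩]
      refine (setIntegral_eq_integral_of_forall_compl_eq_zero fun x hx => ?_).symm
      rw [image_eq_zero_of_notMem_tsupport fun hx' => hx (h3 hx'), zero_smul]
  have h2 : EqOn D (fun _ => c) (Ioi 0) :=
    Measure.eqOn_open_of_ae_eq (μ := volume) (by
      filter_upwards [(ae_restrict_iff' measurableSet_Ioi).2 h1] with s hs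
      exact sub_eq_zero.1 hs) isOpen_Ioi (hD.mono Ioi_subset_Ici_self) continuousOn_const
  have h3 : EqOn D (fun _ => c) (Ici 0) :=
    h2.of_subset_closure hD continuousOn_const Ioi_subset_Ici_self (by rw [closure_Ioi])
  have h4 : c = 0 := by rw [← h0]; exact (h3 (mem_Ici.2 le_rfl)).symm
  intro s hs
  rw [h3 hs, h4]; rfl

end Primitive

/-! ### The transport equation in the memory space -/

section Memory

variable {f : ℝ → ℝ} {L : ℝ} {k : ℕ}

/-- This is `f'' ≥ 0`. At interior points the one-sided derivatives in the hypothesis agree with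
ordinary ones, so the monotonicity criterion applies. -/
theorem IsMemoryKernel.antitoneOn_memG (hf : IsMemoryKernel f) : AntitoneOn (memG f) (Ici 0) := by
  obtain ⟨c, -, hc⟩ := hf.second
  have hd : DifferentiableOn ℝ (derivWithin f (Ici 0)) (Ici 0) := by
    have := hf.smooth.differentiableOn_iteratedDerivWithin (m := 1) (by norm_num)
      (uniqueDiffOn_Ici 0)
    exact this.congr fun x hx => by rw [iteratedDerivWithin_one]
  have hm : MonotoneOn (derivWithin f (Ici 0)) (Ici 0) := by
    refine monotoneOn_of_deriv_nonneg (convex_Ici 0) hd.continuousOn (hd.mono interior_subset)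
      fun x hx => ?_
    rw [interior_Ici] at hx
    have h1 := (hc x (le_of_lt hx)).1
    rw [iteratedDerivWithin_succ, derivWithin_of_mem_nhds (Ici_mem_nhds hx)] at h1
    refine h1.trans_eq (Filter.EventuallyEq.deriv_eq ?_)
    filter_upwards [Ici_mem_nhds hx] with y hy
    rw [iteratedDerivWithin_one]
  exact fun x hx y hy hxy => neg_le_neg (hm hx hy hxy)

theorem ae_memMeasure_iff (hf : IsMemoryKernel f) {p : ℝ → Prop} :
    (∀ᵐ s ∂(memMeasure f), p s) ↔ ∀ᵐ s ∂(volume.restrict (Ioi 0)), p s :=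
  ⟨fun h => hf.absolutelyContinuous.ae_le h, fun h => IsMemoryKernel.absolutelyContinuous'.ae_le h⟩

/-- On `[0, S]` the continuous positive weight `g` is bounded away from zero, so the weighted
integrability (the measure being finite) passes to Lebesgue measure, up to the endpoint `0`. -/
theorem integrableOn_Lg (hf : IsMemoryKernel f) (η : Lg f L k) (S : ℝ) :
    IntegrableOn η (Icc 0 S) := by
  have := hf.isFiniteMeasure
  have h1 : Integrable η (memMeasure f) := (Lp.memLp η).integrable (by norm_num)
  have h2 : IntegrableOn (fun s => memG f s • η s) (Ioi 0) := by
    refine ((integrable_withDensity_iff_integrable_smul₀'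
      (μ := volume.restrict (Ioi (0 : ℝ))) hf.aemeasurable_memG.ennreal_ofReal
      (Eventually.of_forall fun _ => ENNReal.ofReal_lt_top)).1 h1).congr ?_
    filter_upwards [ae_restrict_mem measurableSet_Ioi] with s hs
    rw [ENNReal.toReal_ofReal (hf.memG_pos (le_of_lt hs)).le]
  have h3 : IntegrableOn (fun s => memG f s • η s) (Icc 0 S) := by
    rw [integrableOn_Icc_iff_integrableOn_Ioc (by simp)]
    exact h2.mono_set Ioc_subset_Ioi_self
  have h4 : IntegrableOn (fun s => (memG f s)⁻¹ • (memG f s • η s)) (Icc 0 S) :=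
    h3.continuousOn_smul ((hf.continuousOn_memG.mono Icc_subset_Ici_self).inv₀
      fun s hs => (hf.memG_pos hs.1).ne') isCompact_Icc
  exact h4.congr_fun (fun s hs => inv_smul_smul₀ (hf.memG_pos hs.1).ne' _) measurableSet_Icc

/-- The solution `∫₀ˢ exp(-μ(s-τ)) Ξ(τ) dτ` of `μ η + ∂ₛη = Ξ`, `η(0) = 0`. -/
def memConv (μ : ℝ) (Ξ : ℝ → Hk L k) (s : ℝ) : Hk L k :=
  Real.exp (-μ * s) • ∫ τ in (0 : ℝ)..s, Real.exp (μ * τ) • Ξ τ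

theorem integrableOn_exp_smul (hf : IsMemoryKernel f) (η : Lg f L k) (μ S : ℝ) :
    IntegrableOn (fun τ => Real.exp (μ * τ) • η τ) (Icc 0 S) :=
  (integrableOn_Lg hf η S).continuousOn_smul (by fun_prop) isCompact_Icc

theorem continuousOn_memConv (hf : IsMemoryKernel f) (μ : ℝ) (Ξ : Lg f L k) :
    ContinuousOn (memConv μ Ξ) (Ici 0) :=
  (Continuous.continuousOn (f := fun s : ℝ => Real.exp (-μ * s)) (by fun_prop)).smul
    (continuousOn_primitive_Ici (integrableOn_exp_smul hf Ξ μ))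

theorem memConv_zero (μ : ℝ) (Ξ : ℝ → Hk L k) : memConv μ Ξ 0 = 0 := by
  rw [memConv, intervalIntegral.integral_same, smul_zero]

theorem lintegral_exp_Ioi {μ : ℝ} (hμ : 0 < μ) (τ : ℝ) :
    ∫⁻ s in Ioi τ, ENNReal.ofReal (Real.exp (-μ * (s - τ))) = ENNReal.ofReal μ⁻¹ := by
  have he : ∀ s, Real.exp (-μ * (s - τ)) = Real.exp (μ * τ) * Real.exp (-μ * s) := fun s => by
    rw [← Real.exp_add]; congr 1; ring
  simp only [he]
  rw [← ofReal_integral_eq_lintegral_ofReal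
    ((integrableOn_exp_mul_Ioi (neg_lt_zero.2 hμ) τ).const_mul _)
    (Eventually.of_forall fun s => by positivity), integral_const_mul,
    integral_exp_mul_Ioi (neg_lt_zero.2 hμ)]
  congr 1
  rw [neg_div_neg_eq, ← mul_div_assoc, ← Real.exp_add, ← add_mul, add_neg_cancel, zero_mul,
    Real.exp_zero, one_div]

theorem lintegral_exp_Iic {μ : ℝ} (hμ : 0 < μ) (s : ℝ) :
    ∫⁻ τ in Iic s, ENNReal.ofReal (Real.exp (-μ * (s - τ))) = ENNReal.ofReal μ⁻¹ := by
  have he : ∀ τ, Real.exp (-μ * (s - τ)) = Real.exp (-μ * s) * Real.exp (μ * τ) := fun s => by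
    rw [← Real.exp_add]; congr 1; ring
  simp only [he]
  rw [← ofReal_integral_eq_lintegral_ofReal ((integrableOn_exp_mul_Iic hμ s).const_mul _)
    (Eventually.of_forall fun s => by positivity), integral_const_mul, integral_exp_mul_Iic hμ]
  congr 1
  rw [← mul_div_assoc, ← Real.exp_add, ← add_mul, neg_add_cancel, zero_mul, Real.exp_zero, one_div]

theorem sq_lintegral_mul_le {α : Type*} [MeasurableSpace α] {ν : Measure α} {a b : α → ENNReal}
    (ha : AEMeasurable a ν) (hb : AEMeasurable b ν) :
    (∫⁻ x, a x * b x ∂ν) ^ 2 ≤ (∫⁻ x, a x ^ 2 ∂ν) * ∫⁻ x, b x ^ 2 ∂ν := by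
  have h := ENNReal.lintegral_mul_le_Lp_mul_Lq ν Real.HolderConjugate.two_two ha hb
  refine (pow_le_pow_left' h 2).trans_eq ?_
  rw [mul_pow, ← ENNReal.rpow_natCast, ← ENNReal.rpow_natCast, ← ENNReal.rpow_mul,
    ← ENNReal.rpow_mul]
  norm_num

/-- Cauchy–Schwarz with the exponential split into two equal halves; one of them contributes the
total mass `1 / μ`. -/
theorem enorm_memConv_sq_le {μ : ℝ} (hμ : 0 < μ) (Ξ : Lg f L k) {s : ℝ} (hs : 0 ≤ s) :
    ‖memConv μ Ξ s‖ₑ ^ 2 ≤ ENNReal.ofReal μ⁻¹ *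
      ∫⁻ τ in Ioc 0 s, ENNReal.ofReal (Real.exp (-μ * (s - τ))) * ‖Ξ τ‖ₑ ^ 2 := by
  set a : ℝ → ENNReal := fun τ => ENNReal.ofReal (Real.exp (-μ / 2 * (s - τ))) with ha
  have ha2 : ∀ τ, a τ ^ 2 = ENNReal.ofReal (Real.exp (-μ * (s - τ))) := fun τ => by
    rw [ha, ← ENNReal.ofReal_pow (Real.exp_pos _).le, ← Real.exp_nat_mul]
    congr 2; push_cast; ring
  have ham : Measurable a := by fun_prop
  have hΞ : Measurable fun τ => ‖Ξ τ‖ₑ := (Lp.stronglyMeasurable Ξ).enorm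
  have h1 : memConv μ Ξ s = ∫ τ in Ioc 0 s, Real.exp (-μ * (s - τ)) • Ξ τ := by
    rw [memConv, intervalIntegral.integral_of_le hs, ← integral_smul]
    refine integral_congr_ae (Eventually.of_forall fun τ => ?_)
    simp only [smul_smul, ← Real.exp_add]
    congr 2; ring
  have h2 : ‖memConv μ Ξ s‖ₑ ≤ ∫⁻ τ in Ioc 0 s, a τ * (a τ * ‖Ξ τ‖ₑ) := by
    rw [h1]
    refine (enorm_integral_le_lintegral_enorm _).trans_eq (lintegral_congr fun τ => ?_)
    rw [← mul_assoc, ← pow_two, ha2, enorm_smul, Real.enorm_eq_ofReal (Real.exp_pos _).le]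
  refine (pow_le_pow_left' h2 2).trans ?_
  refine (sq_lintegral_mul_le (b := fun τ => a τ * ‖Ξ τ‖ₑ) ham.aemeasurable
    (ham.mul hΞ).aemeasurable).trans ?_
  simp only [mul_pow, ha2]
  refine mul_le_mul_left ?_ _
  rw [← lintegral_exp_Iic hμ s]
  exact lintegral_mono_set Ioc_subset_Iic_self

theorem lintegral_memMeasure (hf : IsMemoryKernel f) {F : ℝ → ENNReal}
    (hF : AEMeasurable F (volume.restrict (Ioi 0))) :
    ∫⁻ s, F s ∂(memMeasure f) = ∫⁻ s in Ioi 0, ENNReal.ofReal (memG f s) * F s :=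
  lintegral_withDensity_eq_lintegral_mul₀ hf.aemeasurable_memG.ennreal_ofReal hF

/-- For `τ ≤ s` one has `g(s) ≤ g(τ)`, so the weight can be moved inside the convolution. Tonelli's
theorem then produces a second factor `1 / μ`. This is where the decrease of `g` enters. -/
theorem lintegral_memConv_sq_le (hf : IsMemoryKernel f) {μ : ℝ} (hμ : 0 < μ) (Ξ : Lg f L k) :
    ∫⁻ s, ‖memConv μ Ξ s‖ₑ ^ 2 ∂(memMeasure f)
      ≤ ENNReal.ofReal μ⁻¹ ^ 2 * ∫⁻ s, ‖Ξ s‖ₑ ^ 2 ∂(memMeasure f) := by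
  have hΞ : Measurable fun τ => ‖Ξ τ‖ₑ := (Lp.stronglyMeasurable Ξ).enorm
  have hG : AEMeasurable (fun s => ENNReal.ofReal (memG f s)) (volume.restrict (Ioi 0)) :=
    hf.aemeasurable_memG.ennreal_ofReal
  have hconv : AEMeasurable (fun s => ‖memConv μ Ξ s‖ₑ ^ 2) (volume.restrict (Ioi 0)) :=
    ((((continuousOn_memConv hf μ Ξ).mono Ioi_subset_Ici_self).aestronglyMeasurable
      measurableSet_Ioi).enorm).pow_const 2
  set e : ℝ → ℝ → ENNReal := fun s τ => ENNReal.ofReal (Real.exp (-μ * (s - τ))) with he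
  set T : Set (ℝ × ℝ) := {p | p.2 ≤ p.1} with hT
  have hTm : MeasurableSet T := measurableSet_le measurable_snd measurable_fst
  set F : ℝ × ℝ → ENNReal := T.indicator fun p =>
    e p.1 p.2 * (ENNReal.ofReal (memG f p.2) * ‖Ξ p.2‖ₑ ^ 2) with hF
  have hFm : AEMeasurable F ((volume.restrict (Ioi 0)).prod (volume.restrict (Ioi 0))) := by
    refine AEMeasurable.indicator ?_ hTm
    have h1 : Measurable fun p : ℝ × ℝ => e p.1 p.2 := by simp only [he]; fun_prop
    have h2 : AEMeasurable (fun p : ℝ × ℝ => ENNReal.ofReal (memG f p.2) * ‖Ξ p.2‖ₑ ^ 2)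
        ((volume.restrict (Ioi 0)).prod (volume.restrict (Ioi 0))) :=
      (hG.mul (hΞ.pow_const 2).aemeasurable).comp_snd
    exact h1.aemeasurable.mul h2
  rw [lintegral_memMeasure hf hconv, lintegral_memMeasure hf (hΞ.pow_const 2).aemeasurable]
  calc ∫⁻ s in Ioi 0, ENNReal.ofReal (memG f s) * ‖memConv μ Ξ s‖ₑ ^ 2
      ≤ ∫⁻ s in Ioi 0, ENNReal.ofReal μ⁻¹ * ∫⁻ τ in Ioi 0, F (s, τ) := by
        refine lintegral_mono_ae ?_
        filter_upwards [ae_restrict_mem measurableSet_Ioi] with s hs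
        refine (mul_le_mul_right (enorm_memConv_sq_le hμ Ξ (le_of_lt hs)) _).trans ?_
        rw [mul_left_comm]
        refine mul_le_mul_right ?_ _
        rw [← lintegral_const_mul' _ _ ENNReal.ofReal_ne_top]
        have h1 : (fun τ => F (s, τ)) = (Iic s).indicator fun τ =>
            e s τ * (ENNReal.ofReal (memG f τ) * ‖Ξ τ‖ₑ ^ 2) := by
          funext τ; simp [hF, hT, indicator]
        rw [h1, lintegral_indicator measurableSet_Iic, Measure.restrict_restrict measurableSet_Iic,
          Iic_inter_Ioi]
        refine setLIntegral_mono' measurableSet_Ioc fun τ hτ => ?_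
        rw [mul_left_comm]
        refine mul_le_mul_right (mul_le_mul_left (ENNReal.ofReal_le_ofReal ?_) _) _
        exact hf.antitoneOn_memG (mem_Ici.2 hτ.1.le) (mem_Ici.2 (le_of_lt hs)) hτ.2
    _ = ENNReal.ofReal μ⁻¹ * ∫⁻ τ in Ioi 0, ∫⁻ s in Ioi 0, F (s, τ) := by
        rw [lintegral_const_mul' _ _ ENNReal.ofReal_ne_top]
        rw [lintegral_lintegral_swap (f := fun s τ => F (s, τ)) hFm]
    _ ≤ ENNReal.ofReal μ⁻¹ * ∫⁻ τ in Ioi 0,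
          ENNReal.ofReal μ⁻¹ * (ENNReal.ofReal (memG f τ) * ‖Ξ τ‖ₑ ^ 2) := by
        refine mul_le_mul_right (lintegral_mono fun τ => ?_) _
        have h1 : (fun s => F (s, τ)) = (Ici τ).indicator fun s =>
            e s τ * (ENNReal.ofReal (memG f τ) * ‖Ξ τ‖ₑ ^ 2) := by
          funext s; simp [hF, hT, indicator]
        simp only [h1]
        rw [lintegral_indicator measurableSet_Ici, lintegral_mul_const _ (by simp only [he]; fun_prop)]
        refine mul_le_mul_left ?_ _
        rw [← lintegral_exp_Ioi hμ τ, Measure.restrict_restrict measurableSet_Ici,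
          setLIntegral_congr Ioi_ae_eq_Ici]
        exact lintegral_mono_set inter_subset_left
    _ = _ := by
        rw [lintegral_const_mul' _ _ ENNReal.ofReal_ne_top, ← mul_assoc, pow_two]

end Memory

/-! ### The resolvent of `∂ₛ` in the memory space, and the memory term. -/

section MemoryResolvent

variable {f : ℝ → ℝ} {L : ℝ} {k : ℕ}

theorem eLpNorm_two_sq {α E : Type*} [MeasurableSpace α] [NormedAddCommGroup E] (ν : Measure α)
    (F : α → E) : eLpNorm F 2 ν ^ 2 = ∫⁻ x, ‖F x‖ₑ ^ 2 ∂ν := by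
  have h := eLpNorm_nnreal_pow_eq_lintegral (p := 2) (μ := ν) (f := F) two_ne_zero
  simpa using h

theorem eLpNorm_memConv_le (hf : IsMemoryKernel f) {μ : ℝ} (hμ : 0 < μ) (Ξ : Lg f L k) :
    eLpNorm (memConv μ Ξ) 2 (memMeasure f)
      ≤ ENNReal.ofReal μ⁻¹ * eLpNorm Ξ 2 (memMeasure f) := by
  refine (ENNReal.pow_le_pow_left_iff two_ne_zero).1 ?_
  rw [mul_pow, eLpNorm_two_sq, eLpNorm_two_sq]
  exact lintegral_memConv_sq_le hf hμ Ξ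

theorem memLp_memConv (hf : IsMemoryKernel f) {μ : ℝ} (hμ : 0 < μ) (Ξ : Lg f L k) :
    MemLp (memConv μ Ξ) 2 (memMeasure f) :=
  ⟨(((continuousOn_memConv hf μ Ξ).mono Ioi_subset_Ici_self).aestronglyMeasurable
      measurableSet_Ioi).mono_ac IsMemoryKernel.absolutelyContinuous',
    (eLpNorm_memConv_le hf hμ Ξ).trans_lt
      (ENNReal.mul_lt_top ENNReal.ofReal_lt_top (Lp.memLp Ξ).2)⟩

/-- The class in `L_g` of the solution of the transport equation. -/
def memResolvent (hf : IsMemoryKernel f) {μ : ℝ} (hμ : 0 < μ) (Ξ : Lg f L k) : Lg f L k :=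
  (memLp_memConv hf hμ Ξ).toLp

theorem coeFn_memResolvent (hf : IsMemoryKernel f) {μ : ℝ} (hμ : 0 < μ) (Ξ : Lg f L k) :
    memResolvent hf hμ Ξ =ᵐ[memMeasure f] memConv μ Ξ := MemLp.coeFn_toLp _

theorem norm_memResolvent_le (hf : IsMemoryKernel f) {μ : ℝ} (hμ : 0 < μ) (Ξ : Lg f L k) :
    μ * ‖memResolvent hf hμ Ξ‖ ≤ ‖Ξ‖ := by
  have h := ENNReal.toReal_mono
    (ENNReal.mul_lt_top ENNReal.ofReal_lt_top (Lp.memLp Ξ).2).ne (eLpNorm_memConv_le hf hμ Ξ)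
  rw [ENNReal.toReal_mul, ENNReal.toReal_ofReal (inv_nonneg.2 hμ.le)] at h
  have h1 : ‖memResolvent hf hμ Ξ‖ = (eLpNorm (memConv μ Ξ) 2 (memMeasure f)).toReal :=
    Lp.norm_toLp _ _
  rw [h1, Lp.norm_def]
  rwa [inv_mul_eq_div, le_div_iff₀ hμ, mul_comm] at h

theorem vanishesAtZero_memResolvent (hf : IsMemoryKernel f) {μ : ℝ} (hμ : 0 < μ) (Ξ : Lg f L k) :
    VanishesAtZero (memResolvent hf hμ Ξ) :=
  ⟨memConv μ Ξ, continuousOn_memConv hf μ Ξ, coeFn_memResolvent hf hμ Ξ, memConv_zero μ Ξ⟩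

theorem deriv_exp_mul {φ : ℝ → ℝ} {U : Set ℝ} (h : IsTest U φ) (μ s : ℝ) :
    deriv (fun s => Real.exp (μ * s) * φ s) s
      = Real.exp (μ * s) * deriv φ s + μ * (Real.exp (μ * s) * φ s) := by
  have h1 : HasDerivAt (fun s => Real.exp (μ * s)) (Real.exp (μ * s) * μ) s := by
    simpa using ((hasDerivAt_id s).const_mul μ).exp
  rw [(h1.fun_mul (h.smooth.differentiable (by simp) s).hasDerivAt).deriv]
  ring

theorem contDiff_exp_mul (μ : ℝ) : ContDiff ℝ ∞ fun s => Real.exp (μ * s) := by fun_prop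

/-- The product rule for `exp(-μ s)` times a primitive, obtained weakly by testing the primitive
against `exp(-μ s) φ(s)`. The identity is checked in `L²(I)` after `∂ₓᵏ`. -/
theorem isMemDeriv_memResolvent (hL : 0 < L) (hf : IsMemoryKernel f) {μ : ℝ} (hμ : 0 < μ)
    (Ξ : Lg f L k) : IsMemDeriv (memResolvent hf hμ Ξ) (Ξ + (-μ) • memResolvent hf hμ Ξ) := by
  have := Hk.completeSpace (k := k) hL
  intro φ hφ
  set ι := (Hk.dxi (L := L) (k := k)).toContinuousLinearMap with hι
  set G : ℝ → L2I L := fun τ => ι (Real.exp (μ * τ) • Ξ τ) with hG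
  have hGi : ∀ S, IntegrableOn G (Icc 0 S) := fun S =>
    ι.integrable_comp (integrableOn_exp_smul hf Ξ μ S)
  set P : ℝ → L2I L := fun s => ∫ τ in (0 : ℝ)..s, G τ with hP
  have hPc : ContinuousOn P (Ici 0) := continuousOn_primitive_Ici hGi
  have hψ := hφ.mul_left (contDiff_exp_mul (-μ))
  have hη : ∀ᵐ s ∂(volume.restrict (Ioi 0)),
      Hk.dx (memResolvent hf hμ Ξ s) = Real.exp (-μ * s) • P s := by
    filter_upwards [(ae_memMeasure_iff hf).1 (coeFn_memResolvent hf hμ Ξ),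
      ae_restrict_mem measurableSet_Ioi] with s h1 hs
    have hs' : (0 : ℝ) ≤ s := le_of_lt hs
    rw [h1, memConv, map_smul, hP]
    congr 1
    change ι _ = _
    rw [← ContinuousLinearMap.intervalIntegral_comp_comm]
    exact (intervalIntegrable_iff_integrableOn_Icc_of_le hs').2 (integrableOn_exp_smul hf Ξ μ s)
  have h1 := hψ.integral_deriv_smul_primitive hGi
  have h2 : ∀ s, deriv (fun s => Real.exp (-μ * s) * φ s) s • P s
      = deriv φ s • (Real.exp (-μ * s) • P s) + (-μ) • ((Real.exp (-μ * s) * φ s) • P s) := by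
    intro s
    rw [deriv_exp_mul hφ, add_smul, smul_smul, smul_smul, mul_comm (deriv φ s)]
  have h3 : IntegrableOn (fun s => (Real.exp (-μ * s) * φ s) • P s) (Ioi 0) :=
    hψ.integrable_smul hPc
  have h4 : IntegrableOn (fun s => deriv φ s • (Real.exp (-μ * s) • P s)) (Ioi 0) :=
    hφ.deriv.integrable_smul ((Continuous.continuousOn
      (f := fun s : ℝ => Real.exp (-μ * s)) (by fun_prop)).smul hPc)
  have h5 : ∫ s in Ioi 0, deriv (fun s => Real.exp (-μ * s) * φ s) s • P s
      = (∫ s in Ioi 0, deriv φ s • (Real.exp (-μ * s) • P s))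
        + (-μ) • ∫ s in Ioi 0, (Real.exp (-μ * s) * φ s) • P s := by
    simp only [h2]
    have h3' : IntegrableOn (fun s => (-μ) • (Real.exp (-μ * s) * φ s) • P s) (Ioi 0) := h3.smul (-μ)
    rw [integral_add h4 h3', integral_smul]
  have h6 : ∫ s in Ioi 0, (Real.exp (-μ * s) * φ s) • G s = ∫ s in Ioi 0, φ s • Hk.dx (Ξ s) := by
    refine integral_congr_ae (Eventually.of_forall fun s => ?_)
    change (Real.exp (-μ * s) * φ s) • ι (Real.exp (μ * s) • Ξ s) = φ s • ι (Ξ s)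
    rw [map_smul, smul_smul, mul_right_comm, ← Real.exp_add, ← add_mul, neg_add_cancel, zero_mul,
      Real.exp_zero, one_mul]
  have h7 : ∫ s in Ioi 0, deriv φ s • Hk.dx (memResolvent hf hμ Ξ s)
      = ∫ s in Ioi 0, deriv φ s • (Real.exp (-μ * s) • P s) := by
    refine integral_congr_ae ?_
    filter_upwards [hη] with s hs
    rw [hs]
  have h8 : ∫ s in Ioi 0, φ s • Hk.dx (memResolvent hf hμ Ξ s)
      = ∫ s in Ioi 0, (Real.exp (-μ * s) * φ s) • P s := by
    refine integral_congr_ae ?_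
    filter_upwards [hη] with s hs
    rw [hs, smul_smul, mul_comm]
  rw [integral_smul_dx_add hf _ _ hφ, integral_smul_dx_smul hf, h7, h8, ← h6, neg_add, ← h1, h5]
  abel

/-- The integrating factor `exp(μ s)` turns the equation `∂ₛη = -μ η` into a vanishing weak
derivative. -/
theorem eq_zero_of_isMemDeriv_smul (hf : IsMemoryKernel f) {μ : ℝ} {η : Lg f L k}
    (h : IsMemDeriv η ((-μ) • η)) (h0 : VanishesAtZero η) : η = 0 := by
  obtain ⟨r, hr, hηr, hr0⟩ := h0
  set ι := (Hk.dxi (L := L) (k := k)).toContinuousLinearMap with hι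
  have hιr : ContinuousOn (fun s => ι (r s)) (Ici 0) := ι.continuous.comp_continuousOn hr
  have hD : ContinuousOn (fun s => Real.exp (μ * s) • ι (r s)) (Ici 0) :=
    (Continuous.continuousOn (f := fun s : ℝ => Real.exp (μ * s)) (by fun_prop)).smul hιr
  have hae : ∀ᵐ s ∂(volume.restrict (Ioi 0)), Hk.dx (η s) = ι (r s) := by
    filter_upwards [(ae_memMeasure_iff hf).1 hηr] with s hs
    rw [hs]; rfl
  have hcong : ∀ χ : ℝ → ℝ, ∫ s in Ioi 0, χ s • Hk.dx (η s) = ∫ s in Ioi 0, χ s • ι (r s) := by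
    intro χ
    refine integral_congr_ae ?_
    filter_upwards [hae] with s hs
    rw [hs]
  have key := eqOn_zero_of_integral_deriv_smul hD (by simp [hr0]) fun φ hφ => by
    have hψ := hφ.mul_left (contDiff_exp_mul μ)
    have h1 := h _ hψ
    rw [integral_smul_dx_smul hf, hcong, hcong] at h1
    have h2 : ∀ s, deriv φ s • (Real.exp (μ * s) • ι (r s))
        = deriv (fun s => Real.exp (μ * s) * φ s) s • ι (r s)
          - μ • ((Real.exp (μ * s) * φ s) • ι (r s)) := by
      intro s
      rw [deriv_exp_mul hφ, add_smul, smul_smul, smul_smul, mul_comm (deriv φ s),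
        add_sub_cancel_right]
    simp only [h2]
    have h3 : IntegrableOn (fun s => μ • (Real.exp (μ * s) * φ s) • ι (r s)) (Ioi 0) :=
      (hψ.integrable_smul hιr).smul μ
    rw [integral_sub (hψ.deriv.integrable_smul hιr) h3,
      integral_smul, h1]
    module
  refine Lp.ext ?_
  filter_upwards [hηr, Lp.coeFn_zero (Hk L k) 2 (memMeasure f),
    (ae_memMeasure_iff hf).2 (ae_restrict_mem measurableSet_Ioi)] with s h1 h2 hs
  have h3 : Real.exp (μ * s) • ι (r s) = 0 := key (mem_Ici.2 (le_of_lt hs))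
  have h4 : Hk.dx (r s) = 0 := (smul_eq_zero.1 h3).resolve_left (Real.exp_pos _).ne'
  rw [h1, h2, Hk.eq_zero_of_dx h4]; rfl

theorem eq_memResolvent (hL : 0 < L) (hf : IsMemoryKernel f) {μ : ℝ} (hμ : 0 < μ) {η ζ : Lg f L k}
    (h : IsMemDeriv η ζ) (h0 : VanishesAtZero η) : η = memResolvent hf hμ (μ • η + ζ) := by
  set Ξ := μ • η + ζ with hΞ
  have h1 := h.add hf ((isMemDeriv_memResolvent hL hf hμ Ξ).smul hf (-1))
  have h2 := h0.add ((vanishesAtZero_memResolvent hf hμ Ξ).smul (-1))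
  have h3 : ζ + (-1 : ℝ) • (Ξ + (-μ) • memResolvent hf hμ Ξ)
      = (-μ) • (η + (-1 : ℝ) • memResolvent hf hμ Ξ) := by
    rw [hΞ]; module
  rw [h3] at h1
  have h4 := eq_zero_of_isMemDeriv_smul hf h1 h2
  rwa [neg_one_smul, ← sub_eq_add_neg, sub_eq_zero] at h4

/-- Since `η` is the resolvent applied to `μ η + ζ`, contractivity gives `μ ‖η‖ ≤ ‖μ η + ζ‖` for all
`μ > 0`. Squared, this is `0 ≤ 2 μ ⟨ζ, η⟩ + ‖ζ‖²`, which excludes a negative inner product for large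
`μ`. No differentiation of `g` and no boundary term at infinity are needed. -/
theorem inner_memDeriv_nonneg (hL : 0 < L) (hf : IsMemoryKernel f) {η ζ : Lg f L k}
    (h : IsMemDeriv η ζ) (h0 : VanishesAtZero η) : 0 ≤ inner ℝ ζ η := by
  by_contra hneg
  rw [not_le] at hneg
  have key : ∀ μ : ℝ, 0 < μ → 0 ≤ 2 * μ * inner ℝ ζ η + ‖ζ‖ ^ 2 := by
    intro μ hμ
    have h1 := norm_memResolvent_le hf hμ (μ • η + ζ)
    rw [← eq_memResolvent hL hf hμ h h0] at h1
    have h2 := pow_le_pow_left₀ (by positivity) h1 2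
    rw [norm_add_sq_real, norm_smul, Real.norm_of_nonneg hμ.le, real_inner_smul_left,
      real_inner_comm] at h2
    linarith
  -- With this `μ` the bound would read `0 ≤ -1`.
  have h1 := key ((‖ζ‖ ^ 2 + 1) / (-(2 * inner ℝ ζ η))) (by
    apply div_pos (by positivity); linarith)
  have h2 : (‖ζ‖ ^ 2 + 1) / (-(2 * inner ℝ ζ η)) * (-(2 * inner ℝ ζ η)) = ‖ζ‖ ^ 2 + 1 :=
    div_mul_cancel₀ _ (by linarith)
  nlinarith

/-! ### The memory integral -/

/-- The memory term `∫₀^∞ g(s) ∂ₓᵏ η(s) ds`. -/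
def memInt (η : Lg f L k) : L2I L := ∫ s, Hk.dx (η s) ∂(memMeasure f)

theorem integrable_dx (hf : IsMemoryKernel f) (η : Lg f L k) :
    Integrable (fun s => Hk.dx (η s)) (memMeasure f) := by
  have := hf.isFiniteMeasure
  exact ((Hk.dxi (L := L) (k := k)).toContinuousLinearMap).integrable_comp
    ((Lp.memLp η).integrable (by norm_num))

theorem memInt_add (hf : IsMemoryKernel f) (η ζ : Lg f L k) :
    memInt (η + ζ) = memInt η + memInt ζ := by
  rw [memInt, memInt, memInt, ← integral_add (integrable_dx hf η) (integrable_dx hf ζ)]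
  refine integral_congr_ae ?_
  filter_upwards [Lp.coeFn_add η ζ] with s hs
  rw [hs, Pi.add_apply, map_add]

theorem inner_memInt (hf : IsMemoryKernel f) (η : Lg f L k) (v : L2I L) :
    inner ℝ v (memInt η) = ∫ s, inner ℝ v (Hk.dx (η s)) ∂(memMeasure f) :=
  (integral_inner (𝕜 := ℝ) (integrable_dx hf η) v).symm

theorem pairing_eq_inner (hf : IsMemoryKernel f) (η : Lg f L k) {U : Set ℝ} {φ : ℝ → ℝ}
    (h : IsTest U φ) : ∫ s, (∫ x in Ioo 0 L, Hk.dx (η s) x * φ x) ∂(memMeasure f)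
      = inner ℝ (memInt η) (testL2 L h) := by
  rw [real_inner_comm, inner_memInt hf]
  refine integral_congr_ae (Eventually.of_forall fun s => ?_)
  simp only [← inner_testL2 _ h]
  exact real_inner_comm _ _

theorem memLp_const_Hk (hf : IsMemoryKernel f) (U : Hk L k) :
    MemLp (fun _ : ℝ => U) 2 (memMeasure f) := by
  have := hf.isFiniteMeasure
  exact memLp_const U

/-- Constant elements of `L_g`. -/
def constLg (hf : IsMemoryKernel f) (U : Hk L k) : Lg f L k :=
  (memLp_const_Hk hf U).toLp

theorem coeFn_constLg (hf : IsMemoryKernel f) (U : Hk L k) :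
    constLg hf U =ᵐ[memMeasure f] fun _ => U :=
  (memLp_const_Hk hf U).coeFn_toLp

theorem inner_constLg (hf : IsMemoryKernel f) (U : Hk L k) (η : Lg f L k) :
    inner ℝ (constLg hf U) η = inner ℝ (Hk.dx U) (memInt η) := by
  rw [L2.inner_def, inner_memInt hf]
  refine integral_congr_ae ?_
  filter_upwards [coeFn_constLg hf U] with s hs
  rw [hs, Hk.inner_def]

theorem memMeasure_univ (hf : IsMemoryKernel f) :
    (memMeasure f).real univ = ∫ s in Ioi 0, memG f s := by
  rw [memMeasure, Measure.real, withDensity_apply _ MeasurableSet.univ, Measure.restrict_univ,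
    ← ofReal_integral_eq_lintegral_ofReal hf.integrableOn_memG, ENNReal.toReal_ofReal]
  · exact setIntegral_nonneg measurableSet_Ioi fun s hs => (hf.memG_pos (le_of_lt hs)).le
  · filter_upwards [ae_restrict_mem measurableSet_Ioi] with s hs
    exact (hf.memG_pos (le_of_lt hs)).le

/-- Cauchy–Schwarz against the constant `1`, whose squared norm is the total mass of the measure.
Only this mass enters the smoothing constant. -/
theorem norm_memInt_sq_le (hf : IsMemoryKernel f) (η : Lg f L k) :
    ‖memInt η‖ ^ 2 ≤ (∫ s in Ioi 0, memG f s) * ‖η‖ ^ 2 := by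
  have := hf.isFiniteMeasure
  set o : Lp ℝ 2 (memMeasure f) := (memLp_const (1 : ℝ)).toLp fun _ => 1 with ho
  have hoc : o =ᵐ[memMeasure f] fun _ => (1 : ℝ) := MemLp.coeFn_toLp _
  set n : Lp ℝ 2 (memMeasure f) := (Lp.memLp η).norm.toLp with hn
  have hnc : n =ᵐ[memMeasure f] fun s => ‖η s‖ := MemLp.coeFn_toLp _
  have h1 : ‖memInt η‖ ≤ inner ℝ o n := by
    refine (norm_integral_le_integral_norm _).trans_eq ?_
    rw [L2.inner_def]
    refine integral_congr_ae ?_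
    filter_upwards [hoc, hnc] with s h1 h2
    rw [h1, h2, Hk.norm_dx]; simp
  have h2 : ‖o‖ ^ 2 = ∫ s in Ioi 0, memG f s := by
    rw [← memMeasure_univ hf, ← real_inner_self_eq_norm_sq, L2.inner_def]
    have : ∫ s, inner ℝ (o s) (o s) ∂(memMeasure f) = ∫ s, (1 : ℝ) ∂(memMeasure f) := by
      refine integral_congr_ae ?_
      filter_upwards [hoc] with s h1
      rw [h1]; simp
    rw [this]; simp
  have h3 : ‖n‖ = ‖η‖ := by
    refine le_antisymm (Lp.norm_le_norm_of_ae_le ?_) (Lp.norm_le_norm_of_ae_le ?_) <;>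
    · filter_upwards [hnc] with s hs
      rw [hs]; simp
  rw [← h2, ← mul_pow, ← h3]
  exact pow_le_pow_left₀ (norm_nonneg _) (h1.trans (real_inner_le_norm _ _)) 2

/-- For a constant source the transport equation has a scalar function of `s` times that constant as
solution. The memory therefore feeds back into the resolvent equation as a multiple of `∂ₓᵏ u`,
which keeps that equation polynomial in `K`. -/
theorem exists_memInt_memResolvent_constLg (hL : 0 < L) (hf : IsMemoryKernel f) {μ : ℝ}
    (hμ : 0 < μ) (k : ℕ) :
    ∃ c : ℝ, ∀ U : Hk L k, memInt (memResolvent hf hμ (constLg hf U)) = c • Hk.dx U := by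
  have := Hk.completeSpace (k := k) hL
  refine ⟨∫ s, (Real.exp (-μ * s) * ∫ τ in (0 : ℝ)..s, Real.exp (μ * τ)) ∂(memMeasure f),
    fun U => ?_⟩
  rw [memInt, ← integral_smul_const]
  refine integral_congr_ae ?_
  filter_upwards [coeFn_memResolvent hf hμ (constLg hf U),
    (ae_memMeasure_iff hf).2 (ae_restrict_mem measurableSet_Ioi)] with s h1 hs
  have hs' : (0 : ℝ) ≤ s := le_of_lt hs
  have h2 : ∫ τ in (0 : ℝ)..s, Real.exp (μ * τ) • constLg hf U τ
      = (∫ τ in (0 : ℝ)..s, Real.exp (μ * τ)) • U := by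
    rw [← intervalIntegral.integral_smul_const, intervalIntegral.integral_of_le hs',
      intervalIntegral.integral_of_le hs']
    refine integral_congr_ae ?_
    filter_upwards [ae_mono (Measure.restrict_mono_set _ Ioc_subset_Ioi_self)
      ((ae_memMeasure_iff hf).1 (coeFn_constLg hf U))] with τ hτ
    rw [hτ]
  rw [h1, memConv, h2, map_smul, map_smul, smul_smul]

end MemoryResolvent

/-! ### Dissipativity of the operator and the Kato smoothing inequality -/

section Operator

variable {f : ℝ → ℝ} {L : ℝ} {k : ℕ} {a₀ a₁ : ℝ}

theorem pow_two_neg_volterra (w : L2I L) : ((-volterra L) ^ 2) w = volterra L (volterra L w) := by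
  rw [neg_sq, pow_two]; rfl

theorem inner_volterra_volterra (hL : 0 < L) (v : L2I L) {w : L2I L} (h : ell L w = 0)
    (h' : ell L (volterra L w) = 0) :
    inner ℝ (volterra L (volterra L v)) w = inner ℝ v (volterra L (volterra L w)) := by
  rw [inner_volterra_of_ell_eq_zero hL h, inner_volterra_of_ell_eq_zero hL h', neg_neg]

theorem inner_volterra_pow (hL : 0 < L) (v : L2I L) {w : L2I L} (h : ell L w = 0)
    (h' : ell L (volterra L w) = 0) {j : ℕ} (hj : j ≤ 2) :
    inner ℝ ((volterra L ^ j) v) w = inner ℝ v (((-volterra L) ^ j) w) := by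
  interval_cases j
  · rfl
  · rw [pow_one, pow_one, inner_volterra_of_ell_eq_zero hL h, ← inner_neg_right]; rfl
  · rw [pow_two_neg_volterra, ← inner_volterra_volterra hL v h h', pow_two]; rfl

theorem ell_pow_neg_volterra {w : L2I L} (h : ell L w = 0) (h' : ell L (volterra L w) = 0) {i : ℕ}
    (hi : i < 2) : ell L (((-volterra L) ^ i) w) = 0 := by
  interval_cases i
  · exact h
  · rw [pow_one]
    change ell L (-volterra L w) = 0
    rw [map_neg, h', neg_zero]

/-- The function of `H₀²(I)` with second derivative `w`, as an element of `H_k`. -/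
def hkOf (hL : 0 < L) (hk : k ≤ 2) {w : L2I L} (h : ell L w = 0) (h' : ell L (volterra L w) = 0) :
    Hk L k :=
  Hk.ofDx hL (((-volterra L) ^ (2 - k)) w) fun i hi => by
    rw [← mul_apply_eq_comp, ← pow_add]
    exact ell_pow_neg_volterra h h' (by omega)

theorem dx_hkOf (hL : 0 < L) (hk : k ≤ 2) {w : L2I L} (h : ell L w = 0)
    (h' : ell L (volterra L w) = 0) : Hk.dx (hkOf hL hk h h') = ((-volterra L) ^ (2 - k)) w :=
  Hk.dx_ofDx _ _ _

theorem fn_hkOf (hL : 0 < L) (hk : k ≤ 2) {w : L2I L} (h : ell L w = 0)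
    (h' : ell L (volterra L w) = 0) : Hk.fn (hkOf hL hk h h') = volterra L (volterra L w) := by
  rw [hkOf, Hk.fn_ofDx, ← mul_apply_eq_comp, ← pow_add, Nat.add_sub_cancel' hk,
    pow_two_neg_volterra]

/-- The thrice integrated first component of `A (u, η) = (F, Ξ)`, where `w = ∂ₓ²u`. -/
def firstDefect (k : ℕ) (a₀ a₁ : ℝ) (w m F : L2I L) : L2I L :=
  (volterra L ^ 3) F - volterra L (volterra L w) + a₀ • w
    - a₁ • (volterra L ^ 4) w + (volterra L ^ (3 - k)) m

/-- Powers of `K` absorb or supply derivatives until every term is paired with the third derivative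
of the test function. Order three is the one at which the leading term, with `u = K² w`, becomes `a₀
w` itself. -/
theorem isFirstComp_iff (hL : 0 < L) (hf : IsMemoryKernel f) (hk : k ≤ 2) {w F : L2I L}
    {η : Lg f L k} : IsFirstComp a₀ a₁ (volterra L (volterra L w)) η F ↔
      ∀ φ (h : IsTest (Ioo 0 L) φ),
        inner ℝ (firstDefect k a₀ a₁ w (memInt η) F) (testD h 3) = 0 := by
  refine forall_congr' fun φ => forall_congr' fun h => ?_
  set u := volterra L (volterra L w) with hu
  have e0 : ∫ x in Ioo 0 L, F x * φ x = inner ℝ ((volterra L ^ 3) F) (testD h 3) := by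
    rw [← inner_testL2 F h, testL2_congr h (h.iteratedDeriv 0) iteratedDeriv_zero.symm]
    exact (inner_testD_add hL F h 0 3).symm
  have e5 : ∫ x in Ioo 0 L, u x * iteratedDeriv 5 φ x = inner ℝ w (testD h 3) := by
    rw [← inner_testL2 u (h.iteratedDeriv 5)]
    have := inner_testD_add hL w h 3 2
    rwa [pow_two] at this
  have e1 : ∫ x in Ioo 0 L, u x * iteratedDeriv 1 φ x
      = inner ℝ ((volterra L ^ 4) w) (testD h 3) := by
    rw [← inner_testL2 u (h.iteratedDeriv 1)]
    have := inner_testD_add hL u h 1 2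
    rw [← this]; rfl
  have ek : ∫ s, (∫ x in Ioo 0 L, Hk.dx (η s) x * iteratedDeriv k φ x) ∂(memMeasure f)
      = inner ℝ ((volterra L ^ (3 - k)) (memInt η)) (testD h 3) := by
    rw [pairing_eq_inner hf η (h.iteratedDeriv k)]
    have h1 := inner_testD_add hL (memInt η) h k (3 - k)
    have h2 : testD h (k + (3 - k)) = testD h 3 := testL2_congr _ _ (by congr 1; omega)
    rw [h2] at h1
    exact h1.symm
  rw [e0, e5, e1, ek, ← inner_testL2 u (h.iteratedDeriv 3), firstDefect, inner_add_left,
    inner_sub_left, inner_add_left, inner_sub_left, real_inner_smul_left, real_inner_smul_left,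
    ← hu]
  constructor <;> intro h' <;> linarith

/-- The description of the elements of the graph of `A` in terms of `w = ∂ₓ²u`, `z = -∂ₓ³u`. -/
structure GraphData (hf : IsMemoryKernel f) (a₀ a₁ : ℝ) (Φ Ψ : Energy f L k) (w z : L2I L) : Prop where
  ell_zero : ell L w = 0
  ell_one : ell L (volterra L w) = 0
  fst_eq : Φ.fst = volterra L (volterra L w)
  w_eq : w = volterra L z
  first : ∃ β γ : ℝ, volterra L (volterra L Ψ.fst) = volterra L w - a₀ • z
    + a₁ • volterra L (volterra L (volterra L w)) - (volterra L ^ (2 - k)) (memInt Φ.snd)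
    + β • oneI L + γ • volterra L (oneI L)
  second : ∃ (U : Hk L k) (ζ : Lg f L k), Hk.dx U = ((-volterra L) ^ (2 - k)) w ∧
    IsMemDeriv Φ.snd ζ ∧ VanishesAtZero Φ.snd ∧ Ψ.snd = constLg hf U - ζ

theorem exists_graphData (hL : 0 < L) (ha₀ : 0 < a₀) (hf : IsMemoryKernel f) (hk : k ≤ 2)
    {Φ Ψ : Energy f L k} (h : (Φ, Ψ) ∈ opGraph hf L k a₀ a₁) :
    ∃ w z, GraphData hf a₀ a₁ Φ Ψ w z := by
  obtain ⟨⟨v, hv, hvu, htr⟩, hvan, h1, ζ, hζ, h2⟩ := h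
  change v 0 = Φ.fst at hvu
  set w := v 2 with hw
  have hw0 : ell L w = 0 := Sob0.ell_pow_last hL hv (i := 0) (by norm_num)
  have hw1 : ell L (volterra L w) = 0 := by
    have : ell L (-volterra L w) = 0 := Sob0.ell_pow_last hL hv (i := 1) (by norm_num)
    rwa [map_neg, neg_eq_zero] at this
  have hu : Φ.fst = volterra L (volterra L w) := by
    rw [← hvu, Sob0.apply_eq hL hv 0, ← pow_two_neg_volterra]; rfl
  change IsFirstComp a₀ a₁ Φ.fst Φ.snd Ψ.fst at h1
  rw [hu, isFirstComp_iff hL hf hk] at h1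
  -- Three constants of integration appear. Two remain free as `β` and `γ`; the first is removed
  -- below by the trace of `w` at `L`.
  obtain ⟨c, hc⟩ := eq_sum_of_inner_testD_eq_zero hL 3 _ h1
  simp only [Finset.sum_range_succ, Finset.sum_range_zero, zero_add, pow_zero, pow_one, pow_two,
    firstDefect, one_apply_eq_self, mul_apply_eq_comp] at hc
  set r : L2I L := c 1 • oneI L + c 2 • volterra L (oneI L) + volterra L w
    + a₁ • volterra L (volterra L (volterra L w)) - volterra L (volterra L Ψ.fst)
    - (volterra L ^ (2 - k)) (memInt Φ.snd) with hr
  have hk3 : 3 - k = (2 - k) + 1 := by omega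
  have haw : a₀ • w = c 0 • oneI L + volterra L r := by
    have h3 : (volterra L ^ 3) Ψ.fst = volterra L (volterra L (volterra L Ψ.fst)) := by
      simp only [pow_succ, pow_zero, one_mul]; rfl
    have h4 : (volterra L ^ 4) w = volterra L (volterra L (volterra L (volterra L w))) := by
      simp only [pow_succ, pow_zero, one_mul]; rfl
    have h5 : (volterra L ^ (3 - k)) (memInt Φ.snd)
        = volterra L ((volterra L ^ (2 - k)) (memInt Φ.snd)) := by
      rw [hk3, pow_succ']; rfl
    rw [h3, h4, h5] at hc
    rw [hr]
    simp only [map_add, map_sub, map_smul]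
    rw [← sub_eq_zero] at hc ⊢
    rw [← hc]
    module
  -- All other terms of `a₀ w` lie in the range of `K` and vanish at `L`, as `w` does.
  have hc0 : c 0 = 0 := by
    have t1 := ((hasTrace_oneI (L := L) L).smul (c 0)).add (hasTrace_volterra_right r)
    rw [← haw] at t1
    have := t1.unique hL (right_mem_Icc.2 hL.le) (htr.smul a₀)
    linarith
  refine ⟨w, a₀⁻¹ • r, hw0, hw1, hu, ?_, ⟨c 1, c 2, ?_⟩, ?_⟩
  · rw [map_smul, eq_inv_smul_iff₀ ha₀.ne', haw, hc0, zero_smul, zero_add]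
  · rw [smul_inv_smul₀ ha₀.ne', hr]; abel
  · refine ⟨hkOf hL hk hw0 hw1, ζ, dx_hkOf _ _ _ _, hζ, hvan, ?_⟩
    refine Lp.ext ?_
    filter_upwards [h2, Lp.coeFn_sub (constLg hf (hkOf hL hk hw0 hw1)) ζ,
      coeFn_constLg hf (hkOf hL hk hw0 hw1)] with s a1 a2 a3
    rw [a2, Pi.sub_apply, a3]
    refine Hk.fn_injective ?_
    rw [map_sub, fn_hkOf, ← hu]
    exact a1

theorem energy_inner (Φ Ψ : Energy f L k) :
    inner ℝ Φ Ψ = inner ℝ Φ.fst Ψ.fst + inner ℝ Φ.snd Ψ.snd :=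
  WithLp.prod_inner_apply _ _

theorem GraphData.inner_snd_le {hf : IsMemoryKernel f} {Φ Ψ : Energy f L k} {w z : L2I L}
    (h : GraphData hf a₀ a₁ Φ Ψ w z) (hL : 0 < L) :
    inner ℝ Ψ.snd Φ.snd ≤ inner ℝ (((-volterra L) ^ (2 - k)) w) (memInt Φ.snd) := by
  obtain ⟨U, ζ, hU, hζ, hvan, he⟩ := h.second
  rw [he, inner_sub_left, inner_constLg, hU]
  linarith [inner_memDeriv_nonneg hL hf hζ hvan]

/-- Pair the integrated equation with `w`. The conditions `ell w = ell (K w) = 0` remove the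
constants and the terms with `K w` and `K³ w`; the leading term gives `-a₀ (ell z)² / 2`, where `ell
z = ∂ₓ²u(0)`. The memory pairing cancels against the upper bound in `inner_snd_le`. -/
theorem GraphData.inner_nonpos {hf : IsMemoryKernel f} {Φ Ψ : Energy f L k} {w z : L2I L}
    (h : GraphData hf a₀ a₁ Φ Ψ w z) (hL : 0 < L) (ha₀ : 0 < a₀) : inner ℝ Ψ Φ ≤ 0 := by
  obtain ⟨β, γ, h1⟩ := h.first
  have h0 := h.ell_zero
  have h0' := h.ell_one
  have e1 : inner ℝ Ψ.fst Φ.fst = inner ℝ (volterra L (volterra L Ψ.fst)) w := by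
    rw [h.fst_eq, inner_volterra_volterra hL _ h0 h0']
  have e2 : inner ℝ (volterra L w) w = 0 := by rw [inner_volterra_self hL, h0]; norm_num
  have e3 : inner ℝ (volterra L (volterra L (volterra L w))) w = 0 := by
    rw [inner_volterra_of_ell_eq_zero hL h0, inner_volterra_self hL, h0']; norm_num
  have e4 : inner ℝ z w = ell L z ^ 2 / 2 := by
    rw [h.w_eq, real_inner_comm, inner_volterra_self hL]
  have e5 : inner ℝ (volterra L (oneI L)) w = 0 := by
    rw [inner_volterra_of_ell_eq_zero hL h0, inner_oneI_left, h0', neg_zero]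
  have e6 := inner_volterra_pow hL (memInt Φ.snd) h0 h0' (j := 2 - k) (by omega)
  have e7 := h.inner_snd_le hL
  rw [h1, inner_add_left, inner_add_left, inner_sub_left, inner_add_left, inner_sub_left,
    real_inner_smul_left, real_inner_smul_left, real_inner_smul_left, real_inner_smul_left,
    inner_oneI_left, h0, e2, e3, e4, e5, e6] at e1
  have e8 := real_inner_comm (memInt Φ.snd) (((-volterra L) ^ (2 - k)) w)
  rw [energy_inner, e1]
  nlinarith [sq_nonneg (ell L z)]

/-- By the commutator identity `x K v = K (x v - K v)`, and the trace of this function at `0` is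
zero. -/
theorem ell_mulX (hL : 0 < L) (v : L2I L) : ell L (mulX L v) = ell L (volterra L v) := by
  have ht : HasTrace L (mulX L (volterra L v)) 0 0 := by
    refine ⟨fun x => x * primR v x, continuousOn_id.mul (continuousOn_primR v), ?_, by simp⟩
    filter_upwards [coeFn_mulX (volterra L v), coeFn_volterra v] with x h1 h2
    rw [h1, h2]; rfl
  rw [mulX_volterra hL, ← map_sub] at ht
  have := (hasTrace_volterra_left hL _).unique hL (left_mem_Icc.2 hL.le) ht
  rwa [map_sub, sub_eq_zero] at this

/-- With `p = K z` and `z = -p'` this is `-∫ x p p' = ½ ∫ p²`; the boundary terms vanish because `x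
= 0` at one end and `p = 0` at the other. -/
theorem inner_mulX_volterra_self (hL : 0 < L) (z : L2I L) :
    inner ℝ z (mulX L (volterra L z)) = ‖volterra L z‖ ^ 2 / 2 := by
  have h1 := inner_volterra hL (mulX L z) z
  have h2 := inner_volterra hL z (volterra L z)
  have h3 : inner ℝ z (mulX L (volterra L z))
      = inner ℝ z (volterra L (mulX L z)) - inner ℝ z (volterra L (volterra L z)) := by
    rw [mulX_volterra hL, inner_sub_right]
  have h4 : inner ℝ (mulX L z) (volterra L z) = inner ℝ z (mulX L (volterra L z)) := inner_mulX _ _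
  have h5 : inner ℝ (volterra L (mulX L z)) z = inner ℝ z (volterra L (mulX L z)) :=
    real_inner_comm _ _
  rw [real_inner_self_eq_norm_sq] at h2
  rw [h4, h5, ell_mulX hL] at h1
  rw [mul_comm] at h1
  linarith

/-- The multiplier of the smoothing estimate, `∂ₓ²(x u)` for `u = K² w`. -/
def katoMul (w : L2I L) : L2I L := mulX L w - (2 : ℝ) • volterra L w

theorem volterra_volterra_katoMul (hL : 0 < L) (w : L2I L) :
    volterra L (volterra L (katoMul w)) = mulX L (volterra L (volterra L w)) := by
  rw [mulX_volterra hL, mulX_volterra hL, katoMul]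
  simp only [map_sub, map_smul]
  module

/-- This and `ell_volterra_katoMul` express that `x u` lies in `H₀²(I)`, so that it is admissible in
the integrations by parts and is insensitive to `β` and `γ`. -/
theorem ell_katoMul (hL : 0 < L) {w : L2I L} (h' : ell L (volterra L w) = 0) :
    ell L (katoMul w) = 0 := by
  rw [katoMul, map_sub, map_smul, ell_mulX hL, h', smul_zero, sub_zero]

theorem ell_volterra_katoMul (hL : 0 < L) (w : L2I L) :
    ell L (volterra L (katoMul w)) = 0 := by
  have h1 := ell_mulX hL (volterra L w)
  rw [mulX_volterra hL, map_sub] at h1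
  rw [katoMul, map_sub, map_smul, map_sub, map_smul, smul_eq_mul]
  linarith

theorem norm_katoMul_le (w : L2I L) : ‖katoMul w‖ ≤ (L + 2 * ‖volterra L‖) * ‖w‖ := by
  have h1 := norm_sub_le (mulX L w) ((2 : ℝ) • volterra L w)
  have h2 := norm_mulX_le w
  have h3 := (volterra L).le_opNorm w
  rw [norm_smul] at h1
  norm_num at h1
  rw [katoMul]; linarith

/-- The constant of the smoothing inequality. -/
def katoConst (L a₁ : ℝ) : ℝ :=
  (|a₁| * ‖volterra L‖ + (1 + ‖volterra L‖) ^ 2) * (L + 2 * ‖volterra L‖)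

theorem norm_pow_volterra_le (v : L2I L) {j : ℕ} (hj : j ≤ 2) :
    ‖(volterra L ^ j) v‖ ≤ (1 + ‖volterra L‖) ^ 2 * ‖v‖ := by
  have h0 := norm_nonneg (volterra L)
  have hv := norm_nonneg v
  have h1 := (volterra L).le_opNorm v
  interval_cases j
  · rw [pow_zero, one_apply_eq_self]; nlinarith [mul_nonneg h0 hv, mul_nonneg (mul_nonneg h0 h0) hv]
  · rw [pow_one]; nlinarith [mul_nonneg h0 hv, mul_nonneg (mul_nonneg h0 h0) hv]
  · rw [pow_two, mul_apply_eq_comp]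
    have h2 := (volterra L).le_opNorm (volterra L v)
    nlinarith [mul_nonneg h0 hv, mul_le_mul_of_nonneg_left h1 h0]

theorem young_aux {a : ℝ} (ha : 0 < a) (N w u m : ℝ) :
    N * w * (u + m) ≤ a / 2 * w ^ 2 + N ^ 2 / a * (u ^ 2 + m ^ 2) := by
  have q1 : 0 ≤ (a * w - N * (u + m)) ^ 2 / (2 * a) := by positivity
  have q2 : (a * w - N * (u + m)) ^ 2 / (2 * a)
      = a / 2 * w ^ 2 - N * w * (u + m) + N ^ 2 / a * ((u + m) ^ 2 / 2) := by
    field_simp; ring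
  have q3 : (u + m) ^ 2 / 2 ≤ u ^ 2 + m ^ 2 := by nlinarith [sq_nonneg (u - m)]
  have q4 : N ^ 2 / a * ((u + m) ^ 2 / 2) ≤ N ^ 2 / a * (u ^ 2 + m ^ 2) :=
    mul_le_mul_of_nonneg_left q3 (by positivity)
  linarith

/-- The integrated equation is paired with `y = ∂ₓ²(x u)`. The fifth-order term yields `-(5/2) a₀
‖w‖²` and the third-order term the favourable `-(3/2) ‖K w‖²`. The lower-order and memory terms are
bounded by `‖w‖ (‖u‖ + ‖m‖)`, and Young's inequality absorbs them at the cost of `a₀ ‖w‖² / 2`,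
leaving the factor `2 a₀`. -/
theorem GraphData.kato {hf : IsMemoryKernel f} {Φ Ψ : Energy f L k} {w z : L2I L}
    (h : GraphData hf a₀ a₁ Φ Ψ w z) (hL : 0 < L) (ha₀ : 0 < a₀) :
    2 * a₀ * ‖w‖ ^ 2 ≤ -inner ℝ Ψ.fst (mulX L Φ.fst)
      + katoConst L a₁ ^ 2 / a₀ * (1 + ∫ s in Ioi 0, memG f s) * ‖Φ‖ ^ 2 := by
  obtain ⟨β, γ, h1⟩ := h.first
  have h0 := h.ell_zero
  have h0' := h.ell_one
  have k0 := ell_katoMul hL h0'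
  have k1 := ell_volterra_katoMul hL w
  set y := katoMul w with hy
  set u := Φ.fst with hu
  set m := memInt Φ.snd with hm
  set N := katoConst L a₁ with hN
  have hκ := norm_nonneg (volterra L)
  have hN0 : 0 ≤ N := by rw [hN, katoConst]; positivity
  have e1 : inner ℝ Ψ.fst (mulX L u) = inner ℝ (volterra L (volterra L Ψ.fst)) y := by
    rw [inner_volterra_volterra hL _ k0 k1, hy, volterra_volterra_katoMul hL, ← h.fst_eq]
  -- Here `-3/2 = 1/2 - 2`, from the two terms `x w` and `-2 K w` of the multiplier.
  have e2 : inner ℝ (volterra L w) y = -(3 / 2) * ‖volterra L w‖ ^ 2 := by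
    have := inner_mulX_volterra_self hL w
    rw [← inner_mulX, real_inner_comm] at this
    rw [hy, katoMul, inner_sub_right, this, real_inner_smul_right, real_inner_self_eq_norm_sq]
    ring
  -- Here `5/2 = 1/2 + 2`; the sign of the second term changes because `K` is skew when `ell w = 0`.
  have e3 : inner ℝ z y = 5 / 2 * ‖w‖ ^ 2 := by
    have a1 := inner_mulX_volterra_self hL z
    have a2 := inner_volterra_of_ell_eq_zero hL (v := z) h0
    rw [← h.w_eq] at a1 a2
    rw [real_inner_self_eq_norm_sq] at a2
    rw [hy, katoMul, inner_sub_right, a1, real_inner_smul_right]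
    linarith
  have e5 : inner ℝ (volterra L (oneI L)) y = 0 := by
    rw [inner_volterra_of_ell_eq_zero hL k0, inner_oneI_left, k1, neg_zero]
  rw [h1, inner_add_left, inner_add_left, inner_sub_left, inner_add_left, inner_sub_left,
    real_inner_smul_left, real_inner_smul_left, real_inner_smul_left, real_inner_smul_left,
    inner_oneI_left, k0, e2, e3, e5, ← h.fst_eq] at e1
  have hyn := norm_katoMul_le w
  rw [← hy] at hyn
  have b1 : |a₁ * inner ℝ (volterra L u) y|
      ≤ |a₁| * ‖volterra L‖ * (L + 2 * ‖volterra L‖) * (‖w‖ * ‖u‖) := by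
    rw [abs_mul]
    have c1 := abs_real_inner_le_norm (volterra L u) y
    have c2 := (volterra L).le_opNorm u
    calc |a₁| * |inner ℝ (volterra L u) y| ≤ |a₁| * (‖volterra L u‖ * ‖y‖) := by gcongr
      _ ≤ |a₁| * ((‖volterra L‖ * ‖u‖) * ((L + 2 * ‖volterra L‖) * ‖w‖)) := by gcongr
      _ = _ := by ring
  -- The factor `(1 + ‖K‖)²` bounds every power `K^(2 - k)`, so the constant does not depend on `k`.
  have b2 : |inner ℝ ((volterra L ^ (2 - k)) m) y|
      ≤ (1 + ‖volterra L‖) ^ 2 * (L + 2 * ‖volterra L‖) * (‖w‖ * ‖m‖) := by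
    have c1 := abs_real_inner_le_norm ((volterra L ^ (2 - k)) m) y
    have c2 := norm_pow_volterra_le m (j := 2 - k) (by omega)
    calc _ ≤ ‖(volterra L ^ (2 - k)) m‖ * ‖y‖ := c1
      _ ≤ ((1 + ‖volterra L‖) ^ 2 * ‖m‖) * ((L + 2 * ‖volterra L‖) * ‖w‖) := by gcongr
      _ = _ := by ring
  have b3 : |a₁| * ‖volterra L‖ * (L + 2 * ‖volterra L‖) * (‖w‖ * ‖u‖)
      + (1 + ‖volterra L‖) ^ 2 * (L + 2 * ‖volterra L‖) * (‖w‖ * ‖m‖)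
      ≤ N * ‖w‖ * (‖u‖ + ‖m‖) := by
    have p1 : 0 ≤ |a₁| * ‖volterra L‖ * (L + 2 * ‖volterra L‖) * (‖w‖ * ‖m‖) := by positivity
    have p2 : 0 ≤ (1 + ‖volterra L‖) ^ 2 * (L + 2 * ‖volterra L‖) * (‖w‖ * ‖u‖) := by positivity
    rw [hN, katoConst]
    linarith
  have hΦ : ‖Φ‖ ^ 2 = ‖u‖ ^ 2 + ‖Φ.snd‖ ^ 2 := WithLp.prod_norm_sq_eq_of_L2 _
  have hmn := norm_memInt_sq_le hf Φ.snd
  set g := ∫ s in Ioi 0, memG f s with hg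
  have hg0 : 0 ≤ g := setIntegral_nonneg measurableSet_Ioi fun s hs => (hf.memG_pos (le_of_lt hs)).le
  have b4 : ‖u‖ ^ 2 + ‖m‖ ^ 2 ≤ (1 + g) * ‖Φ‖ ^ 2 := by
    rw [hΦ]; nlinarith [sq_nonneg ‖u‖, sq_nonneg ‖Φ.snd‖, mul_nonneg hg0 (sq_nonneg ‖u‖)]
  have b5 := young_aux ha₀ N ‖w‖ ‖u‖ ‖m‖
  have b6 : N ^ 2 / a₀ * (‖u‖ ^ 2 + ‖m‖ ^ 2) ≤ N ^ 2 / a₀ * ((1 + g) * ‖Φ‖ ^ 2) :=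
    mul_le_mul_of_nonneg_left b4 (by positivity)
  have b7 := le_abs_self (a₁ * inner ℝ (volterra L u) y)
  have b8 := neg_abs_le (inner ℝ ((volterra L ^ (2 - k)) m) y)
  have b9 := sq_nonneg ‖volterra L w‖
  rw [← mul_assoc] at b6
  linarith

end Operator

/-! ### Maximality of the operator -/

section Range

variable {f : ℝ → ℝ} {L : ℝ} {k : ℕ} {a₀ a₁ : ℝ}

theorem ell_testD_succ (hL : 0 < L) {φ : ℝ → ℝ} (h : IsTest (Ioo 0 L) φ) (n : ℕ) :
    ell L (testD h (n + 1)) = 0 := by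
  rw [testD_succ]; exact ell_testL2_deriv hL (h.iteratedDeriv n)

theorem inner_oneI_testD (hL : 0 < L) {φ : ℝ → ℝ} (h : IsTest (Ioo 0 L) φ) (n i : ℕ) :
    inner ℝ ((volterra L ^ i) (oneI L)) (testD h (n + 1 + i)) = 0 := by
  rw [inner_testD_add hL, inner_oneI_left, ell_testD_succ hL]

/-- The Volterra operator obtained from the resolvent equation by integrating three times. -/
def resolventOp (L : ℝ) (k : ℕ) (a₁ μ c : ℝ) : L2I L →L[ℝ] L2I L :=
  volterra L + a₁ • volterra L ^ 3 - μ • volterra L ^ 4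
    - c • (volterra L ^ (2 - k) * (-volterra L) ^ (2 - k))

theorem volterra_commute_resolventOp (a₁ μ c : ℝ) :
    Commute (volterra L) (resolventOp L k a₁ μ c) := by
  have h := Commute.refl (volterra L)
  exact (((h.add_right ((h.pow_right 3).smul_right a₁)).sub_right
    ((h.pow_right 4).smul_right μ)).sub_right
    (((h.pow_right _).mul_right ((h.neg_right).pow_right _)).smul_right c))

theorem memResolvent_zero (hf : IsMemoryKernel f) {μ : ℝ} (hμ : 0 < μ) :
    memResolvent hf hμ (0 : Lg f L k) = 0 := by
  have := norm_memResolvent_le hf hμ (0 : Lg f L k)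
  rw [norm_zero] at this
  have h0 := norm_nonneg (memResolvent hf hμ (0 : Lg f L k))
  exact norm_eq_zero.1 (le_antisymm (by nlinarith) h0)

theorem memInt_zero : memInt (0 : Lg f L k) = 0 := by
  rw [memInt, ← integral_zero ℝ (L2I L)]
  refine integral_congr_ae ?_
  filter_upwards [Lp.coeFn_zero (Hk L k) 2 (memMeasure f)] with s hs
  rw [hs]; exact map_zero _

/-- Converts a solution `w` of the scalar Volterra equation with the two side conditions into a
solution of the full resolvent equation. It serves both for existence and, with `Θ = 0`, for the
injectivity of the system that determines `(β, γ)`. -/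
theorem mem_opGraph_of_solution (hL : 0 < L) (ha₀ : 0 < a₀) (hf : IsMemoryKernel f) (hk : k ≤ 2)
    {μ : ℝ} (hμ : 0 < μ) {c : ℝ}
    (hc : ∀ U : Hk L k, memInt (memResolvent hf hμ (constLg hf U)) = c • Hk.dx U)
    (Θ : Energy f L k) {w : L2I L} (h0 : ell L w = 0) (h1 : ell L (volterra L w) = 0) {β γ : ℝ}
    (hw : a₀ • w - volterra L (resolventOp L k a₁ μ c w)
      = volterra L (volterra L (volterra L Θ.fst)
          - (volterra L ^ (2 - k)) (memInt (memResolvent hf hμ Θ.snd))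
          + β • oneI L + γ • volterra L (oneI L))) :
    ∃ Φ Ψ : Energy f L k, (Φ, Ψ) ∈ opGraph hf L k a₀ a₁ ∧ μ • Φ - Ψ = Θ ∧
      Φ.fst = volterra L (volterra L w) := by
  set U := hkOf hL hk h0 h1 with hU
  set η₁ := memResolvent hf hμ (constLg hf U) with hη₁
  set η₂ := memResolvent hf hμ Θ.snd with hη₂
  set u := volterra L (volterra L w) with hu
  have hm : memInt (η₁ + η₂) = c • ((-volterra L) ^ (2 - k)) w + memInt η₂ := by
    rw [memInt_add hf, hη₁, hc, hU, dx_hkOf]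
  refine ⟨WithLp.toLp 2 (u, η₁ + η₂),
    WithLp.toLp 2 (μ • u - Θ.fst, μ • (η₁ + η₂) - Θ.snd), ⟨?_, ?_, ?_, ?_⟩, ?_, rfl⟩
  · refine ⟨jetOf 2 w, jetOf_mem hL fun i hi => ell_pow_neg_volterra h0 h1 hi, ?_, ?_⟩
    · change ((-volterra L) ^ 2) w = u
      exact pow_two_neg_volterra w
    · change HasTrace L w L 0
      have ht := (hasTrace_volterra_right (L := L) (a₀⁻¹ • (resolventOp L k a₁ μ c w
        + (volterra L (volterra L Θ.fst)
          - (volterra L ^ (2 - k)) (memInt (memResolvent hf hμ Θ.snd))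
          + β • oneI L + γ • volterra L (oneI L)))))
      -- The equation exhibits `w` as an element of the range of `K`; this is the boundary condition
      -- `∂ₓ²u(L) = 0`.
      have he : volterra L (a₀⁻¹ • (resolventOp L k a₁ μ c w
        + (volterra L (volterra L Θ.fst)
          - (volterra L ^ (2 - k)) (memInt (memResolvent hf hμ Θ.snd))
          + β • oneI L + γ • volterra L (oneI L)))) = w := by
        rw [map_smul, inv_smul_eq_iff₀ ha₀.ne', map_add, ← hw, add_sub_cancel]
      rwa [he] at ht
  · exact (vanishesAtZero_memResolvent hf hμ _).add (vanishesAtZero_memResolvent hf hμ _)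
  · change IsFirstComp a₀ a₁ u (η₁ + η₂) (μ • u - Θ.fst)
    refine (isFirstComp_iff hL hf hk).2 fun φ hφ => ?_
    -- The defect consists of polynomials of degree one and two, which third derivatives of test
    -- functions annihilate.
    have hq : firstDefect k a₀ a₁ w (memInt (η₁ + η₂)) (μ • u - Θ.fst)
        = β • (volterra L ^ 1) (oneI L) + γ • (volterra L ^ 2) (oneI L) := by
      have hk3 : volterra L ^ (3 - k) = volterra L * volterra L ^ (2 - k) := by
        rw [← pow_succ']; congr 1; omega
      rw [firstDefect, hm, hk3]
      have p3 : ∀ v, (volterra L ^ 3) v = volterra L (volterra L (volterra L v)) := fun v => by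
        simp only [pow_succ, pow_zero, one_mul]; rfl
      have p4 : ∀ v, (volterra L ^ 4) v = volterra L (volterra L (volterra L (volterra L v))) :=
        fun v => by simp only [pow_succ, pow_zero, one_mul]; rfl
      have hR : resolventOp L k a₁ μ c w = volterra L w
          + a₁ • volterra L (volterra L (volterra L w))
          - μ • volterra L (volterra L (volterra L (volterra L w)))
          - c • (volterra L ^ (2 - k)) (((-volterra L) ^ (2 - k)) w) := by
        rw [← p4, ← p3]; rfl
      rw [hR] at hw
      simp only [map_add, map_sub, map_smul] at hw
      rw [pow_one, pow_two, p3, p4]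
      simp only [mul_apply_eq_comp, map_add, map_sub, map_smul]
      rw [sub_eq_iff_eq_add] at hw
      rw [hw, hu]
      module
    rw [hq, inner_add_left, real_inner_smul_left, real_inner_smul_left,
      inner_oneI_testD hL hφ 1 1, inner_oneI_testD hL hφ 0 2]
    ring
  · refine ⟨(constLg hf U + (-μ) • η₁) + (Θ.snd + (-μ) • η₂),
      (isMemDeriv_memResolvent hL hf hμ _).add hf (isMemDeriv_memResolvent hL hf hμ _), ?_⟩
    change ∀ᵐ s ∂(memMeasure f), Hk.fn ((μ • (η₁ + η₂) - Θ.snd : Lg f L k) s) = u - Hk.fn _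
    have he : μ • (η₁ + η₂) - Θ.snd
        = constLg hf U - ((constLg hf U + (-μ) • η₁) + (Θ.snd + (-μ) • η₂)) := by module
    rw [he]
    filter_upwards [Lp.coeFn_sub (constLg hf U)
      ((constLg hf U + (-μ) • η₁) + (Θ.snd + (-μ) • η₂)), coeFn_constLg hf U] with s a1 a2
    rw [a1, Pi.sub_apply, a2, map_sub, hU, fn_hkOf]
  · refine (WithLp.ofLp_injective 2) (Prod.ext ?_ ?_)
    · change μ • u - (μ • u - Θ.fst) = Θ.fst
      abel
    · change μ • (η₁ + η₂) - (μ • (η₁ + η₂) - Θ.snd) = Θ.snd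
      abel

theorem opGraph_inner_nonpos (hL : 0 < L) (ha₀ : 0 < a₀) (hf : IsMemoryKernel f) (hk : k ≤ 2)
    {Φ Ψ : Energy f L k} (h : (Φ, Ψ) ∈ opGraph hf L k a₀ a₁) : inner ℝ Ψ Φ ≤ 0 := by
  obtain ⟨w, z, hd⟩ := exists_graphData hL ha₀ hf hk h
  exact hd.inner_nonpos hL ha₀

/-- For each `(β, γ)` the Volterra equation is uniquely solvable for `w`, and the two conditions
`ell w = ell (K w) = 0` have to be met by the choice of these two parameters. -/
theorem exists_mem_opGraph (hL : 0 < L) (ha₀ : 0 < a₀) (hf : IsMemoryKernel f) (hk : k ≤ 2)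
    {μ : ℝ} (hμ : 0 < μ) (Θ : Energy f L k) :
    ∃ Φ Ψ : Energy f L k, (Φ, Ψ) ∈ opGraph hf L k a₀ a₁ ∧ μ • Φ - Ψ = Θ := by
  obtain ⟨c, hc⟩ := exists_memInt_memResolvent_constLg hL hf hμ k
  obtain ⟨E, hE⟩ := isUnit_smul_one_sub_volterra_mul hL ha₀.ne'
    (volterra_commute_resolventOp (L := L) (k := k) a₁ μ c)
  have hE1 : ∀ v, a₀ • (↑E⁻¹ : L2I L →L[ℝ] L2I L) v
      - volterra L (resolventOp L k a₁ μ c ((↑E⁻¹ : L2I L →L[ℝ] L2I L) v)) = v := fun v => by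
    have h1 : (E : L2I L →L[ℝ] L2I L) * (↑E⁻¹ : L2I L →L[ℝ] L2I L) = 1 := E.mul_inv
    rw [hE] at h1
    exact congrArg (fun T : L2I L →L[ℝ] L2I L => T v) h1
  set B : L2I L →L[ℝ] L2I L := ↑E⁻¹ with hB
  set p : ℝ × ℝ →ₗ[ℝ] L2I L :=
    (LinearMap.toSpanSingleton ℝ (L2I L) (oneI L)).coprod
      (LinearMap.toSpanSingleton ℝ (L2I L) (volterra L (oneI L))) with hp
  have hpa : ∀ b : ℝ × ℝ, p b = b.1 • oneI L + b.2 • volterra L (oneI L) := fun b => rfl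
  set W : ℝ × ℝ →ₗ[ℝ] L2I L := (B * volterra L).toLinearMap ∘ₗ p with hW
  have hWa : ∀ b, W b = B (volterra L (p b)) := fun b => rfl
  set T : ℝ × ℝ →ₗ[ℝ] ℝ × ℝ := ((ell L).toLinearMap ∘ₗ W).prod
    ((ell L).toLinearMap ∘ₗ (volterra L).toLinearMap ∘ₗ W) with hT
  have hTa : ∀ b, T b = (ell L (W b), ell L (volterra L (W b))) := fun b => rfl
  -- A kernel element yields `Φ` with `A Φ = μ Φ`. Dissipativity forces `Φ = 0`, hence `w = 0`, and
  -- then both parameters vanish because `1` and `K 1` are independent.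
  have hinj : Function.Injective T := by
    refine (injective_iff_map_eq_zero T).2 fun b hb => ?_
    rw [hTa] at hb
    have hb1 : ell L (W b) = 0 := congrArg Prod.fst hb
    have hb2 : ell L (volterra L (W b)) = 0 := congrArg Prod.snd hb
    obtain ⟨Φ, Ψ, hmem, hΦ, hfst⟩ := mem_opGraph_of_solution (a₁ := a₁) hL ha₀ hf hk hμ hc 0 hb1 hb2
      (β := b.1) (γ := b.2) (by
        rw [hWa, hE1, hpa]
        congr 1
        change _ = volterra L (volterra L 0)
          - (volterra L ^ (2 - k)) (memInt (memResolvent hf hμ 0)) + _ + _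
        rw [memResolvent_zero, memInt_zero, map_zero, map_zero, map_zero]; abel)
    have h1 := opGraph_inner_nonpos hL ha₀ hf hk hmem
    rw [sub_eq_zero] at hΦ
    rw [← hΦ, real_inner_smul_left, real_inner_self_eq_norm_sq] at h1
    have h2 : ‖Φ‖ ^ 2 = 0 := le_antisymm (by
      by_contra hcon
      exact absurd h1 (not_le.2 (mul_pos hμ (not_le.1 hcon)))) (sq_nonneg _)
    have h3 : Φ = 0 := norm_eq_zero.1 (pow_eq_zero_iff two_ne_zero |>.1 h2)
    have h4 : volterra L (volterra L (W b)) = 0 := by rw [← hfst, h3]; rfl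
    have h5 : W b = 0 := by
      have := volterra_injective hL (h4.trans (map_zero _).symm)
      exact volterra_injective hL (this.trans (map_zero _).symm)
    have h6 := hE1 (volterra L (p b))
    rw [← hWa, h5, map_zero, map_zero, smul_zero, sub_zero] at h6
    have h7 : p b = 0 := volterra_injective hL (h6.symm.trans (map_zero _).symm)
    rw [hpa, ← map_smul] at h7
    obtain ⟨h8, h9⟩ := eq_zero_of_smul_oneI_add_volterra hL h7
    exact Prod.ext h8 ((smul_eq_zero.1 h9).resolve_right (oneI_ne_zero hL))
  set r := volterra L (volterra L Θ.fst)
    - (volterra L ^ (2 - k)) (memInt (memResolvent hf hμ Θ.snd)) with hr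
  -- In dimension two injectivity is surjectivity, so the defects caused by the data `r` can be
  -- compensated.
  obtain ⟨b, hb⟩ := LinearMap.injective_iff_surjective.1 hinj
    (-ell L (B (volterra L r)), -ell L (volterra L (B (volterra L r))))
  rw [hTa] at hb
  have hb1 : ell L (W b) = -ell L (B (volterra L r)) := congrArg Prod.fst hb
  have hb2 : ell L (volterra L (W b)) = -ell L (volterra L (B (volterra L r))) :=
    congrArg Prod.snd hb
  obtain ⟨Φ, Ψ, hmem, hΦ, -⟩ := mem_opGraph_of_solution (a₁ := a₁) hL ha₀ hf hk hμ hc Θ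
    (w := B (volterra L (r + p b))) (β := b.1) (γ := b.2)
    (by rw [map_add, map_add, map_add, ← hWa, hb1, add_neg_cancel])
    (by rw [map_add, map_add, map_add, map_add, ← hWa, hb2, add_neg_cancel])
    (by rw [hE1, hpa, ← hr, add_assoc])
  exact ⟨Φ, Ψ, hmem, hΦ⟩

theorem isMaximalDissipative_op (hL : 0 < L) (ha₀ : 0 < a₀) (hf : IsMemoryKernel f) (hk : k ≤ 2) :
    IsMaximalDissipative (op hf L k a₀ a₁) where
  dissipative Φ Ψ h := by
    rw [op_graph] at h
    exact opGraph_inner_nonpos hL ha₀ hf hk h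
  range μ hμ Θ := by
    rw [op_graph]
    exact exists_mem_opGraph hL ha₀ hf hk hμ Θ

theorem completeSpace_energy (hL : 0 < L) : CompleteSpace (Energy f L k) := by
  have := Hk.completeSpace (k := k) hL
  infer_instance

end Range

/-! ### Smoothing by a bounded symmetric form -/

section Smoothing

variable {X : Type*} [NormedAddCommGroup X] [InnerProductSpace ℝ X] [CompleteSpace X]
  {A : X →ₗ.[ℝ] X} (hA : IsMaximalDissipative A)
  {Y : Type*} [NormedAddCommGroup Y] [InnerProductSpace ℝ Y]

namespace IsMaximalDissipative

/-- The semigroup restricted to the domain of its generator, extended by the identity to `t < 0`. -/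
def domSemigroup (t : ℝ) : A.domain →ₗ[ℝ] A.domain :=
  (hA.semigroup (max t 0)).toLinearMap.restrict fun x hx =>
    LinearPMap.mem_domain_of_mem_graph
      (hA.semigroup_mem (A.mem_graph ⟨x, hx⟩) (le_max_right t 0))

theorem coe_domSemigroup (t : ℝ) (x : A.domain) :
    (hA.domSemigroup t x : X) = hA.semigroup (max t 0) x := rfl

theorem apply_domSemigroup (t : ℝ) (x : A.domain) :
    A (hA.domSemigroup t x) = hA.semigroup (max t 0) (A x) :=
  LinearPMap.mem_graph_snd_inj _ (A.mem_graph (hA.domSemigroup t x))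
    (hA.semigroup_mem (A.mem_graph x) (le_max_right t 0)) rfl

theorem continuous_semigroup_max (x : X) : Continuous fun t => hA.semigroup (max t 0) x :=
  (hA.continuousOn_semigroup x).comp_continuous (continuous_id.max continuous_const)
    fun t => le_max_right t 0

variable {B : X →L[ℝ] X} {J : A.domain →ₗ[ℝ] Y} {c κ ℓ : ℝ}

/-- `J` need not be bounded on `X`. Its quadratic bound, applied to `S(t) x - S(s) x`, is controlled
by the continuity of `S(·) x` and of `A S(·) x = S(·) A x`. -/
theorem continuous_domSemigroup (hc : 0 < c)
    (hJ : ∀ x : A.domain, c * ‖J x‖ ^ 2 ≤ -inner ℝ (A x) (B x) + κ * ‖(x : X)‖ ^ 2)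
    (x : A.domain) : Continuous fun t => J (hA.domSemigroup t x) := by
  refine continuous_iff_continuousAt.2 fun s => ?_
  have hp := hA.continuous_semigroup_max x
  have hq := hA.continuous_semigroup_max (A x)
  set p := fun t => hA.semigroup (max t 0) (x : X) with hpdef
  set q := fun t => hA.semigroup (max t 0) (A x) with hqdef
  have hb : Continuous fun t => c⁻¹ * (-inner ℝ (q t - q s) (B (p t - p s))
      + κ * ‖p t - p s‖ ^ 2) := by fun_prop
  have h0 := hb.tendsto s
  simp only [sub_self, map_zero, inner_zero_left, norm_zero, neg_zero, zero_add, ne_eq,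
    OfNat.ofNat_ne_zero, not_false_eq_true, zero_pow, mul_zero] at h0
  have h1 : ∀ t, ‖J (hA.domSemigroup t x) - J (hA.domSemigroup s x)‖ ^ 2
      ≤ c⁻¹ * (-inner ℝ (q t - q s) (B (p t - p s)) + κ * ‖p t - p s‖ ^ 2) := fun t => by
    rw [← map_sub, inv_mul_eq_div, le_div_iff₀ hc, mul_comm]
    refine (hJ _).trans_eq ?_
    rw [LinearPMap.map_sub, apply_domSemigroup, apply_domSemigroup]; rfl
  have h2 := (squeeze_zero (fun t => sq_nonneg _) h1 h0).sqrt
  simp only [Real.sqrt_sq (norm_nonneg _), Real.sqrt_zero] at h2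
  exact tendsto_iff_norm_sub_tendsto_zero.2 h2

/-- By symmetry of `B` the integrand is the time derivative of `⟨S(t) x, B S(t) x⟩`. -/
theorem integral_inner_eq (hB : ∀ x y, inner ℝ (B x) y = inner ℝ x (B y)) {T : ℝ} (hT : 0 ≤ T)
    (x : A.domain) :
    ∫ t in (0 : ℝ)..T, 2 * inner ℝ (A (hA.domSemigroup t x)) (B (hA.domSemigroup t x))
      = inner ℝ (hA.semigroup T x) (B (hA.semigroup T x)) - inner ℝ (x : X) (B x) := by
  have hp := hA.continuous_semigroup_max x
  have hq := hA.continuous_semigroup_max (A x)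
  have h0 := hA.semigroup_zero
  have key := intervalIntegral.integral_eq_sub_of_hasDeriv_right_of_le hT
    (f := fun t => inner ℝ (hA.semigroup (max t 0) (x : X)) (B (hA.semigroup (max t 0) (x : X))))
    (f' := fun t => 2 * inner ℝ (hA.semigroup (max t 0) (A x))
      (B (hA.semigroup (max t 0) (x : X))))
    (by fun_prop)
    (fun t ht => by
      have h1 := (hA.hasDerivWithinAt_semigroup (A.mem_graph x) ht.1.le).hasDerivAt
        (Ici_mem_nhds ht.1)
      have h2 := (h1.inner ℝ (B.hasFDerivAt.comp_hasDerivAt t h1)).congr_of_eventuallyEq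
        (f₁ := fun t => inner ℝ (hA.semigroup (max t 0) (x : X))
          (B (hA.semigroup (max t 0) (x : X)))) (by
          filter_upwards [Ioi_mem_nhds ht.1] with r hr
          rw [max_eq_left (le_of_lt hr)]; rfl)
      refine (h2.congr_deriv ?_).hasDerivWithinAt
      rw [max_eq_left ht.1.le, Function.comp_apply, ← hB, real_inner_comm, two_mul])
    ((by fun_prop : Continuous _).intervalIntegrable _ _)
  simp only [max_eq_left hT, max_self, h0, one_apply_eq_self] at key
  simpa only [apply_domSemigroup, coe_domSemigroup] using key

theorem memLp_domSemigroup (hc : 0 < c)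
    (hJ : ∀ x : A.domain, c * ‖J x‖ ^ 2 ≤ -inner ℝ (A x) (B x) + κ * ‖(x : X)‖ ^ 2) (T : ℝ)
    (x : A.domain) :
    MemLp (fun t => J (hA.domSemigroup t x)) 2 (volume.restrict (Ioo 0 T)) := by
  have h := hA.continuous_domSemigroup hc hJ x
  refine (memLp_two_iff_integrable_sq_norm h.aestronglyMeasurable).2 ?_
  exact ((h.norm.pow 2).integrableOn_Icc (a := 0) (b := T)).mono_set Ioo_subset_Icc_self

/-- Integrating the quadratic bound along the orbit leaves half the difference of the form `⟨·, B
·⟩` at times `0` and `T`, which contractivity bounds by `ℓ ‖x‖²`, and `κ T ‖x‖²`. -/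
theorem integral_norm_sq_le (hc : 0 < c) (hκ : 0 ≤ κ)
    (hJ : ∀ x : A.domain, c * ‖J x‖ ^ 2 ≤ -inner ℝ (A x) (B x) + κ * ‖(x : X)‖ ^ 2)
    (hB : ∀ x y, inner ℝ (B x) y = inner ℝ x (B y)) (hℓ : ∀ x, ‖B x‖ ≤ ℓ * ‖x‖) {T : ℝ}
    (hT : 0 ≤ T) (x : A.domain) :
    c * ∫ t in (0 : ℝ)..T, ‖J (hA.domSemigroup t x)‖ ^ 2 ≤ (ℓ + κ * T) * ‖(x : X)‖ ^ 2 := by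
  have hp := hA.continuous_semigroup_max x
  have hq := hA.continuous_semigroup_max (A x)
  have hi : Continuous fun t => inner ℝ (A (hA.domSemigroup t x)) (B (hA.domSemigroup t x)) := by
    simp only [apply_domSemigroup, coe_domSemigroup]; fun_prop
  have hform : ∀ y : X, |inner ℝ y (B y)| ≤ ℓ * ‖y‖ ^ 2 := fun y =>
    (abs_real_inner_le_norm _ _).trans (by nlinarith [hℓ y, norm_nonneg y])
  have h1 : ∫ t in (0 : ℝ)..T, c * ‖J (hA.domSemigroup t x)‖ ^ 2 ≤
      ∫ t in (0 : ℝ)..T, (-(1 / 2) * (2 * inner ℝ (A (hA.domSemigroup t x))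
        (B (hA.domSemigroup t x))) + κ * ‖(x : X)‖ ^ 2) := by
    refine intervalIntegral.integral_mono_on hT ?_ ?_ fun t _ => ?_
    · exact (((hA.continuous_domSemigroup hc hJ x).norm.pow 2).const_mul c).intervalIntegrable _ _
    · exact (by fun_prop : Continuous _).intervalIntegrable _ _
    · have h2 := hA.norm_semigroup_le (le_max_right t 0) (x : X)
      have h3 := hJ (hA.domSemigroup t x)
      have h4 : κ * ‖(hA.domSemigroup t x : X)‖ ^ 2 ≤ κ * ‖(x : X)‖ ^ 2 :=
        mul_le_mul_of_nonneg_left (pow_le_pow_left₀ (norm_nonneg _) h2 2) hκ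
      linarith
  rw [intervalIntegral.integral_const_mul,
    intervalIntegral.integral_add ((by fun_prop : Continuous _).intervalIntegrable _ _)
      (continuous_const.intervalIntegrable _ _), intervalIntegral.integral_const_mul,
    hA.integral_inner_eq hB hT, intervalIntegral.integral_const, sub_zero, smul_eq_mul] at h1
  have h5 := abs_le.1 (hform (hA.semigroup T x))
  have h6 := abs_le.1 (hform x)
  have hℓ0 : ℓ * ‖hA.semigroup T x‖ ^ 2 ≤ ℓ * ‖(x : X)‖ ^ 2 := by
    rcases eq_or_ne (x : X) 0 with h | h
    · rw [h, map_zero]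
    · have h7 : 0 ≤ ℓ := nonneg_of_mul_nonneg_left ((norm_nonneg _).trans (hℓ x))
        (norm_pos_iff.2 h)
      exact mul_le_mul_of_nonneg_left
        (pow_le_pow_left₀ (norm_nonneg _) (hA.norm_semigroup_le hT x) 2) h7
  nlinarith

theorem norm_toLp_sq {T : ℝ} (hT : 0 ≤ T) {g : ℝ → Y}
    (hg : MemLp g 2 (volume.restrict (Ioo 0 T))) :
    ‖hg.toLp g‖ ^ 2 = ∫ t in (0 : ℝ)..T, ‖g t‖ ^ 2 := by
  rw [← real_inner_self_eq_norm_sq, L2.inner_def, intervalIntegral.integral_of_le hT,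
    integral_Ioc_eq_integral_Ioo]
  refine integral_congr_ae ?_
  filter_upwards [hg.coeFn_toLp] with t ht
  rw [ht, real_inner_self_eq_norm_sq]

/-- A quadratic bound `c ‖J x‖² ≤ -⟨A x, B x⟩ + κ ‖x‖²` with a bounded symmetric `B` extends the map
`x ↦ J (S(·) x)` from the domain to a bounded map of the whole space into `L²(0, T; Y)`. -/
theorem exists_smoothing [CompleteSpace Y] (hc : 0 < c) (hκ : 0 ≤ κ) (hℓ0 : 0 ≤ ℓ)
    (hJ : ∀ x : A.domain, c * ‖J x‖ ^ 2 ≤ -inner ℝ (A x) (B x) + κ * ‖(x : X)‖ ^ 2)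
    (hB : ∀ x y, inner ℝ (B x) y = inner ℝ x (B y)) (hℓ : ∀ x, ‖B x‖ ≤ ℓ * ‖x‖) {T : ℝ}
    (hT : 0 ≤ T) :
    ∃ V : X →L[ℝ] Lp Y 2 (volume.restrict (Ioo 0 T)),
      (∀ x, ‖V x‖ ^ 2 ≤ (ℓ + κ * T) / c * ‖x‖ ^ 2) ∧
      ∀ x : A.domain, V x =ᵐ[volume.restrict (Ioo 0 T)] fun t => J (hA.domSemigroup t x) := by
  have hm := hA.memLp_domSemigroup hc hJ T
  let V₀ : A.domain →ₗ[ℝ] Lp Y 2 (volume.restrict (Ioo 0 T)) :=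
    { toFun := fun x => (hm x).toLp _
      map_add' := fun x y => by
        rw [← MemLp.toLp_add]
        exact MemLp.toLp_congr _ _ (Eventually.of_forall fun t => by simp)
      map_smul' := fun r x => by
        rw [RingHom.id_apply, ← MemLp.toLp_const_smul]
        exact MemLp.toLp_congr _ _ (Eventually.of_forall fun t => by simp) }
  have hb0 : 0 ≤ (ℓ + κ * T) / c := by positivity
  have hd : DenseRange A.domain.subtype := by
    have := hA.dense_domain
    rwa [DenseRange, Submodule.coe_subtype, Subtype.range_coe]
  have hV : ∀ x, ‖V₀ x‖ ≤ √((ℓ + κ * T) / c) * ‖A.domain.subtype x‖ := fun x => by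
    refine le_of_sq_le_sq ?_ (by positivity)
    rw [mul_pow, Real.sq_sqrt hb0, div_mul_eq_mul_div, le_div_iff₀ hc, mul_comm]
    change c * ‖(hm x).toLp _‖ ^ 2 ≤ _
    rw [norm_toLp_sq hT]
    exact hA.integral_norm_sq_le hc hκ hJ hB hℓ hT x
  -- The estimate uses only the norm of `X`, so the map extends from the dense domain with the same
  -- bound.
  refine ⟨V₀.extendOfNorm A.domain.subtype, fun x => ?_, fun x => ?_⟩
  · have := V₀.norm_extendOfNorm_apply_le hd _ hV x
    calc _ ≤ (√((ℓ + κ * T) / c) * ‖x‖) ^ 2 := pow_le_pow_left₀ (norm_nonneg _) this 2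
      _ = _ := by rw [mul_pow, Real.sq_sqrt hb0]
  · have h := V₀.extendOfNorm_eq hd ⟨_, hV⟩ x
    rw [Submodule.subtype_apply] at h
    rw [h]
    exact (hm x).coeFn_toLp

/-- The curve `t ↦ P (S(t) x)` on `[0, T]`. -/
def orbit {Z : Type*} [NormedAddCommGroup Z] [NormedSpace ℝ Z] (P : X →L[ℝ] Z) (T : ℝ) (x : X) :
    C(Icc (0 : ℝ) T, Z) where
  toFun t := P (hA.semigroup t x)
  continuous_toFun := P.continuous.comp
    ((hA.continuousOn_semigroup x).comp_continuous continuous_subtype_val fun t => t.2.1)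

theorem continuous_orbit {Z : Type*} [NormedAddCommGroup Z] [NormedSpace ℝ Z] (P : X →L[ℝ] Z)
    (T : ℝ) : Continuous (hA.orbit P T) := by
  refine (LipschitzWith.of_dist_le_mul (K := ‖P‖₊) fun x y => ?_).continuous
  refine (ContinuousMap.dist_le (by positivity)).2 fun t => ?_
  change dist (P (hA.semigroup t x)) (P (hA.semigroup t y)) ≤ _
  rw [dist_eq_norm, dist_eq_norm, ← map_sub, ← map_sub]
  exact (P.le_opNorm _).trans
    (mul_le_mul_of_nonneg_left (hA.norm_semigroup_le t.2.1 _) (norm_nonneg _))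

end IsMaximalDissipative

end Smoothing

/-! ### The smoothing estimate -/

section Regularity

variable {f : ℝ → ℝ} {L : ℝ} {k : ℕ} {a₀ a₁ : ℝ}

/-- A bound for the squared norm of the embedding `w ↦ u`, `∂ₓ²u = w`, into `H²(I)`. -/
def jetConst (L : ℝ) : ℝ := 3 * ((1 + ‖volterra L‖) ^ 2) ^ 2

theorem jetConst_pos (L : ℝ) : 0 < jetConst L := by
  unfold jetConst; positivity

theorem norm_jetOf_sq_le (w : L2I L) : ‖jetOf 2 w‖ ^ 2 ≤ jetConst L * ‖w‖ ^ 2 := by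
  rw [PiLp.norm_sq_eq_of_L2]
  have h : ∀ j : Fin 3, ‖jetOf 2 w j‖ ^ 2 ≤ ((1 + ‖volterra L‖) ^ 2) ^ 2 * ‖w‖ ^ 2 := fun j => by
    rw [← mul_pow]
    refine pow_le_pow_left₀ (norm_nonneg _) ?_ 2
    have h1 : jetOf 2 w j = (-1 : ℝ) ^ (2 - (j : ℕ)) • (volterra L ^ (2 - (j : ℕ))) w := by
      change ((-volterra L) ^ (2 - (j : ℕ))) w = _
      rw [← neg_one_smul ℝ (volterra L), smul_pow]; rfl
    rw [h1, norm_smul, norm_pow, norm_neg, norm_one, one_pow, one_mul]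
    exact norm_pow_volterra_le w (by omega)
  refine (Finset.sum_le_sum fun j _ => h j).trans_eq ?_
  rw [Finset.sum_const, Finset.card_univ, Fintype.card_fin, nsmul_eq_mul, jetConst]
  push_cast; ring

theorem exists_sob_of_mem_opGraph (hL : 0 < L) (ha₀ : 0 < a₀) (hf : IsMemoryKernel f) (hk : k ≤ 2)
    {Φ Ψ : Energy f L k} (h : (Φ, Ψ) ∈ opGraph hf L k a₀ a₁) :
    ∃ v : Sob L 2, v.1 0 = Φ.fst ∧ 2 * a₀ / jetConst L * ‖v‖ ^ 2 ≤
      -inner ℝ Ψ.fst (mulX L Φ.fst)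
        + katoConst L a₁ ^ 2 / a₀ * (1 + ∫ s in Ioi 0, memG f s) * ‖Φ‖ ^ 2 := by
  obtain ⟨w, z, hd⟩ := exists_graphData hL ha₀ hf hk h
  refine ⟨⟨jetOf 2 w, (jetOf_mem hL fun i hi =>
    ell_pow_neg_volterra hd.ell_zero hd.ell_one hi).1⟩, ?_, ?_⟩
  · rw [hd.fst_eq, ← pow_two_neg_volterra]; rfl
  · refine le_trans ?_ (hd.kato hL ha₀)
    rw [div_mul_eq_mul_div, div_le_iff₀ (jetConst_pos L), mul_assoc (2 * a₀), mul_comm _ (jetConst L)]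
    exact mul_le_mul_of_nonneg_left (norm_jetOf_sq_le w) (by positivity)

/-- A function determines its weak derivatives. This makes the lift to `H²(I)` chosen in `sobFst`
linear. -/
theorem Sob.ext_zero {m : ℕ} {v v' : Sob L m} (h : v.1 0 = v'.1 0) : v = v' := by
  have h1 : ((v - v' : Sob L m) : Jet L m) = 0 :=
    Sob.eq_zero_of_zero (v - v').2 (by
      change v.1 0 - v'.1 0 = 0
      rw [h, sub_self])
  exact sub_eq_zero.1 (Subtype.ext h1)

/-- On a domain whose first components lie in `H²(I)`, the first component as a linear map into
`H²(I)`. -/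
def sobFst {A : Energy f L k →ₗ.[ℝ] Energy f L k}
    (h : ∀ x : A.domain, ∃ v : Sob L 2, v.1 0 = (x : Energy f L k).fst) : A.domain →ₗ[ℝ] Sob L 2 where
  toFun x := (h x).choose
  map_add' x y := Sob.ext_zero (by
    refine (h (x + y)).choose_spec.trans ?_
    change _ = (h x).choose.1 0 + (h y).choose.1 0
    rw [(h x).choose_spec, (h y).choose_spec]; rfl)
  map_smul' r x := Sob.ext_zero (by
    refine (h (r • x)).choose_spec.trans ?_
    change _ = r • (h x).choose.1 0
    rw [(h x).choose_spec]; rfl)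

theorem sobFst_apply_zero {A : Energy f L k →ₗ.[ℝ] Energy f L k}
    (h : ∀ x : A.domain, ∃ v : Sob L 2, v.1 0 = (x : Energy f L k).fst) (x : A.domain) :
    (sobFst h x).1 0 = (x : Energy f L k).fst := (h x).choose_spec

/-- Multiplication of the first component by `x`, which annihilates the memory variable. -/
def mulXFst (f : ℝ → ℝ) (L : ℝ) (k : ℕ) : Energy f L k →L[ℝ] Energy f L k :=
  ((WithLp.prodContinuousLinearEquiv 2 ℝ (L2I L) (Lg f L k)).symm : _ →L[ℝ] Energy f L k).comp
    ((ContinuousLinearMap.inl ℝ (L2I L) (Lg f L k)).comp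
      ((mulX L).comp (WithLp.fstL 2 ℝ (L2I L) (Lg f L k))))

theorem inner_mulXFst (Ψ Φ : Energy f L k) :
    inner ℝ Ψ (mulXFst f L k Φ) = inner ℝ Ψ.fst (mulX L Φ.fst) := by
  rw [WithLp.prod_inner_apply]
  change inner ℝ Ψ.fst (mulX L Φ.fst) + inner ℝ Ψ.snd 0 = _
  rw [inner_zero_right, add_zero]

theorem inner_mulXFst_comm (Φ Ψ : Energy f L k) :
    inner ℝ (mulXFst f L k Φ) Ψ = inner ℝ Φ (mulXFst f L k Ψ) := by
  rw [real_inner_comm, inner_mulXFst, inner_mulXFst, ← inner_mulX, real_inner_comm]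

theorem norm_mulXFst_le (hL : 0 < L) (Φ : Energy f L k) : ‖mulXFst f L k Φ‖ ≤ L * ‖Φ‖ := by
  have h : ‖mulXFst f L k Φ‖ ^ 2 = ‖mulX L Φ.fst‖ ^ 2 := by
    rw [← real_inner_self_eq_norm_sq, inner_mulXFst, ← real_inner_self_eq_norm_sq]; rfl
  rw [(sq_eq_sq₀ (norm_nonneg _) (norm_nonneg _)).1 h]
  exact (norm_mulX_le _).trans
    (mul_le_mul_of_nonneg_left (WithLp.norm_fst_le (L2I L) Φ) hL.le)

/-- Convergence in `L²(0, T; H²(I))` gives almost everywhere convergence along a subsequence, and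
uniform convergence gives it at every time. The compatibility of the two components can thus be
transferred from the domain to all data by density. -/
theorem isClosed_setOf_sob_eq (L T : ℝ) :
    IsClosed {p : C(Icc (0 : ℝ) T, L2I L) × Lp (Sob L 2) 2 (volume.restrict (Ioo 0 T)) |
      ∀ᵐ t ∂(volume.restrict (Ioo 0 T)), ∀ ht : t ∈ Icc 0 T, (p.2 t).1 0 = p.1 ⟨t, ht⟩} := by
  refine IsSeqClosed.isClosed fun p q hp hpq => ?_
  have h1 : Tendsto (fun n => (p n).1) atTop (𝓝 q.1) := (continuous_fst.tendsto q).comp hpq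
  have h2 : Tendsto (fun n => (p n).2) atTop (𝓝 q.2) := (continuous_snd.tendsto q).comp hpq
  obtain ⟨ns, hns, h3⟩ := (tendstoInMeasure_of_tendsto_Lp h2).exists_seq_tendsto_ae
  have h4 : ∀ n, ∀ᵐ t ∂(volume.restrict (Ioo 0 T)), ∀ ht : t ∈ Icc 0 T,
      ((p n).2 t).1 0 = (p n).1 ⟨t, ht⟩ := hp
  change ∀ᵐ t ∂(volume.restrict (Ioo 0 T)), ∀ ht : t ∈ Icc 0 T, (q.2 t).1 0 = q.1 ⟨t, ht⟩
  filter_upwards [h3, ae_all_iff.2 h4] with t h5 h6 ht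
  have h7 : Continuous fun v : Sob L 2 => v.1 0 := by fun_prop
  refine tendsto_nhds_unique ((h7.tendsto _).comp h5) ?_
  have h8 := ((continuous_eval_const (F := C(Icc (0 : ℝ) T, L2I L)) ⟨t, ht⟩).tendsto q.1).comp
    (h1.comp hns.tendsto_atTop)
  exact h8.congr fun n => (h6 (ns n) ht).symm

/-- The bound for `u ∈ L²(0, T; H²(I))` in terms of `T` and `g₀`. -/
def smoothingConst (L a₀ a₁ T g₀ : ℝ) : ℝ :=
  (L + katoConst L a₁ ^ 2 / a₀ * (1 + g₀) * T) / (2 * a₀ / jetConst L)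

theorem smoothingConst_pos (hL : 0 < L) (ha₀ : 0 < a₀) {T g₀ : ℝ} (hT : 0 < T) (hg : 0 < g₀) :
    0 < smoothingConst L a₀ a₁ T g₀ := by
  have := jetConst_pos L
  unfold smoothingConst; positivity

theorem exists_sobOrbit [CompleteSpace (Energy f L k)] (hL : 0 < L) (ha₀ : 0 < a₀)
    (hf : IsMemoryKernel f) (hk : k ≤ 2) (hA : IsMaximalDissipative (op hf L k a₀ a₁)) {T : ℝ}
    (hT : 0 < T) :
    ∃ V : Energy f L k →L[ℝ] Lp (Sob L 2) 2 (volume.restrict (Ioo 0 T)),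
      (∀ Φ, ‖V Φ‖ ^ 2 ≤ smoothingConst L a₀ a₁ T (∫ s in Ioi 0, memG f s) * ‖Φ‖ ^ 2) ∧
      ∀ Φ ∈ (op hf L k a₀ a₁).domain, ∀ᵐ t ∂(volume.restrict (Ioo 0 T)), ∀ _ : t ∈ Icc 0 T,
        (V Φ t).1 0 = (hA.semigroup t Φ).fst := by
  have hg : 0 ≤ ∫ s in Ioi 0, memG f s :=
    setIntegral_nonneg measurableSet_Ioi fun s hs => (hf.memG_pos (le_of_lt hs)).le
  have hex : ∀ x : (op hf L k a₀ a₁).domain, ∃ v : Sob L 2, v.1 0 = (x : Energy f L k).fst ∧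
      2 * a₀ / jetConst L * ‖v‖ ^ 2 ≤ -inner ℝ ((op hf L k a₀ a₁) x) (mulXFst f L k x)
        + katoConst L a₁ ^ 2 / a₀ * (1 + ∫ s in Ioi 0, memG f s) * ‖(x : Energy f L k)‖ ^ 2 :=
    fun x => by
      have h := (op hf L k a₀ a₁).mem_graph x
      rw [op_graph] at h
      rw [inner_mulXFst]
      exact exists_sob_of_mem_opGraph hL ha₀ hf hk h
  have hex' := fun x => (hex x).imp fun _ h => h.1
  have hJe : ∀ x : (op hf L k a₀ a₁).domain, 2 * a₀ / jetConst L * ‖sobFst hex' x‖ ^ 2 ≤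
      -inner ℝ ((op hf L k a₀ a₁) x) (mulXFst f L k x)
        + katoConst L a₁ ^ 2 / a₀ * (1 + ∫ s in Ioi 0, memG f s) * ‖(x : Energy f L k)‖ ^ 2 :=
    fun x => by
      obtain ⟨v, h1, h2⟩ := hex x
      rwa [Sob.ext_zero ((sobFst_apply_zero hex' x).trans h1.symm)]
  obtain ⟨V, hV, hVJ⟩ := hA.exists_smoothing (c := 2 * a₀ / jetConst L) (ℓ := L)
    (div_pos (by positivity) (jetConst_pos L)) (by positivity) hL.le hJe inner_mulXFst_comm
    (norm_mulXFst_le hL) hT.le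
  refine ⟨V, hV, fun Φ hΦ => ?_⟩
  filter_upwards [hVJ ⟨Φ, hΦ⟩] with t h3 ht
  rw [h3, sobFst_apply_zero, hA.coe_domSemigroup, max_eq_left ht.1]

theorem exists_solutionMap [CompleteSpace (Energy f L k)] (hL : 0 < L) (ha₀ : 0 < a₀)
    (hf : IsMemoryKernel f) (hk : k ≤ 2) (hA : IsMaximalDissipative (op hf L k a₀ a₁)) {T : ℝ}
    (hT : 0 < T) :
    ∃ Δ : Energy f L k → BSpace L T × C(Icc (0 : ℝ) T, Lg f L k),
      Continuous Δ ∧ ∀ Φ₀ : Energy f L k,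
        (∀ t : Icc (0 : ℝ) T,
          (Δ Φ₀).1.1.fst t = (hA.semigroup t Φ₀).fst ∧ (Δ Φ₀).2 t = (hA.semigroup t Φ₀).snd) ∧
        ‖(Δ Φ₀).1.1.snd‖ ^ 2 ≤
          smoothingConst L a₀ a₁ T (∫ s in Ioi 0, memG f s) * ‖Φ₀‖ ^ 2 := by
  obtain ⟨V, hV, hVd⟩ := exists_sobOrbit hL ha₀ hf hk hA hT
  have hc1 := hA.continuous_orbit (WithLp.fstL 2 ℝ (L2I L) (Lg f L k)) T
  have hc2 := hA.continuous_orbit (WithLp.sndL 2 ℝ (L2I L) (Lg f L k)) T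
  have hc : Continuous fun x => (hA.orbit (WithLp.fstL 2 ℝ (L2I L) (Lg f L k)) T x, V x) :=
    hc1.prodMk V.continuous
  have hmem : ∀ x, ∀ᵐ t ∂(volume.restrict (Ioo 0 T)), ∀ ht : t ∈ Icc 0 T,
      (V x t).1 0 = hA.orbit (WithLp.fstL 2 ℝ (L2I L) (Lg f L k)) T x ⟨t, ht⟩ := fun x =>
    -- The data for which both components are the same function of `t` form a closed set containing
    -- the dense domain.
    ((isClosed_setOf_sob_eq L T).preimage hc).closure_subset_iff.2 hVd (hA.dense_domain x)
  exact ⟨fun x => (⟨WithLp.toLp 1 (hA.orbit (WithLp.fstL 2 ℝ (L2I L) (Lg f L k)) T x, V x),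
    hmem x⟩, hA.orbit (WithLp.sndL 2 ℝ (L2I L) (Lg f L k)) T x),
    (((WithLp.prod_continuous_toLp 1 _ _).comp hc).subtype_mk hmem).prodMk hc2,
    fun x => ⟨fun t => ⟨rfl, rfl⟩, hV x⟩⟩

end Regularity

end Kawahara

end

/-- `C` is chosen before `k` and `f`, so the constant depends on the kernel only through `g₀ = ∫ g`.
Membership of `u` in `L²(0, T; H²(I))` is contained in the existence of `Δ`, whose first component
takes values in `BSpace`. -/
theorem theorem3p1 (L a₀ a₁ : ℝ) (hL : 0 < L) (ha₀ : 0 < a₀) :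
    ∃ C : ℝ → ℝ → ℝ, (∀ T g₀ : ℝ, 0 < T → 0 < g₀ → 0 < C T g₀) ∧
      ∀ k : ℕ, k ≤ 2 → ∀ (f : ℝ → ℝ) (hf : Kawahara.IsMemoryKernel f),
        ∃ S : ℝ → Kawahara.Energy f L k →L[ℝ] Kawahara.Energy f L k,
          Kawahara.IsContractionSemigroup S ∧
          Kawahara.IsGenerator (Kawahara.op hf L k a₀ a₁) S ∧
          (∀ Φ₀ ∈ (Kawahara.op hf L k a₀ a₁).domain, ∃ Φ : ℝ → Kawahara.Energy f L k,
            Kawahara.IsClassicalSolution (Kawahara.op hf L k a₀ a₁) Φ₀ Φ ∧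
            Kawahara.IsContinuousIntoDomain (Kawahara.op hf L k a₀ a₁) Φ ∧
            ContDiffOn ℝ 1 Φ (Set.Ici 0) ∧
            (∀ t, 0 ≤ t → Φ t = S t Φ₀) ∧
            ∀ Ψ, Kawahara.IsClassicalSolution (Kawahara.op hf L k a₀ a₁) Φ₀ Ψ →
              Set.EqOn Ψ Φ (Set.Ici 0)) ∧
          (∀ Φ₀ : Kawahara.Energy f L k, ∃ Φ : ℝ → Kawahara.Energy f L k,
            Kawahara.IsMildSolution (Kawahara.op hf L k a₀ a₁) Φ₀ Φ ∧
            (∀ t, 0 ≤ t → Φ t = S t Φ₀) ∧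
            ∀ Ψ, Kawahara.IsMildSolution (Kawahara.op hf L k a₀ a₁) Φ₀ Ψ →
              Set.EqOn Ψ Φ (Set.Ici 0)) ∧
          ∀ T : ℝ, 0 < T →
            ∃ Δ : Kawahara.Energy f L k →
                Kawahara.BSpace L T × C(Set.Icc (0 : ℝ) T, Kawahara.Lg f L k),
              Continuous Δ ∧
              ∀ Φ₀ : Kawahara.Energy f L k,
                (∀ t : Set.Icc (0 : ℝ) T,
                  (Δ Φ₀).1.1.fst t = (S t Φ₀).fst ∧ (Δ Φ₀).2 t = (S t Φ₀).snd) ∧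
                ‖(Δ Φ₀).1.1.snd‖ ^ 2 ≤ C T (∫ s in Set.Ioi 0, Kawahara.memG f s) * ‖Φ₀‖ ^ 2 := by
  refine ⟨Kawahara.smoothingConst L a₀ a₁,
    fun T g₀ hT hg => Kawahara.smoothingConst_pos hL ha₀ hT hg, fun k hk f hf => ?_⟩
  have := Kawahara.completeSpace_energy (f := f) (k := k) hL
  have hA := Kawahara.isMaximalDissipative_op (a₁ := a₁) hL ha₀ hf hk
  exact ⟨hA.semigroup, hA.isContractionSemigroup, hA.isGenerator,
    fun Φ₀ h => ⟨fun t => hA.semigroup t Φ₀, hA.isClassicalSolution h,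
      hA.isContinuousIntoDomain h, hA.contDiffOn_semigroup h, fun _ _ => rfl,
      fun Ψ hΨ => hA.classical_unique h hΨ⟩,
    fun Φ₀ => ⟨fun t => hA.semigroup t Φ₀, hA.isMildSolution Φ₀, fun _ _ => rfl,
      fun Ψ hΨ => hA.mild_unique hΨ⟩,
    fun T hT => Kawahara.exists_solutionMap hL ha₀ hf hk hA hT⟩
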